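/- A QAC circuit is a quantum circuit made of arbitrary single-qubit unitaries and generalized Toffoli gates $|x_1,\dots,x_k\rangle|b\rangle\mapsto|x_1,\dots,x_k\rangle|b\oplus(x_1\wedge\cdots\wedge x_k)\rangle$, $k\ge1$. It has depth $D$ if it is a product of $D$ layers, each consisting of gates acting on disjoint sets of qubits, and its size is the number of its gates plus the number of its qubits. On an $N$-bit input $x$, a circuit $C$ with $a$ ancillas outputs the result $C(x)\in\{0,1\}$ of measuring the last qubit of $C|x\rangle|0^a\rangle|0\rangle$ in the computational basis. For $y_1,\dots,y_m\in\{0,1\}^n$ let $\mathrm{Parity}^{\uparrow m}(y_1,\dots,y_m)=\mathrm{Parity}(y_1)$ if $y_1=\cdots=y_m$, and $0$ otherwise. **Theorem (parity with $n^{1.5}/\mathrm{polylog}(n)$ copies).** For all constants $c,d\in\mathbb{N}$ there are constants $D,K\in\mathbb{N}$ such that for every $n\ge2$ and every positive integer $m\ge n^{3/2}/(\log_2 n)^d$ (in particular for $m=\lceil n^{3/2}/(\log_2 n)^d\rceil$) there is a family $\{C_r\}$ of QAC circuits on $nm$ input bits, indexed by the strings $r\in\{0,1\}^n$ of even Hamming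 weight, each of depth at most $D$ and size at most $(nm)^K+K$, such that for all $y_1,\dots,y_m\in\{0,1\}^n$ $$\Pr\left[C_r(y_1,\dots,y_m)=\mathrm{Parity}^{\uparrow m}(y_1,\dots,y_m)\right]\ \ge\ 1-2^{-(\log_2 n)^c},$$ where the probability is over a uniformly random string $r\in\{0,1\}^n$ of even Hamming weight and the measurement outcome. Moreover, the circuits $C_r$ differ only by the shift $r$: there is one QAC circuit $C$ such that each $C_r$ consists of a layer of NOT gates replacing each $y_i$ by $y_i\oplus r$, followed by $C$. -/

import Mathlib

namespace QAC

section Circuits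

variable (Q : Type) [Fintype Q] [DecidableEq Q]

/-- A (not necessarily normalized) state vector on the qubits `Q`: the amplitude of each
computational basis state. -/
abbrev State : Type := (Q → Bool) → ℂ

/-- The gates of a QAC circuit on the qubits `Q`: an arbitrary single-qubit unitary (rows and columns
indexed by the basis states `false = |0⟩`, `true = |1⟩`), or a generalized Toffoli gate, which flips
the target `t` exactly when all the qubits of the nonempty control set `S` are in state `1`. -/
inductive Gate : Type
  | single (i : Q) (U : Matrix.unitaryGroup Bool ℂ) : Gate
  | toffoli (S : Finset Q) (t : Q) (hS : S.Nonempty) (ht : t ∉ S) : Gate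

variable {Q}

/-- The set of qubits a gate operates on. -/
def Gate.support : Gate Q → Finset Q
  | .single i _ => {i}
  | .toffoli S t _ _ => insert t S

/-- The action of a gate on state vectors. The Toffoli gate sends the basis state `x` to
`x` with bit `t` replaced by `x t ⊕ AND (x s : s ∈ S)`, and this permutation of the basis states is
its own inverse. -/
noncomputable def Gate.act : Gate Q → State Q → State Q
  | .single i U, ψ => fun x => ∑ b : Bool, (U : Matrix Bool Bool ℂ) (x i) b * ψ (Function.update x i b)
  | .toffoli S t _ _, ψ => fun x =>
      ψ (Function.update x t (xor (x t) (decide (∀ s ∈ S, x s = true))))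

variable (Q) in
/-- A QAC circuit on the qubits `Q`: a sequence of layers (the first one is applied first), each of
which consists of gates that operate on pairwise disjoint sets of qubits. -/
structure Circuit : Type where
  layers : List (List (Gate Q))
  disjoint : ∀ L ∈ layers, L.Pairwise (fun g h => Disjoint g.support h.support)

/-- The number of layers. -/
def Circuit.depth (C : Circuit Q) : ℕ := C.layers.length

/-- The number of gates plus the number of qubits. -/
def Circuit.size (C : Circuit Q) : ℕ := (C.layers.map List.length).sum + Fintype.card Q

/-- The state produced by the circuit from the state `ψ`. -/
noncomputable def Circuit.run (C : Circuit Q) (ψ : State Q) : State Q :=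
  C.layers.flatten.foldl (fun φ g => g.act φ) ψ

end Circuits

section Deciding

/-- The qubits of a circuit with an input register `ι`, `a` ancillas and an output qubit. -/
abbrev Qubits (ι : Type) (a : ℕ) : Type := ι ⊕ (Fin a ⊕ Unit)

variable {ι : Type} [Fintype ι] [DecidableEq ι] {a : ℕ}

/-- The initial state `|x⟩|0^a⟩|0⟩`. -/
noncomputable def initState (a : ℕ) (x : ι → Bool) : State (Qubits ι a) :=
  Pi.single (Sum.elim x (fun _ => false)) 1

/-- The probability that measuring the output qubit of `C |x⟩|0^a⟩|0⟩` in the computational basis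
yields `b`. -/
noncomputable def outputProb (C : Circuit (Qubits ι a)) (x : ι → Bool) (b : Bool) : ℝ :=
  ∑ z : Qubits ι a → Bool,
    if z (Sum.inr (Sum.inr ())) = b then ‖C.run (initState a x) z‖ ^ 2 else 0

end Deciding

section Parity

/-- The Hamming weight of a bit string. -/
def weight {n : ℕ} (x : Fin n → Bool) : ℕ := ∑ i, (x i).toNat

/-- The parity function: `1` iff the Hamming weight is congruent to `1` modulo `2`. -/
def parity {n : ℕ} (x : Fin n → Bool) : Bool := decide (weight x % 2 = 1)

/-- The `m`-copy lift of a Boolean function: `f (y 0)` if all the blocks of the input agree,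
and `0` otherwise. -/
def lift {n m : ℕ} [NeZero m] (f : (Fin n → Bool) → Bool) (y : Fin m → Fin n → Bool) : Bool :=
  if ∀ i, y i = y 0 then f (y 0) else false

/-- The bit strings of length `n` with even Hamming weight. -/
abbrev EvenString (n : ℕ) : Type := {r : Fin n → Bool // Even (weight r)}

end Parity

section Shift

/-- The NOT gate on one qubit, as a unitary matrix. -/
def notGate : Matrix.unitaryGroup Bool ℂ :=
  ⟨Matrix.of fun b b' => if b = b' then 0 else 1, by
    rw [Matrix.mem_unitaryGroup_iff]
    ext b b'
    cases b <;> cases b' <;> simp [Matrix.mul_apply, Matrix.star_apply]⟩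

/-- The layer of NOT gates that maps each block `y i` of an input consisting of `m` blocks of `n`
bits to `y i ⊕ r`. -/
def shiftLayer (m : ℕ) {n : ℕ} (a : ℕ) (r : Fin n → Bool) :
    List (Gate (Qubits (Fin m × Fin n) a)) :=
  ((List.finRange m ×ˢ List.finRange n).filter (fun p => r p.2)).map
    (fun p => Gate.single (Sum.inl p) notGate)

end Shift

end QAC

set_option linter.unusedSectionVars false

namespace QAC

/-! ### Single gates: linearity, commutation, inverses, unitarity. -/

section Gates

variable {Q : Type} [Fintype Q] [DecidableEq Q]

/-! Cut the `n` bits into `g` blocks of polylogarithmic length `B`. The parity of a string is the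
parity of the number of its odd blocks, and a shift by an even string preserves it. For a random
even shift the block parities behave like independent fair coins, so the number of odd blocks lies
within `O(√g · P)` of `g / 2` except with probability at most `2 ^ (-P)`, where `P` is a power of
the logarithm of `n` (`card_shift_deviation_le`). It therefore suffices to recognize whether this
number is one of the `O(√g · P)` odd values in that window. Each candidate value gets its own `32 g
P` copies of the input, which makes about `g ^ (3/2) P ^ 2` copies in all; a large enough power of
`log n` as block length brings this below `n ^ (3/2) / (log n) ^ d` (`rows_le`).

Testing one value `k` (`ImplOn.weakFanout`, `ImplOn.weightTest`): full fan-out of a bit is not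
available in constant depth, but a bit can exactly control the preparation of `g` qubits in the
state `vec τ` with `cos τ ^ g = 1 / 2`. So one copy of the `g` block parities yields `g` registers,
each holding a weak copy of every parity. A reflection and a layer of rotations give such a register
an all-zero amplitude proportional to `1 - cos τ ^ (w - k)`, where `w` is the number of odd blocks.
It vanishes for `w = k`, and otherwise the all-zero outcome has probability at least `1 / (8 g ^
2)`. Hence the true value is never excluded, and a wrong one survives its `32 g P · g` registers
with probability at most `exp (-4 P)`. If the parity is even, every odd candidate is wrong whatever
the shift; if it is odd, only the rare shifts that leave the window do harm.

The block parities are computed exactly (`ParityImpl.gadget`, `ParityImpl.tree`). A state supported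
on strings that are constant on `q` chosen qubits, with probability `1 / 2` for each constant (a
nekomata), turns the parity of `q` bits into a relative sign, which is then read off. Such a state
is prepared in constant depth with about `(8 q) ^ q` rows of qubits (`ImplOn.nekomata`). This is
polynomial in `n` for `q = √(log n)`, and a tree of constant height reaches the block length `q ^ (2
w + 1)`, where `w` now denotes `2 (c + 1) + d`. The finitely many small `n` are handled by a single
gadget on all the bits. -/

theorem Gate.act_add_smul (g : Gate Q) (φ ψ : State Q) (c : ℂ) :
    g.act (φ + c • ψ) = g.act φ + c • g.act ψ := by
  cases g with
  | single i U =>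
    funext x
    simp only [Gate.act, Pi.add_apply, Pi.smul_apply, smul_eq_mul, Fintype.sum_bool]
    ring
  | toffoli S t hS ht => rfl

/-- This is what allows circuits on disjoint qubits to be merged layer by layer without increasing
the depth. -/
theorem Gate.act_comm (g h : Gate Q) (hd : Disjoint g.support h.support) (ψ : State Q) :
    g.act (h.act ψ) = h.act (g.act ψ) := by
  have key : ∀ (i : Q) (U : Matrix.unitaryGroup Bool ℂ) (S : Finset Q) (t : Q) (hS : S.Nonempty)
      (ht : t ∉ S), i ∉ insert t S → ∀ ψ : State Q,
      (Gate.single i U).act ((Gate.toffoli S t hS ht).act ψ) =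
        (Gate.toffoli S t hS ht).act ((Gate.single i U).act ψ) := by
    intro i U S t hS ht hi ψ
    simp only [Finset.mem_insert, not_or] at hi
    funext x
    have h1 : ∀ (b : Bool), (∀ s ∈ S, Function.update x i b s = true) ↔ ∀ s ∈ S, x s = true := by
      intro b
      refine forall₂_congr fun s hs => ?_
      rw [Function.update_of_ne]
      rintro rfl
      exact hi.2 hs
    simp only [Gate.act, Function.update_of_ne (Ne.symm hi.1), Function.update_of_ne hi.1, h1]
    refine Finset.sum_congr rfl fun b _ => ?_
    rw [Function.update_comm (Ne.symm hi.1)]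
  cases g with
  | single i U =>
    cases h with
    | single j V =>
      have hij : i ≠ j := by
        rintro rfl
        simp [Gate.support] at hd
      funext x
      simp only [Gate.act, Function.update_of_ne hij, Function.update_of_ne hij.symm,
        Finset.mul_sum]
      rw [Finset.sum_comm]
      refine Finset.sum_congr rfl fun b _ => Finset.sum_congr rfl fun b' _ => ?_
      rw [Function.update_comm hij]
      ring
    | toffoli S t hS ht => exact key i U S t hS ht (by simpa [Gate.support] using hd) ψ
  | toffoli S t hS ht =>
    cases h with
    | single i U => exact (key i U S t hS ht (by simpa [Gate.support] using hd) ψ).symm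
    | toffoli S' t' hS' ht' =>
      have hd' := hd
      simp only [Gate.support, Finset.disjoint_left, Finset.mem_insert, not_or] at hd
      have htt : t ≠ t' := (hd (Or.inl rfl)).1
      have h1 : ∀ (x : Q → Bool) (b : Bool),
          (∀ s ∈ S', Function.update x t b s = true) ↔ ∀ s ∈ S', x s = true := by
        intro x b
        refine forall₂_congr fun s hs => ?_
        rw [Function.update_of_ne]
        rintro rfl
        exact (hd (Or.inl rfl)).2 hs
      have h2 : ∀ (x : Q → Bool) (b : Bool),
          (∀ s ∈ S, Function.update x t' b s = true) ↔ ∀ s ∈ S, x s = true := by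
        intro x b
        refine forall₂_congr fun s hs => ?_
        rw [Function.update_of_ne]
        rintro rfl
        exact (hd (Or.inr hs)).1 rfl
      funext x
      simp only [Gate.act, Function.update_of_ne htt, Function.update_of_ne htt.symm, h1, h2]
      rw [Function.update_comm htt]

/-- The inverse gate. -/
def Gate.inv : Gate Q → Gate Q
  | .single i U => .single i U⁻¹
  | .toffoli S t hS ht => .toffoli S t hS ht

@[simp] theorem Gate.support_inv (g : Gate Q) : g.inv.support = g.support := by cases g <;> rfl

theorem Gate.inv_inv (g : Gate Q) : g.inv.inv = g := by cases g <;> simp [Gate.inv]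

theorem unitary_mul_inv_apply (U : Matrix.unitaryGroup Bool ℂ) (a b : Bool) :
    ∑ c, (U : Matrix Bool Bool ℂ) a c * ((U⁻¹ : Matrix.unitaryGroup Bool ℂ) : Matrix Bool Bool ℂ) c b
      = if a = b then 1 else 0 := by
  have h : ((U * U⁻¹ : Matrix.unitaryGroup Bool ℂ) : Matrix Bool Bool ℂ) a b
      = (1 : Matrix Bool Bool ℂ) a b := by
    rw [mul_inv_cancel]; rfl
  rw [Matrix.one_apply] at h
  rw [← h]
  rfl

theorem unitary_star_mul_apply (U : Matrix.unitaryGroup Bool ℂ) (a b : Bool) :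
    ∑ c, star ((U : Matrix Bool Bool ℂ) c a) * (U : Matrix Bool Bool ℂ) c b
      = if a = b then 1 else 0 := by
  have h := Matrix.mem_unitaryGroup_iff'.1 U.2
  have h2 : (star (U : Matrix Bool Bool ℂ) * (U : Matrix Bool Bool ℂ)) a b
      = (1 : Matrix Bool Bool ℂ) a b := by rw [h]
  rw [Matrix.one_apply] at h2
  rw [← h2]
  rfl

theorem Gate.act_act_inv (g : Gate Q) (ψ : State Q) : g.act (g.inv.act ψ) = ψ := by
  cases g with
  | single i U =>
    funext x
    simp only [Gate.act, Gate.inv, Function.update_self, Function.update_idem, Finset.mul_sum]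
    rw [Finset.sum_comm]
    simp only [← mul_assoc, ← Finset.sum_mul, unitary_mul_inv_apply]
    simp
  | toffoli S t hS ht =>
    funext x
    have h1 : ∀ (b : Bool), (∀ s ∈ S, Function.update x t b s = true) ↔ ∀ s ∈ S, x s = true := by
      intro b
      refine forall₂_congr fun s hs => ?_
      rw [Function.update_of_ne]
      rintro rfl
      exact ht hs
    simp only [Gate.act, Gate.inv, Function.update_self, Function.update_idem, h1]
    simp

theorem Gate.act_inv_act (g : Gate Q) (ψ : State Q) : g.inv.act (g.act ψ) = ψ := by
  have := g.inv.act_act_inv ψ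
  rwa [Gate.inv_inv] at this

/-- The inner product of two state vectors. -/
noncomputable def ip (φ ψ : State Q) : ℂ := ∑ z, star (φ z) * ψ z

/-- Every string arises from exactly two pairs `(z, c)`. Grouping strings that differ only at `i`
reduces the unitarity of a single-qubit gate to an identity for 2×2 matrices. -/
theorem sum_update_bool {M : Type*} [AddCommMonoid M]
    (F : (Q → Bool) → M) (i : Q) :
    ∑ z, ∑ c, F (Function.update z i c) = 2 • ∑ z, F z := by
  have h1 : ∀ z : Q → Bool, ∑ c, F (Function.update z i c)
      = F z + F (Function.update z i (!z i)) := by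
    intro z
    rw [Fintype.sum_bool]
    cases h : z i
    · rw [add_comm]; congr 2; rw [← h, Function.update_eq_self]
    · congr 2; rw [← h, Function.update_eq_self]
  have hinv : Function.Involutive (fun z : Q → Bool => Function.update z i (!z i)) := by
    intro z
    simp
  rw [Finset.sum_congr rfl fun z _ => h1 z, Finset.sum_add_distrib, two_nsmul]
  congr 1
  exact Equiv.sum_comp hinv.toPerm F

theorem Gate.ip_act (g : Gate Q) (φ ψ : State Q) : ip (g.act φ) (g.act ψ) = ip φ ψ := by
  cases g with
  | single i U =>
    have h2 : (2 : ℂ) ≠ 0 := two_ne_zero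
    apply mul_left_cancel₀ h2
    have e1 := sum_update_bool (fun z => star ((Gate.single i U).act φ z) *
      (Gate.single i U).act ψ z) i
    have e2 := sum_update_bool (fun z => star (φ z) * ψ z) i
    rw [nsmul_eq_mul, Nat.cast_ofNat] at e1 e2
    rw [ip, ip, ← e1, ← e2]
    refine Finset.sum_congr rfl fun z _ => ?_
    have u00 := unitary_star_mul_apply U false false
    have u01 := unitary_star_mul_apply U false true
    have u10 := unitary_star_mul_apply U true false
    have u11 := unitary_star_mul_apply U true true
    simp only [Fintype.sum_bool, if_true, Bool.false_eq_true, Bool.true_eq_false, if_false]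
      at u00 u01 u10 u11
    simp only [Gate.act, Function.update_self, Function.update_idem, Fintype.sum_bool, star_add,
      star_mul']
    linear_combination
      star (φ (Function.update z i false)) * ψ (Function.update z i false) * u00 +
      star (φ (Function.update z i false)) * ψ (Function.update z i true) * u01 +
      star (φ (Function.update z i true)) * ψ (Function.update z i false) * u10 +
      star (φ (Function.update z i true)) * ψ (Function.update z i true) * u11
  | toffoli S t hS ht =>
    have hinv : Function.Involutive (fun x : Q → Bool =>
        Function.update x t (xor (x t) (decide (∀ s ∈ S, x s = true)))) := by
      intro x
      have h1 : ∀ (b : Bool), (∀ s ∈ S, Function.update x t b s = true) ↔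
          ∀ s ∈ S, x s = true := by
        intro b
        refine forall₂_congr fun s hs => ?_
        rw [Function.update_of_ne]
        rintro rfl
        exact ht hs
      simp only [Function.update_self, Function.update_idem, h1]
      simp
    exact Equiv.sum_comp hinv.toPerm (fun z => star (φ z) * ψ z)

/-- The gate moved along an embedding of the qubits. -/
def Gate.map {R : Type} (e : R ↪ Q) : Gate R → Gate Q
  | .single i U => .single (e i) U
  | .toffoli S t hS ht => .toffoli (S.map e) (e t) (hS.map) (by simpa using ht)

end Gates

/-! ### Lists of gates, side-by-side composition, and registers embedded in larger ones. -/

section Run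

variable {Q : Type} [Fintype Q] [DecidableEq Q]

/-- The state produced by a list of gates. -/
noncomputable def runList (l : List (Gate Q)) (ψ : State Q) : State Q :=
  l.foldl (fun φ g => g.act φ) ψ

@[simp] theorem runList_nil (ψ : State Q) : runList [] ψ = ψ := rfl

@[simp] theorem runList_cons (g : Gate Q) (l : List (Gate Q)) (ψ : State Q) :
    runList (g :: l) ψ = runList l (g.act ψ) := rfl

theorem runList_append (l l' : List (Gate Q)) (ψ : State Q) :
    runList (l ++ l') ψ = runList l' (runList l ψ) := List.foldl_append

theorem runList_add_smul (l : List (Gate Q)) (φ ψ : State Q) (c : ℂ) :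
    runList l (φ + c • ψ) = runList l φ + c • runList l ψ := by
  induction l generalizing φ ψ with
  | nil => rfl
  | cons g l ih => simp only [runList_cons, Gate.act_add_smul, ih]

theorem ip_runList (l : List (Gate Q)) (φ ψ : State Q) :
    ip (runList l φ) (runList l ψ) = ip φ ψ := by
  induction l generalizing φ ψ with
  | nil => rfl
  | cons g l ih => simp only [runList_cons, ih, Gate.ip_act]

theorem runList_act_comm (l : List (Gate Q)) (g : Gate Q)
    (h : ∀ g' ∈ l, Disjoint g.support g'.support) (ψ : State Q) :
    runList l (g.act ψ) = g.act (runList l ψ) := by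
  induction l generalizing ψ with
  | nil => rfl
  | cons g' l ih =>
    simp only [List.mem_cons, forall_eq_or_imp] at h
    rw [runList_cons, ← g.act_comm g' h.1, ih h.2, runList_cons]

theorem runList_comm (l l' : List (Gate Q))
    (h : ∀ g ∈ l, ∀ g' ∈ l', Disjoint g.support g'.support) (ψ : State Q) :
    runList l (runList l' ψ) = runList l' (runList l ψ) := by
  induction l generalizing ψ with
  | nil => rfl
  | cons g l ih =>
    simp only [List.mem_cons, forall_eq_or_imp] at h
    rw [runList_cons, ← runList_act_comm l' g h.1, ih h.2, runList_cons]

theorem runList_inv (l : List (Gate Q)) (ψ : State Q) :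
    runList (l.reverse.map Gate.inv) (runList l ψ) = ψ := by
  induction l generalizing ψ with
  | nil => rfl
  | cons g l ih =>
    simp only [List.reverse_cons, List.map_append, runList_append, runList_cons, ih]
    simp [Gate.act_inv_act]

theorem runList_inv' (l : List (Gate Q)) (ψ : State Q) :
    runList l (runList (l.reverse.map Gate.inv) ψ) = ψ := by
  have h := runList_inv (l.reverse.map Gate.inv) ψ
  have e : ((l.reverse.map Gate.inv).reverse.map Gate.inv) = l := by
    rw [← List.map_reverse, List.reverse_reverse, List.map_map]
    conv_rhs => rw [← List.map_id l]
    exact List.map_congr_left fun g _ => g.inv_inv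
  rwa [e] at h

/-- The layers of two circuits side by side. -/
def zipLayers : List (List (Gate Q)) → List (List (Gate Q)) → List (List (Gate Q))
  | [], B => B
  | A, [] => A
  | a :: A, b :: B => (a ++ b) :: zipLayers A B

theorem length_zipLayers (A B : List (List (Gate Q))) :
    (zipLayers A B).length = max A.length B.length := by
  induction A generalizing B with
  | nil => simp [zipLayers]
  | cons a A ih =>
    cases B with
    | nil => simp [zipLayers]
    | cons b B => simp [zipLayers, ih]

theorem mem_zipLayers {A B : List (List (Gate Q))} {L : List (Gate Q)} (h : L ∈ zipLayers A B) :
    L ∈ A ∨ L ∈ B ∨ ∃ a ∈ A, ∃ b ∈ B, L = a ++ b := by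
  induction A generalizing B with
  | nil => simp only [zipLayers] at h; exact Or.inr (Or.inl h)
  | cons a A ih =>
    cases B with
    | nil => simp only [zipLayers] at h; exact Or.inl h
    | cons b B =>
      simp only [zipLayers, List.mem_cons] at h
      rcases h with rfl | h
      · exact Or.inr (Or.inr ⟨a, by simp, b, by simp, rfl⟩)
      · rcases ih h with h | h | ⟨a', ha, b', hb, rfl⟩
        · exact Or.inl (by simp [h])
        · exact Or.inr (Or.inl (by simp [h]))
        · exact Or.inr (Or.inr ⟨a', by simp [ha], b', by simp [hb], rfl⟩)

theorem runList_zipLayers (A B : List (List (Gate Q)))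
    (h : ∀ g ∈ A.flatten, ∀ g' ∈ B.flatten, Disjoint g.support g'.support) (ψ : State Q) :
    runList (zipLayers A B).flatten ψ = runList B.flatten (runList A.flatten ψ) := by
  induction A generalizing B ψ with
  | nil => simp [zipLayers]
  | cons a A ih =>
    cases B with
    | nil => simp [zipLayers]
    | cons b B =>
      simp only [List.flatten_cons, List.mem_append] at h
      simp only [zipLayers, List.flatten_cons, runList_append]
      rw [ih B (fun g hg g' hg' => h g (Or.inr hg) g' (Or.inr hg')),
        runList_comm A.flatten b (fun g hg g' hg' => h g (Or.inr hg) g' (Or.inl hg'))]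

/-- Throughout, `Function.extend e y z` is the string `z` with the register `e` overwritten by `y`.
-/
theorem extend_comp {R : Type} (e : R ↪ Q) (z : Q → Bool) (y : R → Bool) :
    (fun r => Function.extend e y z (e r)) = y := by
  funext r
  exact e.injective.extend_apply y z r

theorem extend_off {R : Type} (e : R ↪ Q) (z : Q → Bool) (y : R → Bool) {q : Q}
    (hq : q ∉ Set.range e) : Function.extend e y z q = z q :=
  Function.extend_apply' _ _ _ (by simpa using hq)

theorem extend_extend {R : Type} (e : R ↪ Q) (z : Q → Bool) (y y' : R → Bool) :
    Function.extend e y' (Function.extend e y z) = Function.extend e y' z := by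
  funext q
  by_cases hq : q ∈ Set.range e
  · obtain ⟨r, rfl⟩ := hq
    rw [e.injective.extend_apply, e.injective.extend_apply]
  · rw [extend_off e _ _ hq, extend_off e _ _ hq, extend_off e _ _ hq]

theorem update_eq_extend {R : Type} [Fintype R] [DecidableEq R] (e : R ↪ Q) (z : Q → Bool) (r : R) (b : Bool) :
    Function.update z (e r) b
      = Function.extend e (Function.update (fun r => z (e r)) r b) z := by
  funext q
  by_cases hq : q ∈ Set.range e
  · obtain ⟨r', rfl⟩ := hq
    rw [e.injective.extend_apply]
    by_cases h : r' = r
    · subst h; simp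
    · rw [Function.update_of_ne h, Function.update_of_ne (fun h' => h (e.injective h'))]
  · rw [extend_off e _ _ hq, Function.update_of_ne]
    rintro rfl
    exact hq ⟨r, rfl⟩

/-- An operator on the states of `R`, acting on the qubits `e r` of a state of `Q`. -/
noncomputable def liftOp {R : Type} (e : R ↪ Q) (T : State R → State R) (ψ : State Q) : State Q :=
  fun z => T (fun y => ψ (Function.extend e y z)) (fun r => z (e r))

theorem Gate.act_map {R : Type} [Fintype R] [DecidableEq R] (e : R ↪ Q) (g : Gate R) :
    (g.map e).act = liftOp e g.act := by
  funext ψ z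
  cases g with
  | single i U =>
    simp only [Gate.map, Gate.act, liftOp, update_eq_extend]
  | toffoli S t hS ht =>
    simp only [Gate.map, Gate.act, liftOp, update_eq_extend, Finset.mem_map,
      forall_exists_index, and_imp, forall_apply_eq_imp_iff₂]

theorem liftOp_comp {R : Type} (e : R ↪ Q) (T T' : State R → State R) (ψ : State Q) :
    liftOp e T (liftOp e T' ψ) = liftOp e (T ∘ T') ψ := by
  funext z
  simp only [liftOp, extend_comp, extend_extend, Function.comp_apply]

theorem runList_map {R : Type} [Fintype R] [DecidableEq R] (e : R ↪ Q) (l : List (Gate R)) :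
    runList (l.map (Gate.map e)) = liftOp e (runList l) := by
  induction l with
  | nil =>
    funext ψ z
    simp only [List.map_nil, runList_nil, liftOp]
    congr 1
    funext q
    by_cases hq : q ∈ Set.range e
    · obtain ⟨r, rfl⟩ := hq
      rw [e.injective.extend_apply]
    · rw [extend_off e _ _ hq]
  | cons g l ih =>
    funext ψ
    rw [List.map_cons, runList_cons, ih, Gate.act_map, liftOp_comp]
    rfl

end Run

/-! ### Operators realized in bounded depth, and how they compose. -/

section Impl

variable {Q : Type} [Fintype Q] [DecidableEq Q]

theorem Circuit.run_eq (C : Circuit Q) : C.run = runList C.layers.flatten := rfl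

theorem Gate.support_nonempty (g : Gate Q) : g.support.Nonempty := by
  cases g <;> simp [Gate.support]

theorem length_le_card_of_pairwise_disjoint (L : List (Gate Q))
    (h : L.Pairwise (fun g h => Disjoint g.support h.support)) : L.length ≤ Fintype.card Q := by
  have key : ∀ L : List (Gate Q), L.Pairwise (fun g h => Disjoint g.support h.support) →
      ∃ S : Finset Q, L.length ≤ S.card ∧ ∀ q ∈ S, ∃ g ∈ L, q ∈ g.support := by
    intro L
    induction L with
    | nil => intro _; exact ⟨∅, by simp, by simp⟩
    | cons g L ih =>
      intro h
      rw [List.pairwise_cons] at h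
      obtain ⟨S, hS, hS'⟩ := ih h.2
      obtain ⟨q, hq⟩ := g.support_nonempty
      have hqS : q ∉ S := by
        intro hqS
        obtain ⟨g', hg', hq'⟩ := hS' q hqS
        exact Finset.disjoint_left.1 (h.1 g' hg') hq hq'
      refine ⟨insert q S, ?_, ?_⟩
      · rw [Finset.card_insert_of_notMem hqS, List.length_cons]; omega
      · intro q' hq'
        rcases Finset.mem_insert.1 hq' with rfl | hq'
        · exact ⟨g, by simp, hq⟩
        · obtain ⟨g', hg', h'⟩ := hS' q' hq'
          exact ⟨g', by simp [hg'], h'⟩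
  obtain ⟨S, hS, -⟩ := key L h
  exact hS.trans (Finset.card_le_univ S)

/-- Gates of one layer have disjoint nonempty supports, so a layer has at most one gate per qubit.
From here on only the depth and the number of ancillas need to be tracked. -/
theorem Circuit.size_le (C : Circuit Q) : C.size ≤ (C.depth + 1) * Fintype.card Q := by
  have key : ∀ Ls : List (List (Gate Q)),
      (∀ L ∈ Ls, L.Pairwise (fun g h => Disjoint g.support h.support)) →
      (Ls.map List.length).sum ≤ Ls.length * Fintype.card Q := by
    intro Ls
    induction Ls with
    | nil => intro _; simp
    | cons L Ls ih =>
      intro h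
      simp only [List.mem_cons, forall_eq_or_imp] at h
      have h1 := length_le_card_of_pairwise_disjoint L h.1
      have h2 := ih h.2
      simp only [List.map_cons, List.sum_cons, List.length_cons, add_mul, one_mul]
      omega
  have := key C.layers C.disjoint
  simp only [Circuit.size, Circuit.depth, add_mul, one_mul]
  omega

/-- The operator `T` is the action of a circuit of depth at most `d` on the qubits in `S`. -/
def ImplOn (S : Set Q) (d : ℕ) (T : State Q → State Q) : Prop :=
  ∃ C : Circuit Q, C.depth ≤ d ∧ (∀ g ∈ C.layers.flatten, ∀ q ∈ g.support, q ∈ S) ∧ C.run = T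

theorem ImplOn.mono {S S' : Set Q} {d d' : ℕ} {T : State Q → State Q} (h : ImplOn S d T)
    (hS : S ⊆ S') (hd : d ≤ d') : ImplOn S' d' T := by
  obtain ⟨C, h1, h2, h3⟩ := h
  exact ⟨C, h1.trans hd, fun g hg q hq => hS (h2 g hg q hq), h3⟩

theorem ImplOn.id (S : Set Q) : ImplOn S 0 (fun ψ => ψ) :=
  ⟨⟨[], by simp⟩, by simp [Circuit.depth], by simp, rfl⟩

theorem ImplOn.comp {S : Set Q} {d d' : ℕ} {T T' : State Q → State Q} (h : ImplOn S d T)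
    (h' : ImplOn S d' T') : ImplOn S (d + d') (fun ψ => T' (T ψ)) := by
  obtain ⟨C, h1, h2, rfl⟩ := h
  obtain ⟨C', h1', h2', rfl⟩ := h'
  refine ⟨⟨C.layers ++ C'.layers, ?_⟩, ?_, ?_, ?_⟩
  · intro L hL
    rcases List.mem_append.1 hL with hL | hL
    · exact C.disjoint L hL
    · exact C'.disjoint L hL
  · simp only [Circuit.depth, List.length_append] at *
    omega
  · intro g hg
    simp only [List.flatten_append, List.mem_append] at hg
    rcases hg with hg | hg
    · exact h2 g hg
    · exact h2' g hg
  · funext ψ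
    simp only [Circuit.run_eq, List.flatten_append, runList_append]

theorem ImplOn.par {S S' : Set Q} {d : ℕ} {T T' : State Q → State Q} (h : ImplOn S d T)
    (h' : ImplOn S' d T') (hd : Disjoint S S') : ImplOn (S ∪ S') d (fun ψ => T' (T ψ)) := by
  obtain ⟨C, h1, h2, rfl⟩ := h
  obtain ⟨C', h1', h2', rfl⟩ := h'
  have hdis : ∀ g ∈ C.layers.flatten, ∀ g' ∈ C'.layers.flatten,
      Disjoint g.support g'.support := by
    intro g hg g' hg'
    rw [Finset.disjoint_left]
    intro q hq hq'
    exact Set.disjoint_left.1 hd (h2 g hg q hq) (h2' g' hg' q hq')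
  refine ⟨⟨zipLayers C.layers C'.layers, ?_⟩, ?_, ?_, ?_⟩
  · intro L hL
    rcases mem_zipLayers hL with hL | hL | ⟨a, ha, b, hb, rfl⟩
    · exact C.disjoint L hL
    · exact C'.disjoint L hL
    · rw [List.pairwise_append]
      refine ⟨C.disjoint a ha, C'.disjoint b hb, fun g hg g' hg' => hdis g ?_ g' ?_⟩
      · exact List.mem_flatten.2 ⟨a, ha, hg⟩
      · exact List.mem_flatten.2 ⟨b, hb, hg'⟩
  · simp only [Circuit.depth, length_zipLayers] at *
    omega
  · intro g hg q hq
    obtain ⟨L, hL, hg⟩ := List.mem_flatten.1 hg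
    rcases mem_zipLayers hL with hL | hL | ⟨a, ha, b, hb, rfl⟩
    · exact Or.inl (h2 g (List.mem_flatten.2 ⟨L, hL, hg⟩) q hq)
    · exact Or.inr (h2' g (List.mem_flatten.2 ⟨L, hL, hg⟩) q hq)
    · rcases List.mem_append.1 hg with hg | hg
      · exact Or.inl (h2 g (List.mem_flatten.2 ⟨a, ha, hg⟩) q hq)
      · exact Or.inr (h2' g (List.mem_flatten.2 ⟨b, hb, hg⟩) q hq)
  · funext ψ
    exact runList_zipLayers _ _ hdis ψ

/-- The sets being pairwise disjoint, all the circuits run simultaneously: the depth is that of one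
of them. -/
theorem ImplOn.foldl {J : Type} {S : J → Set Q} {d : ℕ} {T : J → State Q → State Q}
    (h : ∀ j, ImplOn (S j) d (T j)) (hd : ∀ j j', j ≠ j' → Disjoint (S j) (S j')) (l : List J)
    (hl : l.Nodup) :
    ImplOn (⋃ j ∈ l, S j) d (fun ψ => l.foldl (fun φ j => T j φ) ψ) := by
  induction l with
  | nil => exact (ImplOn.id _).mono le_rfl (Nat.zero_le d)
  | cons j l ih =>
    rw [List.nodup_cons] at hl
    refine ((h j).par (ih hl.2) ?_).mono ?_ le_rfl
    · simp only [Set.disjoint_iUnion_right]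
      intro j' hj'
      exact hd j j' (fun h => hl.1 (h ▸ hj'))
    · simp

theorem ImplOn.gate (g : Gate Q) : ImplOn (g.support : Set Q) 1 g.act :=
  ⟨⟨[[g]], by simp⟩, by simp [Circuit.depth], by simp, by
    funext ψ; simp [Circuit.run_eq]⟩

theorem ImplOn.inv {S : Set Q} {d : ℕ} {T : State Q → State Q} (h : ImplOn S d T) :
    ∃ T', ImplOn S d T' ∧ (∀ ψ, T' (T ψ) = ψ) ∧ ∀ ψ, T (T' ψ) = ψ := by
  obtain ⟨C, h1, h2, rfl⟩ := h
  have hfl : ((C.layers.reverse.map fun L => L.reverse.map Gate.inv)).flatten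
      = C.layers.flatten.reverse.map Gate.inv := by
    simp only [List.reverse_flatten, List.map_flatten, List.map_reverse, List.map_map,
      Function.comp_def]
  refine ⟨_, ⟨⟨C.layers.reverse.map fun L => L.reverse.map Gate.inv, ?_⟩, ?_, ?_, rfl⟩, ?_, ?_⟩
  · intro L hL
    simp only [List.mem_map, List.mem_reverse] at hL
    obtain ⟨L, hL, rfl⟩ := hL
    rw [List.pairwise_map, List.pairwise_reverse]
    refine (C.disjoint L hL).imp ?_
    intro a b hab
    simpa using hab.symm
  · simpa [Circuit.depth] using h1
  · intro g hg
    simp only [hfl, List.mem_map, List.mem_reverse] at hg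
    obtain ⟨g, hg, rfl⟩ := hg
    simpa using h2 g hg
  · intro ψ
    simp only [Circuit.run_eq, hfl]
    exact runList_inv _ ψ
  · intro ψ
    simp only [Circuit.run_eq, hfl]
    exact runList_inv' _ ψ

theorem ImplOn.map {R : Type} [Fintype R] [DecidableEq R] {S : Set R} {d : ℕ}
    {T : State R → State R} (h : ImplOn S d T) (e : R ↪ Q) :
    ImplOn (Set.range e) d (liftOp e T) := by
  obtain ⟨C, h1, h2, rfl⟩ := h
  have hsup : ∀ g : Gate R, (g.map e).support = g.support.map e := by
    intro g
    cases g <;> simp [Gate.map, Gate.support]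
  refine ⟨⟨C.layers.map fun L => L.map (Gate.map e), ?_⟩, ?_, ?_, ?_⟩
  · intro L hL
    obtain ⟨L', hL', rfl⟩ := List.mem_map.1 hL
    rw [List.pairwise_map]
    refine (C.disjoint L' hL').imp ?_
    intro a b hab
    rw [hsup, hsup, Finset.disjoint_map]
    exact hab
  · simpa [Circuit.depth] using h1
  · intro g hg q hq
    rw [← List.map_flatten] at hg
    obtain ⟨g, hg, rfl⟩ := List.mem_map.1 hg
    rw [hsup] at hq
    obtain ⟨r, -, rfl⟩ := Finset.mem_map.1 hq
    exact ⟨r, rfl⟩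
  · rw [Circuit.run_eq, Circuit.run_eq, ← runList_map, ← List.map_flatten]

theorem ImplOn.add_smul {S : Set Q} {d : ℕ} {T : State Q → State Q} (h : ImplOn S d T)
    (φ ψ : State Q) (c : ℂ) : T (φ + c • ψ) = T φ + c • T ψ := by
  obtain ⟨C, h1, h2, rfl⟩ := h
  exact runList_add_smul _ _ _ _

theorem ImplOn.smul {S : Set Q} {d : ℕ} {T : State Q → State Q} (h : ImplOn S d T)
    (ψ : State Q) (c : ℂ) : T (c • ψ) = c • T ψ := by
  have h0 : T 0 = 0 := by
    have := h.add_smul 0 0 1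
    simpa using this
  have := h.add_smul 0 ψ c
  rwa [zero_add, h0, zero_add] at this

theorem ImplOn.ip_eq {S : Set Q} {d : ℕ} {T : State Q → State Q} (h : ImplOn S d T)
    (φ ψ : State Q) : ip (T φ) (T ψ) = ip φ ψ := by
  obtain ⟨C, h1, h2, rfl⟩ := h
  exact ip_runList _ _ _

end Impl

/-! ### Product states and parallel action on disjoint registers. -/

section Product

variable {Q : Type} [Fintype Q] [DecidableEq Q]

/-- The product state whose qubit `q` is in the state `v q`. -/
noncomputable def prodQ (v : Q → Bool → ℂ) : State Q := fun z => ∏ q, v q (z q)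

/-- The basis states of one qubit. -/
noncomputable def ket (b : Bool) : Bool → ℂ := fun c => if c = b then 1 else 0

/-- The basis states. -/
noncomputable def basis (b : Q → Bool) : State Q := prodQ fun q => ket (b q)

theorem basis_apply (b z : Q → Bool) : basis b z = if z = b then 1 else 0 := by
  unfold basis prodQ ket
  rw [Finset.prod_ite_zero]
  simp [funext_iff]

theorem ip_basis (b : Q → Bool) (ψ : State Q) : ip (basis b) ψ = ψ b := by
  simp [ip, basis_apply]

theorem ip_prodQ (v w : Q → Bool → ℂ) :
    ip (prodQ v) (prodQ w) = ∏ q, ∑ b, star (v q b) * w q b := by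
  rw [Finset.prod_univ_sum]
  simp only [ip, prodQ, star_prod, Fintype.piFinset_univ, Finset.prod_mul_distrib]

theorem prodQ_factor {J : Type} [Fintype J] {R : J → Type} [∀ j, Fintype (R j)]
    (e : (Σ j, R j) ↪ Q) [DecidablePred (· ∈ Set.range e)] (v : Q → Bool → ℂ) (z : Q → Bool) :
    prodQ v z = (∏ j, ∏ r, v (e ⟨j, r⟩) (z (e ⟨j, r⟩))) *
      ∏ q with q ∉ Set.range e, v q (z q) := by
  rw [prodQ, ← Finset.prod_filter_mul_prod_filter_not Finset.univ (· ∈ Set.range e)]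
  congr 1
  rw [← Fintype.prod_sigma']
  have : (Finset.univ.filter (· ∈ Set.range e)) = Finset.univ.map e := by
    ext q
    simp
  rw [this, Finset.prod_map]

/-- The input must factor over the registers, but the local results may be entangled inside each
register; qubits outside all registers keep their states. -/
theorem ImplOn.sigma {J : Type} [Fintype J] [DecidableEq J] {R : J → Type} [∀ j, Fintype (R j)]
    [∀ j, DecidableEq (R j)] (e : (Σ j, R j) ↪ Q) [DecidablePred (· ∈ Set.range e)]
    {S : ∀ j, Set (R j)} {d : ℕ} {T : ∀ j, State (R j) → State (R j)}
    (h : ∀ j, ImplOn (S j) d (T j)) :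
    ∃ U, ImplOn (Set.univ : Set Q) d U ∧ ∀ v : Q → Bool → ℂ, U (prodQ v) = fun z =>
      (∏ j, T j (prodQ fun r => v (e ⟨j, r⟩)) (fun r => z (e ⟨j, r⟩))) *
        ∏ q with q ∉ Set.range e, v q (z q) := by
  let ej : ∀ j, R j ↪ Q := fun j =>
    ⟨fun r => e ⟨j, r⟩, fun r r' hr => by simpa using e.injective hr⟩
  have hej : ∀ j r, ej j r = e ⟨j, r⟩ := fun j r => rfl
  have hne : ∀ j j', j ≠ j' → ∀ r', e ⟨j', r'⟩ ∉ Set.range (ej j) := by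
    rintro j j' hj r' ⟨r, hr⟩
    have := e.injective hr
    exact hj (congrArg Sigma.fst this)
  have hdis : ∀ j j', j ≠ j' → Disjoint (Set.range (ej j)) (Set.range (ej j')) := by
    intro j j' hj
    rw [Set.disjoint_left]
    rintro q hq ⟨r', rfl⟩
    exact hne j j' hj r' hq
  refine ⟨_, (ImplOn.foldl (fun j => (h j).map (ej j)) hdis Finset.univ.toList
    (Finset.nodup_toList _)).mono (Set.subset_univ _) le_rfl, ?_⟩
  intro v
  -- Acting on register `j` replaces only the `j`-th factor, since all the other factors are
  -- constant in the bits of that register.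
  have step : ∀ (f : ∀ j, State (R j)) (j : J),
      liftOp (ej j) (T j) (fun z => (∏ j, f j (fun r => z (e ⟨j, r⟩))) *
        ∏ q with q ∉ Set.range e, v q (z q)) =
      fun z => (∏ i, Function.update f j (T j (f j)) i (fun r => z (e ⟨i, r⟩))) *
        ∏ q with q ∉ Set.range e, v q (z q) := by
    intro f j
    funext z
    simp only [liftOp]
    have h1 : ∀ y : R j → Bool, (fun r => Function.extend (ej j) y z (e ⟨j, r⟩)) = y :=
      extend_comp (ej j) z
    have h2 : ∀ (y : R j → Bool) (i : J), i ≠ j →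
        (fun r => Function.extend (ej j) y z (e ⟨i, r⟩)) = fun r => z (e ⟨i, r⟩) := by
      intro y i hi
      funext r
      exact extend_off (ej j) z y (hne j i hi.symm r)
    have h3 : (fun y : R j → Bool =>
        (∏ i, f i (fun r => Function.extend (ej j) y z (e ⟨i, r⟩))) *
        ∏ q with q ∉ Set.range e, v q (Function.extend (ej j) y z q)) =
        ((∏ i ∈ Finset.univ.erase j, f i (fun r => z (e ⟨i, r⟩))) *
          ∏ q with q ∉ Set.range e, v q (z q)) • f j := by
      funext y
      rw [← Finset.mul_prod_erase _ _ (Finset.mem_univ j), h1]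
      have e1 : ∏ i ∈ Finset.univ.erase j, f i (fun r => Function.extend (ej j) y z (e ⟨i, r⟩))
          = ∏ i ∈ Finset.univ.erase j, f i (fun r => z (e ⟨i, r⟩)) :=
        Finset.prod_congr rfl fun i hi => by rw [h2 y i (Finset.ne_of_mem_erase hi)]
      have e2 : ∏ q with q ∉ Set.range e, v q (Function.extend (ej j) y z q)
          = ∏ q with q ∉ Set.range e, v q (z q) := by
        refine Finset.prod_congr rfl fun q hq => ?_
        rw [extend_off]
        rintro ⟨r, rfl⟩
        exact (Finset.mem_filter.1 hq).2 ⟨⟨j, r⟩, rfl⟩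
      rw [e1, e2]
      simp only [Pi.smul_apply, smul_eq_mul]
      ring
    rw [h3, (h j).smul, ← Finset.mul_prod_erase _ _ (Finset.mem_univ j), Function.update_self]
    have e3 : ∏ i ∈ Finset.univ.erase j, Function.update f j (T j (f j)) i
        (fun r => z (e ⟨i, r⟩)) = ∏ i ∈ Finset.univ.erase j, f i (fun r => z (e ⟨i, r⟩)) :=
      Finset.prod_congr rfl fun i hi => by
        rw [Function.update_of_ne (Finset.ne_of_mem_erase hi)]
    rw [e3]
    simp only [Pi.smul_apply, smul_eq_mul, hej]
    ring
  have main : ∀ (l : List J), l.Nodup → ∀ (f : ∀ j, State (R j)),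
      l.foldl (fun φ j => liftOp (ej j) (T j) φ) (fun z =>
        (∏ j, f j (fun r => z (e ⟨j, r⟩))) * ∏ q with q ∉ Set.range e, v q (z q)) =
      fun z => (∏ j, (if j ∈ l then T j (f j) else f j) (fun r => z (e ⟨j, r⟩))) *
        ∏ q with q ∉ Set.range e, v q (z q) := by
    intro l
    induction l with
    | nil => intro _ f; simp
    | cons j l ih =>
      intro hl f
      rw [List.nodup_cons] at hl
      rw [List.foldl_cons, step, ih hl.2]
      funext z
      congr 1
      refine Finset.prod_congr rfl fun i _ => ?_
      by_cases hi : i = j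
      · subst hi
        simp [hl.1]
      · simp [hi]
  have h0 := main Finset.univ.toList (Finset.nodup_toList _)
    (fun j => prodQ fun r => v (e ⟨j, r⟩))
  have h1 : prodQ v = fun z => (∏ j, (prodQ fun r => v (e ⟨j, r⟩)) (fun r => z (e ⟨j, r⟩))) *
        ∏ q with q ∉ Set.range e, v q (z q) := by
    funext z
    rw [prodQ_factor e v z]
    rfl
  rw [h1, h0]
  simp

theorem ImplOn.sigma_prodQ {J : Type} [Fintype J] [DecidableEq J] {R : J → Type}
    [∀ j, Fintype (R j)] [∀ j, DecidableEq (R j)] (e : (Σ j, R j) ↪ Q)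
    {S : ∀ j, Set (R j)} {d : ℕ} {T : ∀ j, State (R j) → State (R j)}
    (h : ∀ j, ImplOn (S j) d (T j)) :
    ∃ U, ImplOn (Set.univ : Set Q) d U ∧ ∀ v v' : Q → Bool → ℂ,
      (∀ j, T j (prodQ fun r => v (e ⟨j, r⟩)) = prodQ fun r => v' (e ⟨j, r⟩)) →
      (∀ q, q ∉ Set.range e → v' q = v q) → U (prodQ v) = prodQ v' := by
  classical
  obtain ⟨U, hU, hU'⟩ := ImplOn.sigma e h
  refine ⟨U, hU, fun v v' h1 h2 => ?_⟩
  rw [hU']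
  funext z
  rw [prodQ_factor e v' z]
  congr 1
  · exact Finset.prod_congr rfl fun j _ => by rw [h1]; rfl
  · exact Finset.prod_congr rfl fun q hq => by rw [h2 q (Finset.mem_filter.1 hq).2]

end Product

/-! ### Layers of single-qubit gates, and conditional bit flips with arbitrary control patterns. -/

section Singles

variable {Q : Type} [Fintype Q] [DecidableEq Q]

theorem ImplOn.singles (U : Q → Matrix.unitaryGroup Bool ℂ) :
    ∃ A, ImplOn (Set.univ : Set Q) 1 A ∧ ∀ v, A (prodQ v) =
      prodQ fun q b => ∑ c, (U q : Matrix Bool Bool ℂ) b c * v q c := by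
  let e : (Σ _ : Q, Unit) ↪ Q := ⟨fun p => p.1, fun p p' h => by
    obtain ⟨q, _⟩ := p
    obtain ⟨q', _⟩ := p'
    cases h
    rfl⟩
  obtain ⟨A, hA, hA'⟩ := ImplOn.sigma_prodQ e
    (fun q => ImplOn.gate (Gate.single (Q := Unit) () (U q)))
  refine ⟨A, hA, fun v => hA' _ _ ?_ ?_⟩
  · intro q
    funext z
    simp only [Gate.act, prodQ, Fintype.prod_unique, Function.update_self]
    rfl
  · intro q hq
    exact absurd ⟨⟨q, ()⟩, rfl⟩ hq

theorem runList_not (l : List Q) (hl : l.Nodup) (ψ : State Q) (z : Q → Bool) :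
    runList (l.map fun q => Gate.single q notGate) ψ z
      = ψ (fun q => if q ∈ l then !(z q) else z q) := by
  induction l generalizing ψ with
  | nil => simp
  | cons q l ih =>
    rw [List.nodup_cons] at hl
    rw [List.map_cons, runList_cons, ih hl.2]
    have h1 : ∀ w : Q → Bool, (Gate.single q notGate).act ψ w = ψ (Function.update w q (!(w q))) := by
      intro w
      cases h : w q <;> simp [Gate.act, notGate, h]
    rw [h1]
    congr 1
    funext r
    by_cases hr : r = q
    · subst hr; simp [hl.1]
    · simp [hr]

theorem ImplOn.nots (S : Finset Q) :
    ImplOn (S : Set Q) 1 (fun ψ z => ψ (fun q => if q ∈ S then !(z q) else z q)) := by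
  refine ⟨⟨[S.toList.map fun q => Gate.single q notGate], ?_⟩, by simp [Circuit.depth], ?_, ?_⟩
  · simp only [List.mem_singleton, forall_eq, List.pairwise_map]
    refine (Finset.nodup_toList S).imp ?_
    intro a b hab
    simpa [Gate.support] using hab
  · intro g hg q hq
    simp only [List.flatten_cons, List.flatten_nil, List.append_nil, List.mem_map,
      Finset.mem_toList] at hg
    obtain ⟨a, ha, rfl⟩ := hg
    simp only [Gate.support, Finset.mem_singleton] at hq
    exact hq ▸ ha
  · funext ψ z
    rw [Circuit.run_eq]
    simp only [List.flatten_cons, List.flatten_nil, List.append_nil]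
    rw [runList_not _ (Finset.nodup_toList S)]
    simp

/-- The map that flips the bit `t j`, for each `j` such that the qubits in `T j` have the
values `b j`. -/
def flipMap {J : Type} [Fintype J] (T : J → Finset Q) (b : J → Q → Bool) (t : J → Q)
    (z : Q → Bool) : Q → Bool :=
  fun q => xor (z q) (decide (∃ j, t j = q ∧ ∀ s ∈ T j, z s = b j s))

/-- A Toffoli gate conjugated by NOT gates on the controls whose prescribed value is `false`; hence
depth 3. -/
theorem ImplOn.flip (T : Finset Q) (hT : T.Nonempty) (b : Q → Bool) (t : Q) (ht : t ∉ T) :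
    ImplOn ((insert t T : Finset Q) : Set Q) 3
      (fun ψ z => ψ (fun q => xor (z q) (decide (t = q ∧ ∀ s ∈ T, z s = b s)))) := by
  have hsub : ((T.filter fun q => b q = false : Finset Q) : Set Q)
      ⊆ ((insert t T : Finset Q) : Set Q) := by
    intro q hq
    simp only [Finset.coe_filter, Set.mem_ofPred_eq] at hq
    simp [hq.1]
  have hN := (ImplOn.nots (T.filter fun q => b q = false)).mono hsub le_rfl
  have h := (hN.comp (ImplOn.gate (Gate.toffoli T t hT ht))).comp hN
  convert h using 1
  funext ψ z
  simp only [Gate.act]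
  congr 1
  have hc : (∀ s ∈ T, (if s ∈ T.filter (fun q => b q = false) then !(z s) else z s) = true) ↔
      ∀ s ∈ T, z s = b s := by
    refine forall₂_congr fun s hs => ?_
    cases hb : b s <;> simp [hs, hb]
  simp only [hc]
  funext q
  have htf : t ∉ T.filter (fun q => b q = false) := fun h => ht (Finset.mem_filter.1 h).1
  by_cases hq : q = t
  · subst hq
    simp [htf]
  · rw [Function.update_of_ne hq]
    have : ¬ t = q := fun h => hq h.symm
    simp only [this, false_and, decide_false, Bool.xor_false]
    by_cases hm : q ∈ T.filter (fun q => b q = false) <;> simp [hm]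

theorem ImplOn.flips {J : Type} [Fintype J] [DecidableEq J] (T : J → Finset Q)
    (b : J → Q → Bool) (t : J → Q) (hT : ∀ j, (T j).Nonempty) (ht : ∀ j, t j ∉ T j)
    (hd : ∀ j j', j ≠ j' → Disjoint (insert (t j) (T j)) (insert (t j') (T j'))) :
    ImplOn (Set.univ : Set Q) 3 (fun ψ z => ψ (flipMap T b t z)) := by
  have h := (ImplOn.foldl (fun j => ImplOn.flip (T j) (hT j) (b j) (t j) (ht j))
    (fun j j' hj => by exact_mod_cast hd j j' hj) Finset.univ.toList
    (Finset.nodup_toList _)).mono (Set.subset_univ _) le_rfl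
  convert h using 1
  funext ψ z
  have main : ∀ (l : List J), l.Nodup → ∀ ψ : State Q,
      l.foldl (fun φ j => (fun (ψ : State Q) z => ψ (fun q => xor (z q)
        (decide (t j = q ∧ ∀ s ∈ T j, z s = b j s)))) φ) ψ z =
      ψ (fun q => xor (z q) (decide (∃ j ∈ l, t j = q ∧ ∀ s ∈ T j, z s = b j s))) := by
    intro l
    induction l with
    | nil => intro _ ψ; simp
    | cons j l ih =>
      intro hl ψ
      rw [List.nodup_cons] at hl
      rw [List.foldl_cons, ih hl.2]
      refine congrArg ψ ?_
      have hne : ∀ j' ∈ l, ∀ s ∈ insert (t j) (T j), t j' ≠ s := by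
        rintro j' hj' s hs rfl
        refine Finset.disjoint_left.1 (hd j j' (fun h => hl.1 (h ▸ hj'))) hs ?_
        simp
      have hs : ∀ s ∈ insert (t j) (T j), xor (z s) (decide (∃ j ∈ l, t j = s ∧
          ∀ s ∈ T j, z s = b j s)) = z s := by
        intro s hs
        have : ¬ ∃ j ∈ l, t j = s ∧ ∀ s ∈ T j, z s = b j s := by
          rintro ⟨j', hj', h1, -⟩
          exact hne j' hj' s hs h1
        simp [this]
      have hc : (∀ s ∈ T j, xor (z s) (decide (∃ j ∈ l, t j = s ∧
          ∀ s ∈ T j, z s = b j s)) = b j s) ↔ ∀ s ∈ T j, z s = b j s :=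
        forall₂_congr fun s hs' => by rw [hs s (Finset.mem_insert_of_mem hs')]
      funext q
      simp only [hc]
      by_cases hq : t j = q
      · subst hq
        rw [hs (t j) (Finset.mem_insert_self _ _)]
        have : ∀ j' ∈ l, t j' ≠ t j := fun j' hj' => hne j' hj' _ (Finset.mem_insert_self _ _)
        congr 1
        apply decide_eq_decide.2
        constructor
        · rintro ⟨-, h⟩
          exact ⟨j, by simp, rfl, h⟩
        · rintro ⟨j', hj', h1, h2⟩
          rcases List.mem_cons.1 hj' with rfl | hj'
          · exact ⟨rfl, h2⟩
          · exact absurd h1 (this j' hj')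
      · simp [hq]
  rw [main _ (Finset.nodup_toList _)]
  simp only [Finset.mem_toList, Finset.mem_univ, true_and]
  rfl

theorem flipMap_involutive {J : Type} [Fintype J] (T : J → Finset Q) (b : J → Q → Bool)
    (t : J → Q) (ht : ∀ j j', t j ∉ T j') : Function.Involutive (flipMap T b t) := by
  intro z
  have hs : ∀ j, ∀ s ∈ T j, flipMap T b t z s = z s := by
    intro j s hs
    have : ¬ ∃ j, t j = s ∧ ∀ s ∈ T j, z s = b j s := by
      rintro ⟨j', rfl, -⟩
      exact ht j' j hs
    simp [flipMap, this]
  funext q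
  have hc : (∃ j, t j = q ∧ ∀ s ∈ T j, flipMap T b t z s = b j s) ↔
      ∃ j, t j = q ∧ ∀ s ∈ T j, z s = b j s :=
    exists_congr fun j => and_congr_right fun _ =>
      forall₂_congr fun s hs' => by rw [hs j s hs']
  rw [flipMap]
  simp only [hc]
  simp [flipMap]

/-- A permutation of the basis acts on amplitudes by precomposition, that is, through its inverse;
for an involution the two directions agree. -/
theorem basis_comp_involutive {F : (Q → Bool) → Q → Bool} (hF : Function.Involutive F)
    (b : Q → Bool) : (fun z => basis b (F z)) = basis (F b) := by
  funext z
  simp only [basis_apply]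
  congr 1
  exact propext ⟨fun h => by rw [← h, hF], fun h => by rw [h, hF]⟩

end Singles

/-! ### Phase flips, reflections in preparable states, and real rotations. -/

section Reflection

variable {Q : Type} [Fintype Q] [DecidableEq Q]

/-- The amplitude `1 / √2`. -/
noncomputable def invSqrtTwo : ℝ := Real.sqrt 2 / 2

theorem invSqrtTwo_mul_self : (invSqrtTwo : ℂ) * (invSqrtTwo : ℂ) = 1 / 2 := by
  rw [← Complex.ofReal_mul]
  have : invSqrtTwo * invSqrtTwo = 1 / 2 := by
    have := Real.mul_self_sqrt (show (0 : ℝ) ≤ 2 by norm_num)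
    unfold invSqrtTwo
    linarith
  rw [this]; norm_num

/-- The Hadamard gate. -/
noncomputable def hadamard : Matrix.unitaryGroup Bool ℂ :=
  ⟨Matrix.of fun b c => (if b && c then -1 else 1) * (invSqrtTwo : ℂ), by
    rw [Matrix.mem_unitaryGroup_iff]
    ext b c
    cases b <;> cases c <;>
      simp only [Matrix.mul_apply, Matrix.star_apply, Fintype.sum_bool, Matrix.of_apply, star_mul',
        RCLike.star_def, Complex.conj_ofReal, Matrix.one_apply] <;> simp <;>
      linear_combination (2 : ℂ) * invSqrtTwo_mul_self⟩

theorem hadamard_apply (b c : Bool) : (hadamard : Matrix Bool Bool ℂ) b c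
    = (if b && c then -1 else 1) * (invSqrtTwo : ℂ) := rfl

/-- A NOT between two Hadamards is a sign flip: one qubit `t` of `T` serves as the target of a flip
controlled by the others, between Hadamards on `t`, and NOT gates around this adjust for the
prescribed value at `t`. Two qubits are required because a Toffoli gate needs a control. -/
theorem ImplOn.phaseFlip (T : Finset Q) (hT : 2 ≤ T.card) (b : Q → Bool) :
    ImplOn (T : Set Q) 7 (fun ψ z => if ∀ q ∈ T, z q = b q then -ψ z else ψ z) := by
  obtain ⟨t, ht⟩ : T.Nonempty := Finset.card_pos.1 (by omega)
  have hne : (T.erase t).Nonempty := by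
    rw [← Finset.card_pos, Finset.card_erase_of_mem ht]; omega
  have hH : ImplOn (T : Set Q) 1 (Gate.single t hadamard).act :=
    (ImplOn.gate _).mono (by simp [Gate.support, ht]) le_rfl
  have hF := (ImplOn.flip (T.erase t) hne b t (Finset.notMem_erase t T)).mono
    (S' := (T : Set Q)) (by rw [Finset.insert_erase ht]) le_rfl
  have hN : ImplOn (T : Set Q) 1 _ := (ImplOn.nots (T.filter fun q => q = t ∧ b q = false)).mono
    (by intro q hq; exact (Finset.mem_filter.1 hq).1) le_rfl
  have h := (hN.comp ((hH.comp hF).comp hH)).comp hN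
  refine (show ImplOn (T : Set Q) 7 _ from ?_)
  convert h using 1
  funext ψ z
  have h2 := invSqrtTwo_mul_self
  have core : ∀ (φ : State Q) (w : Q → Bool), (Gate.single t hadamard).act
      (fun z => (Gate.single t hadamard).act φ (fun q => xor (z q)
        (decide (t = q ∧ ∀ s ∈ T.erase t, z s = b s)))) w =
      if w t = true ∧ ∀ s ∈ T.erase t, w s = b s then -φ w else φ w := by
    intro φ w
    have hc : ∀ c, (∀ s ∈ T.erase t, Function.update w t c s = b s) ↔
        ∀ s ∈ T.erase t, w s = b s := by
      intro c
      refine forall₂_congr fun s hs => ?_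
      rw [Function.update_of_ne (Finset.ne_of_mem_erase hs)]
    have hv : ∀ (c d : Bool) (P : Prop) [Decidable P], Function.update (fun q =>
        xor (Function.update w t c q) (decide (t = q ∧ P))) t d = Function.update w t d := by
      intro c d P _
      funext q
      by_cases hq : q = t
      · subst hq; simp
      · simp [hq, Ne.symm hq]
    have hw0 : w t = false → Function.update w t false = w := fun h => by
      rw [← h, Function.update_eq_self]
    have hw1 : w t = true → Function.update w t true = w := fun h => by
      rw [← h, Function.update_eq_self]
    simp only [Gate.act, hv, Function.update_self, hc, true_and]
    by_cases hp : ∀ s ∈ T.erase t, w s = b s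
    · have hp' : decide (∀ s ∈ T.erase t, w s = b s) = true := decide_eq_true hp
      rw [hp']
      cases hwt : w t <;> simp only [hadamard_apply, Fintype.sum_bool]
      · rw [if_neg (by simp)]
        simp [hw0 hwt]
        linear_combination (2 : ℂ) * φ w * h2
      · rw [if_pos (And.intro trivial hp)]
        simp [hw1 hwt]
        linear_combination (-2 : ℂ) * φ w * h2
    · have hp' : decide (∀ s ∈ T.erase t, w s = b s) = false := decide_eq_false hp
      rw [if_neg (fun h => hp h.2), hp']
      cases hwt : w t <;> simp only [hadamard_apply, Fintype.sum_bool] <;>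
        simp [hw0, hw1, hwt]
      · linear_combination (2 : ℂ) * φ w * h2
      · linear_combination (2 : ℂ) * φ w * h2
  rw [core]
  have hmem : ∀ q, q ∈ T.filter (fun q => q = t ∧ b q = false) ↔ q = t ∧ b t = false := by
    intro q
    rw [Finset.mem_filter]
    constructor
    · rintro ⟨-, hq, h⟩; exact ⟨hq, hq ▸ h⟩
    · rintro ⟨rfl, h⟩; exact ⟨ht, rfl, h⟩
  have hinv : (fun q => if q ∈ T.filter (fun q => q = t ∧ b q = false)
      then !(if q ∈ T.filter (fun q => q = t ∧ b q = false) then !(z q) else z q)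
      else (if q ∈ T.filter (fun q => q = t ∧ b q = false) then !(z q) else z q)) = z := by
    funext q
    split_ifs <;> simp
  rw [hinv]
  have hcond : ((if t ∈ T.filter (fun q => q = t ∧ b q = false) then !(z t) else z t) = true ∧
      ∀ s ∈ T.erase t, (if s ∈ T.filter (fun q => q = t ∧ b q = false) then !(z s) else z s) = b s)
      ↔ ∀ q ∈ T, z q = b q := by
    rw [← Finset.insert_erase ht, Finset.forall_mem_insert, Finset.erase_insert_eq_erase,
      Finset.erase_idem, Finset.insert_erase ht]
    refine and_congr ?_ (forall₂_congr fun s hs => ?_)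
    · simp only [hmem, true_and]
      cases hb : b t <;> simp
    · simp only [hmem]
      simp [Finset.ne_of_mem_erase hs]
  simp only [hcond]

/-- Conjugating the phase flip of the all-zero string by `A` gives the reflection in the state that
`A` prepares. -/
theorem ImplOn.reflect {d : ℕ} {A : State Q → State Q} (hA : ImplOn (Set.univ : Set Q) d A)
    (hQ : 2 ≤ Fintype.card Q) :
    ImplOn (Set.univ : Set Q) (2 * d + 7) (fun ψ =>
      ψ + (-(2 * ip (A (basis fun _ => false)) ψ)) • A (basis fun _ => false)) := by
  obtain ⟨A', hA', h1, h2⟩ := hA.inv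
  have hS := (ImplOn.phaseFlip (Finset.univ : Finset Q) (by simpa using hQ)
    (fun _ => false)).mono (Set.subset_univ _) le_rfl
  have h := ((hA'.comp hS).comp hA).mono le_rfl (show d + 7 + d ≤ 2 * d + 7 by omega)
  convert h using 1
  funext ψ
  have e : ∀ φ : State Q, (fun z => if ∀ q ∈ Finset.univ, z q = false then -φ z else φ z)
      = φ + (-(2 * φ fun _ => false)) • basis fun _ => false := by
    intro φ
    funext z
    simp only [Pi.add_apply, Pi.smul_apply, basis_apply, smul_eq_mul, Finset.mem_univ,
      forall_const, funext_iff]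
    split_ifs with hz
    · have : z = fun _ => false := funext hz
      subst this
      ring
    · ring
  have e2 : A' ψ (fun _ => false) = ip (A (basis fun _ => false)) ψ := by
    rw [← ip_basis (fun _ => false) (A' ψ), ← hA.ip_eq, h2]
  rw [e, hA.add_smul, h2, e2]

/-- The qubit state `cos θ |0⟩ + sin θ |1⟩`. -/
noncomputable def vec (θ : ℝ) : Bool → ℂ := fun b => if b then (Real.sin θ : ℂ) else (Real.cos θ : ℂ)

theorem vec_zero : vec 0 = ket false := by
  funext b; cases b <;> simp [vec, ket]

theorem vec_pi_div_two : vec (Real.pi / 2) = ket true := by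
  funext b; cases b <;> simp [vec, ket]

/-- The rotation taking `vec φ` to `vec (θ + φ)`. -/
noncomputable def rot (θ : ℝ) : Matrix.unitaryGroup Bool ℂ :=
  ⟨Matrix.of fun b c => if c then vec (θ + Real.pi / 2) b else vec θ b, by
    have h : ((Real.sin θ : ℝ) : ℂ) * ((Real.sin θ : ℝ) : ℂ)
        + ((Real.cos θ : ℝ) : ℂ) * ((Real.cos θ : ℝ) : ℂ) = 1 := by
      rw [← Complex.ofReal_mul, ← Complex.ofReal_mul, ← Complex.ofReal_add]
      have := Real.sin_sq_add_cos_sq θ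
      rw [← pow_two, ← pow_two, this]
      norm_num
    rw [Matrix.mem_unitaryGroup_iff]
    ext b c
    cases b <;> cases c <;>
      simp only [Matrix.mul_apply, Matrix.star_apply, Fintype.sum_bool, Matrix.of_apply, vec,
        Real.cos_add_pi_div_two, Real.sin_add_pi_div_two, Bool.false_eq_true, if_false, if_true,
        RCLike.star_def, Complex.conj_ofReal, Matrix.one_apply, Bool.true_eq_false] <;>
      push_cast at h ⊢ <;> simp only [← Complex.ofReal_sin, ← Complex.ofReal_cos] at h ⊢
    · linear_combination h
    · ring
    · ring
    · linear_combination h⟩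

theorem rot_mul_vec (θ φ : ℝ) :
    (fun b => ∑ c, (rot θ : Matrix Bool Bool ℂ) b c * vec φ c) = vec (θ + φ) := by
  funext b
  have : ∀ b c, (rot θ : Matrix Bool Bool ℂ) b c
      = if c then vec (θ + Real.pi / 2) b else vec θ b := fun _ _ => rfl
  cases b <;> simp only [this, Fintype.sum_bool, vec, Bool.false_eq_true, if_false, if_true,
    Real.cos_add, Real.sin_add, Real.cos_pi_div_two, Real.sin_pi_div_two] <;>
    push_cast <;> ring

theorem ip_vec (θ φ : Q → ℝ) : ip (prodQ fun q => vec (θ q)) (prodQ fun q => vec (φ q))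
    = ((∏ q, Real.cos (θ q - φ q) : ℝ) : ℂ) := by
  rw [ip_prodQ, Complex.ofReal_prod]
  refine Finset.prod_congr rfl fun q _ => ?_
  simp only [vec, Fintype.sum_bool, Bool.false_eq_true, if_false, if_true, RCLike.star_def,
    Complex.conj_ofReal, Real.cos_sub]
  push_cast
  ring

theorem basis_false_eq : (basis fun _ : Q => false) = prodQ fun _ => vec 0 := by
  simp only [basis, vec_zero]

theorem ImplOn.rots (θ : Q → ℝ) :
    ∃ A, ImplOn (Set.univ : Set Q) 1 A ∧ ∀ φ : Q → ℝ, A (prodQ fun q => vec (φ q)) =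
      prodQ fun q => vec (θ q + φ q) := by
  obtain ⟨A, hA, hA'⟩ := ImplOn.singles (Q := Q) fun q => rot (θ q)
  refine ⟨A, hA, fun φ => ?_⟩
  exact (hA' _).trans (congrArg prodQ (funext fun q => rot_mul_vec _ _))

theorem ImplOn.reflect_prodQ (θ : Q → ℝ) (hQ : 2 ≤ Fintype.card Q) :
    ImplOn (Set.univ : Set Q) 9 (fun ψ =>
      ψ + (-(2 * ip (prodQ fun q => vec (θ q)) ψ)) • prodQ fun q => vec (θ q)) := by
  obtain ⟨A, hA, hA'⟩ := ImplOn.rots θ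
  have h := hA.reflect hQ
  have e : A (basis fun _ => false) = prodQ fun q => vec (θ q) := by
    rw [basis_false_eq, hA' fun _ => 0]
    simp only [add_zero]
  rwa [e] at h

end Reflection

/-! ### Weak fan-out of a bit, and the test for a given Hamming weight. -/

section Weight

variable {ν : Type} [Fintype ν] [DecidableEq ν]

/-- The product state on `Option ν` with the angle `a` at `none` and the angles `b i` at `some i`. -/
noncomputable def optState (a : ℝ) (b : ν → ℝ) : State (Option ν) :=
  prodQ fun o => vec (o.elim a b)

theorem ip_optState (a c : ℝ) (b d : ν → ℝ) :
    ip (optState a b) (optState c d)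
      = ((Real.cos (a - c) * ∏ i, Real.cos (b i - d i) : ℝ) : ℂ) := by
  rw [optState, optState, ip_vec, Fintype.prod_option]
  rfl

theorem optState_false (a : ℝ) (b : ν → ℝ) :
    optState a b (fun _ => false) = ((Real.cos a * ∏ i, Real.cos (b i) : ℝ) : ℂ) := by
  rw [← ip_basis (fun _ => false) (optState a b), basis_false_eq, show (prodQ fun _ : Option ν => vec 0)
    = optState 0 (fun _ => 0) from by
      unfold optState; congr 1; funext o; cases o <;> rfl, ip_optState]
  simp [Real.cos_neg]

/-- The gate `diag(1, -1)`. -/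
noncomputable def zGate : Matrix.unitaryGroup Bool ℂ :=
  ⟨Matrix.diagonal fun b => if b then -1 else 1, by
    rw [Matrix.mem_unitaryGroup_iff, Matrix.star_eq_conjTranspose, Matrix.diagonal_conjTranspose,
      Matrix.diagonal_mul_diagonal, ← Matrix.diagonal_one]
    congr 1
    funext b
    cases b <;> simp⟩

theorem zGate_mul (v : Bool → ℂ) :
    (fun b => ∑ c, (zGate : Matrix Bool Bool ℂ) b c * v c) = fun b => if b then -v b else v b := by
  have h : ∀ b c, (zGate : Matrix Bool Bool ℂ) b c
      = Matrix.diagonal (fun b : Bool => if b then (-1 : ℂ) else 1) b c := fun _ _ => rfl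
  funext b
  cases b <;> simp [h, Matrix.diagonal_apply]

/-- A bit controls the preparation of a product state of low energy on many qubits. -/
theorem ImplOn.weakFanout [Nonempty ν] (τ : ℝ) (hτ : Real.cos τ ^ Fintype.card ν = 1 / 2) :
    ∃ T, ImplOn (Set.univ : Set (Option ν)) 19 T ∧ ∀ x : Bool,
      T (prodQ fun o => o.elim (ket x) fun _ => ket false) =
        prodQ fun o => o.elim (ket x) fun _ => vec (if x then τ else 0) := by
  have hcard : 2 ≤ Fintype.card (Option ν) := by
    rw [Fintype.card_option]
    have := Fintype.card_pos (α := ν)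
    omega
  -- The states `|1⟩|vec τ …⟩` and `|1⟩|0 …⟩` have overlap `cos τ ^ n = 1 / 2`, an angle of `π / 3`.
  -- The product of the two reflections rotates by `2π / 3` and takes the second state to minus the
  -- first. Both reflections are trivial when the control is `|0⟩`, and `zGate` on the control
  -- removes the sign.
  have hB := ImplOn.reflect_prodQ (Q := Option ν)
    (fun o => o.elim (Real.pi / 2) fun _ => τ) hcard
  have hA := ImplOn.reflect_prodQ (Q := Option ν)
    (fun o => o.elim (Real.pi / 2) fun _ => 0) hcard
  obtain ⟨Z, hZ, hZ'⟩ := ImplOn.singles (Q := Option ν) fun o => o.elim zGate fun _ => 1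
  refine ⟨_, (hB.comp hA).comp hZ, fun x => ?_⟩
  change Z (_ + (-(2 * ip (optState (Real.pi / 2) fun _ : ν => 0) _)) •
    optState (Real.pi / 2) fun _ => 0) = _
  have hopt : ∀ a b : ℝ, (prodQ fun o : Option ν => vec (o.elim a fun _ => b))
      = optState a fun _ => b := fun _ _ => rfl
  simp only [hopt]
  have hin : ∀ a b : ℝ, optState a (fun _ : ν => b)
      = prodQ fun o => o.elim (vec a) fun _ => vec b := by
    intro a b
    unfold optState
    congr 1
    funext o
    cases o <;> rfl
  have hZo : ∀ a b : ℝ, Z (optState a (fun _ : ν => b)) =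
      prodQ fun o => o.elim (fun b => if b then -vec a b else vec a b) fun _ => vec b := by
    intro a b
    rw [hin, hZ']
    congr 1
    funext o
    cases o with
    | none => exact zGate_mul _
    | some i =>
      funext c
      simp [Matrix.one_apply]
  cases x
  · have e : (prodQ fun o : Option ν => o.elim (ket false) fun _ => ket false)
        = optState 0 fun _ => 0 := by rw [hin, vec_zero]
    rw [e, ip_optState]
    simp only [sub_zero, Real.cos_pi_div_two, zero_mul, Complex.ofReal_zero, mul_zero, neg_zero,
      zero_smul, add_zero]
    rw [ip_optState]
    simp only [sub_zero, Real.cos_pi_div_two, zero_mul, Complex.ofReal_zero, mul_zero, neg_zero,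
      zero_smul, add_zero]
    rw [hZo]
    congr 1
    funext o
    cases o with
    | none => funext b; cases b <;> simp [vec, ket]
    | some i => simp
  · have e : (prodQ fun o : Option ν => o.elim (ket true) fun _ => ket false)
        = optState (Real.pi / 2) fun _ => 0 := by rw [hin, vec_zero, vec_pi_div_two]
    have e1 : ip (optState (Real.pi / 2) fun _ : ν => τ) (optState (Real.pi / 2) fun _ => 0)
        = 1 / 2 := by
      rw [ip_optState]; simp only [sub_self, Real.cos_zero, sub_zero, one_mul, Finset.prod_const,
        Finset.card_univ, hτ]; norm_num
    have e2 : ip (optState (Real.pi / 2) fun _ : ν => 0) (optState (Real.pi / 2) fun _ => 0 )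
        = 1 := by
      rw [ip_optState]; simp
    have e3 : ip (optState (Real.pi / 2) fun _ : ν => 0) (optState (Real.pi / 2) fun _ => τ)
        = 1 / 2 := by
      rw [ip_optState]; simp only [sub_self, Real.cos_zero, zero_sub, Real.cos_neg, one_mul,
        Finset.prod_const, Finset.card_univ, hτ]; norm_num
    have e4 : ∀ (φ ψ χ : State (Option ν)) (c : ℂ), ip φ (ψ + c • χ) = ip φ ψ + c * ip φ χ := by
      intro φ ψ χ c
      simp only [ip, Pi.add_apply, Pi.smul_apply, smul_eq_mul, mul_add, Finset.sum_add_distrib,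
        Finset.mul_sum]
      congr 1
      exact Finset.sum_congr rfl fun z _ => by ring
    rw [e, e1, e4, e2, e3]
    have e5 : (optState (Real.pi / 2) fun _ : ν => 0)
        + (-(2 * (1 / 2)) : ℂ) • (optState (Real.pi / 2) fun _ => τ)
        + (-(2 * (1 + -(2 * (1 / 2)) * (1 / 2))) : ℂ) • (optState (Real.pi / 2) fun _ : ν => 0)
        = (-1 : ℂ) • optState (Real.pi / 2) fun _ : ν => τ := by
      funext z
      simp only [Pi.add_apply, Pi.smul_apply, smul_eq_mul]
      ring
    rw [e5, hZ.smul, hZo]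
    funext z
    simp only [Pi.smul_apply, smul_eq_mul, prodQ, Fintype.prod_option, Option.elim_none,
      Option.elim_some, vec_pi_div_two, if_true]
    cases z none <;> simp [ket]

/-- Since `cos² (τ/2) = (1 + cos τ) / 2 ≥ cos τ`, the squared prefactor is at least `cos τ ^ n =
1/2`. The other factor differs from zero by at least `1 - cos τ`, which is at least `1 / (2n)` by
Bernoulli's inequality. -/
theorem weight_test_zero (ν : Type) [Fintype ν] (τ : ℝ) (hτ : Real.cos τ ^ Fintype.card ν = 1 / 2)
    (hτ0 : 0 < Real.cos τ) (k w : ℕ) (hwk : w ≠ k) (hw : w ≤ Fintype.card ν) :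
    1 / (8 * (Fintype.card ν : ℝ) ^ 2) ≤
      (Real.cos (τ / 2) ^ Fintype.card ν * (1 - Real.cos τ ^ w / Real.cos τ ^ k)) ^ 2 := by
  set n := Fintype.card ν
  set C := Real.cos τ
  have hC1 : C ≤ 1 := Real.cos_le_one τ
  have hn : 0 < n := by
    rcases Nat.eq_zero_or_pos n with h | h
    · rw [h] at hτ; norm_num at hτ
    · exact h
  have hn' : (0 : ℝ) < n := by exact_mod_cast hn
  have hb : 1 / (2 * (n : ℝ)) ≤ 1 - C := by
    have h := one_add_mul_le_pow (show (-2 : ℝ) ≤ C - 1 by linarith) n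
    rw [add_sub_cancel, hτ] at h
    rw [div_le_iff₀ (by positivity)]
    linarith
  have h1 : 1 / 2 ≤ (Real.cos (τ / 2) ^ n) ^ 2 := by
    rw [← pow_mul, mul_comm n 2, pow_mul, ← hτ]
    refine pow_le_pow_left₀ hτ0.le ?_ n
    rw [Real.cos_sq]
    rw [show 2 * (τ / 2) = τ by ring]
    change C ≤ 1 / 2 + C / 2
    linarith
  have h2 : (1 / (2 * (n : ℝ))) ^ 2 ≤ (1 - C ^ w / C ^ k) ^ 2 := by
    rcases lt_or_gt_of_ne hwk with h | h
    · obtain ⟨j, rfl⟩ := Nat.exists_eq_add_of_lt h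
      have e : C ^ w / C ^ (w + j + 1) = (C ^ (j + 1))⁻¹ := by
        rw [add_assoc, pow_add, div_mul_eq_div_div, div_self (pow_pos hτ0 w).ne', one_div]
      have hj : C ^ (j + 1) ≤ C := by
        have := pow_le_pow_of_le_one hτ0.le hC1 (show 1 ≤ j + 1 by omega)
        rwa [pow_one] at this
      have hi : 1 + (1 - C) ≤ (C ^ (j + 1))⁻¹ := by
        rw [le_inv_comm₀ (by linarith) (pow_pos hτ0 _)]
        refine hj.trans ?_
        rw [le_inv_comm₀ hτ0 (by linarith), ← one_div, le_div_iff₀ hτ0]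
        nlinarith [sq_nonneg (1 - C)]
      rw [e, ← sq_abs (1 - _), abs_sub_comm]
      refine pow_le_pow_left₀ (by positivity) ?_ 2
      exact le_trans (by linarith) (le_abs_self _)
    · obtain ⟨j, rfl⟩ := Nat.exists_eq_add_of_lt h
      have e : C ^ (k + j + 1) / C ^ k = C ^ (j + 1) := by
        rw [add_assoc, pow_add, mul_div_cancel_left₀ _ (pow_pos hτ0 k).ne']
      have hj : C ^ (j + 1) ≤ C := by
        have := pow_le_pow_of_le_one hτ0.le hC1 (show 1 ≤ j + 1 by omega)
        rwa [pow_one] at this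
      rw [e]
      refine pow_le_pow_left₀ (by positivity) ?_ 2
      linarith
  calc 1 / (8 * (n : ℝ) ^ 2) = 1 / 2 * (1 / (2 * (n : ℝ))) ^ 2 := by field_simp; norm_num
    _ ≤ (Real.cos (τ / 2) ^ n) ^ 2 * (1 - C ^ w / C ^ k) ^ 2 := by gcongr
    _ = _ := by ring

/-- The number of ones of a string of bits. -/
def ones (x : ν → Bool) : ℕ := ∑ i, (x i).toNat

theorem ones_eq_card (x : ν → Bool) : ones x = (Finset.univ.filter fun i => x i = true).card := by
  rw [Finset.card_filter, ones]
  exact Finset.sum_congr rfl fun i _ => by cases x i <;> rfl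

/-- A test that detects a weight different from `k` with probability at least `1 / (8 n ^ 2)`, and
never detects the weight `k`. -/
theorem ImplOn.weightTest [Nonempty ν] (τ : ℝ) (hτ : Real.cos τ ^ Fintype.card ν = 1 / 2)
    (hτ0 : 0 < Real.cos τ) (k : ℕ) (hk : k ≤ Fintype.card ν) :
    ∃ T, ImplOn (Set.univ : Set (Option ν)) 10 T ∧ ∀ x : ν → Bool, ∀ Φ : State (Option ν),
      Φ = T (prodQ fun o => o.elim (ket false) fun i => vec (if x i then τ else 0)) →
      ip Φ Φ = 1 ∧ (ones x = k → Φ (fun _ => false) = 0) ∧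
      (ones x ≠ k → 1 / (8 * (Fintype.card ν : ℝ) ^ 2) ≤ ‖Φ (fun _ => false)‖ ^ 2) := by
  have hcard : 2 ≤ Fintype.card (Option ν) := by
    rw [Fintype.card_option]
    have := Fintype.card_pos (α := ν)
    omega
  have hCk : 1 / 2 ≤ Real.cos τ ^ k := by
    rw [← hτ]
    exact pow_le_pow_of_le_one hτ0.le (Real.cos_le_one τ) hk
  have hCk0 : 0 < Real.cos τ ^ k := pow_pos hτ0 k
  -- The reflection subtracts `2 c² cos τ ^ w` times a fixed vector on inputs of weight `w`; this
  -- choice makes the coefficient equal to `1` for `w = k`. The bound `k ≤ n` ensures `c ≤ 1`, so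
  -- that `c` is a cosine.
  set c := Real.sqrt (1 / (2 * Real.cos τ ^ k)) with hc
  have hc2 : c * c = 1 / (2 * Real.cos τ ^ k) := Real.mul_self_sqrt (by positivity)
  have hc1 : c ≤ 1 := by
    refine Real.sqrt_le_iff.2 ⟨zero_le_one, ?_⟩
    rw [one_pow, div_le_one (by positivity)]
    linarith
  have hcos : Real.cos (Real.arccos c) = c :=
    Real.cos_arccos (by linarith [Real.sqrt_nonneg (1 / (2 * Real.cos τ ^ k))]) hc1
  have hR := ImplOn.reflect_prodQ (Q := Option ν)
    (fun o => o.elim (Real.arccos c) fun _ => 0) hcard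
  -- Rotating by `-τ/2` places `vec 0` and `vec τ` symmetrically around `|0⟩`, so every input
  -- contributes the same prefactor `cos (τ/2) ^ n` and the amplitude depends on the weight alone.
  obtain ⟨A, hA, hA'⟩ := ImplOn.rots (Q := Option ν) fun o => o.elim 0 fun _ => -(τ / 2)
  have hAo : ∀ (a : ℝ) (b : ν → ℝ), A (optState a b) = optState a fun i => -(τ / 2) + b i := by
    intro a b
    refine (hA' _).trans ?_
    unfold optState
    congr 1
    funext o
    cases o <;> simp
  have hT := hR.comp hA
  refine ⟨_, hT, fun x Φ hΦ => ?_⟩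
  have hin : (prodQ fun o : Option ν => o.elim (ket false) fun i => vec (if x i then τ else 0))
      = optState 0 fun i => if x i then τ else 0 := by
    unfold optState
    congr 1
    funext o
    cases o <;> simp [vec_zero]
  rw [hin] at hΦ
  have hval : Φ (fun _ => false) = ((Real.cos (τ / 2) ^ Fintype.card ν *
      (1 - Real.cos τ ^ ones x / Real.cos τ ^ k) : ℝ) : ℂ) := by
    have e0 : (prodQ fun o : Option ν => vec (o.elim (Real.arccos c) fun _ => 0))
      = optState (Real.arccos c) fun _ => 0 := rfl
    rw [e0] at hΦ
    rw [hΦ, hA.add_smul, hAo, hAo, ip_optState]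
    simp only [Pi.add_apply, Pi.smul_apply, optState_false, smul_eq_mul]
    have p1 : ∏ i, Real.cos (-(τ / 2) + if x i then τ else 0)
        = Real.cos (τ / 2) ^ Fintype.card ν := by
      rw [← Finset.card_univ, ← Finset.prod_const]
      refine Finset.prod_congr rfl fun i _ => ?_
      split_ifs
      · congr 1; ring
      · rw [add_zero, Real.cos_neg]
    have p2 : ∏ i, Real.cos (0 - if x i then τ else 0) = Real.cos τ ^ ones x := by
      rw [ones, ← Finset.prod_pow_eq_pow_sum]
      refine Finset.prod_congr rfl fun i _ => ?_
      cases x i <;> simp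
    have p3 : ∏ _i : ν, Real.cos (-(τ / 2) + 0) = Real.cos (τ / 2) ^ Fintype.card ν := by
      simp
    rw [p1, p2, p3, sub_zero, hcos, Real.cos_zero]
    have : c * c * (2 * Real.cos τ ^ k) = 1 := by
      rw [hc2]; field_simp
    rw [← Complex.ofReal_ofNat, ← Complex.ofReal_mul, ← Complex.ofReal_neg, ← Complex.ofReal_mul,
      ← Complex.ofReal_add, Complex.ofReal_inj]
    field_simp
    linear_combination (-Real.cos (τ / 2) ^ Fintype.card ν * Real.cos τ ^ ones x) * this
  refine ⟨?_, ?_, ?_⟩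
  · rw [hΦ, hT.ip_eq, ip_optState]
    simp
  · intro h
    rw [hval, h, div_self hCk0.ne', sub_self, mul_zero, Complex.ofReal_zero]
  · intro h
    rw [hval, Complex.norm_real, Real.norm_eq_abs, sq_abs]
    refine weight_test_zero ν τ hτ hτ0 k (ones x) h ?_
    rw [ones_eq_card]
    exact Finset.card_le_univ _

theorem exists_angle (n : ℕ) (hn : 0 < n) : ∃ τ : ℝ, Real.cos τ ^ n = 1 / 2 ∧ 0 < Real.cos τ := by
  have h0 : (0 : ℝ) < (1 / 2 : ℝ) ^ ((1 : ℝ) / n) := by positivity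
  have h1 : (1 / 2 : ℝ) ^ ((1 : ℝ) / n) ≤ 1 :=
    Real.rpow_le_one (by norm_num) (by norm_num) (by positivity)
  refine ⟨Real.arccos ((1 / 2 : ℝ) ^ ((1 : ℝ) / n)), ?_, ?_⟩ <;>
    rw [Real.cos_arccos (by linarith) h1]
  · rw [← Real.rpow_natCast, ← Real.rpow_mul (by norm_num)]
    rw [one_div_mul_cancel (by exact_mod_cast hn.ne'), Real.rpow_one]
  · exact h0

end Weight

/-! ### Exact amplitude amplification. -/

section Amplify

variable {Q : Type} [Fintype Q] [DecidableEq Q]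

theorem star_mul_self_eq (c : ℂ) : star c * c = ((‖c‖ ^ 2 : ℝ) : ℂ) := by
  rw [RCLike.star_def, Complex.conj_mul']
  push_cast
  rfl

theorem ip_self (ψ : State Q) : ip ψ ψ = ((∑ z, ‖ψ z‖ ^ 2 : ℝ) : ℂ) := by
  simp only [ip, star_mul_self_eq]
  push_cast
  rfl

/-- Exact amplitude amplification of an event of probability `1 / 4`. -/
theorem ImplOn.amplify {d d' : ℕ} {A : State Q → State Q} (hA : ImplOn (Set.univ : Set Q) d A)
    (hQ : 2 ≤ Fintype.card Q) (P : (Q → Bool) → Prop) [DecidablePred P]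
    (hP : ImplOn (Set.univ : Set Q) d' (fun ψ z => if P z then -ψ z else ψ z))
    (hp : ∑ z, (if P z then ‖A (basis fun _ => false) z‖ ^ 2 else 0) = 1 / 4) :
    ∃ B, ImplOn (Set.univ : Set Q) (3 * d + d' + 7) B ∧ B (basis fun _ => false) =
      fun z => if P z then -2 * A (basis fun _ => false) z else 0 := by
  refine ⟨_, ((hA.comp hP).comp (hA.reflect hQ)).mono le_rfl (by omega), ?_⟩
  set ψ := A (basis fun _ => false) with hψ
  have h1 : ∑ z, ‖ψ z‖ ^ 2 = 1 := by
    have := hA.ip_eq (basis fun _ => false) (basis fun _ => false)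
    rw [← hψ, ip_self, ip_basis, basis_apply, if_pos rfl] at this
    exact_mod_cast this
  -- The amplitude of the event is `1/2 = sin (π/6)`, and one Grover step triples the angle to
  -- `π/2`. Here the overlap is `1 - 2 · (1/4)`, so the reflection subtracts exactly `ψ` and cancels
  -- everything outside `P`.
  have h2 : ip ψ (fun z => if P z then -ψ z else ψ z) = 1 / 2 := by
    have : ∀ z, star (ψ z) * (if P z then -ψ z else ψ z)
        = ((‖ψ z‖ ^ 2 - 2 * (if P z then ‖ψ z‖ ^ 2 else 0) : ℝ) : ℂ) := by
      intro z
      split_ifs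
      · rw [mul_neg, star_mul_self_eq]; push_cast; ring
      · rw [star_mul_self_eq]; push_cast; ring
    rw [ip, Finset.sum_congr rfl fun z _ => this z, ← Complex.ofReal_sum, Finset.sum_sub_distrib,
      ← Finset.mul_sum, h1, hp]
    norm_num
  rw [h2]
  funext z
  simp only [Pi.add_apply, Pi.smul_apply, smul_eq_mul]
  split_ifs <;> ring

theorem ImplOn.phaseFlips {J : Type} [Fintype J] [DecidableEq J] (T : J → Finset Q)
    (b : J → Q → Bool) (hT : ∀ j, 2 ≤ (T j).card)
    (hd : ∀ j j', j ≠ j' → Disjoint (T j) (T j')) :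
    ImplOn (Set.univ : Set Q) 7
      (fun ψ z => (∏ j, if ∀ q ∈ T j, z q = b j q then (-1 : ℂ) else 1) * ψ z) := by
  have h := (ImplOn.foldl (fun j => ImplOn.phaseFlip (T j) (hT j) (b j))
    (fun j j' hj => by exact_mod_cast hd j j' hj) Finset.univ.toList
    (Finset.nodup_toList _)).mono (Set.subset_univ _) le_rfl
  convert h using 1
  funext ψ z
  have main : ∀ (l : List J) (ψ : State Q),
      l.foldl (fun φ j => (fun (ψ : State Q) z =>
        if ∀ q ∈ T j, z q = b j q then -ψ z else ψ z) φ) ψ z =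
      (l.map fun j => if ∀ q ∈ T j, z q = b j q then (-1 : ℂ) else 1).prod * ψ z := by
    intro l
    induction l with
    | nil => intro ψ; simp
    | cons j l ih =>
      intro ψ
      rw [List.foldl_cons, ih, List.map_cons, List.prod_cons]
      by_cases h : ∀ q ∈ T j, z q = b j q
      · simp only [if_pos h]; ring
      · simp only [if_neg h]; ring
  rw [main, Finset.prod_map_toList]

end Amplify

/-! ### Random tables with independent rows: all columns empty, or all columns hit. -/

section Columns

variable {μ κ : Type} [Fintype μ] [DecidableEq μ] [Fintype κ] [DecidableEq κ]

theorem add_pow_sub_pow_le (a e : ℝ) (ha : 0 ≤ a) (he : 0 ≤ e) (h1 : a + e ≤ 1) (M : ℕ) :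
    (a + e) ^ M - a ^ M ≤ M * e := by
  induction M with
  | zero => simp
  | succ M ih =>
    have h2 : (a + e) ^ M ≤ 1 := pow_le_one₀ (by linarith) h1
    have h3 : 0 ≤ (a + e) ^ M - a ^ M := by
      have := pow_le_pow_left₀ ha (show a ≤ a + e by linarith) M
      linarith
    have h4 : a * ((a + e) ^ M - a ^ M) ≤ (a + e) ^ M - a ^ M :=
      mul_le_of_le_one_left h3 (by linarith)
    push_cast
    calc (a + e) ^ (M + 1) - a ^ (M + 1) = a * ((a + e) ^ M - a ^ M) + e * (a + e) ^ M := by ring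
      _ ≤ M * e + e * 1 := add_le_add (h4.trans ih) (mul_le_mul_of_nonneg_left h2 he)
      _ = (M + 1) * e := by ring

theorem sum_prod_rows (f : (κ → Bool) → ℝ) :
    ∑ a : μ → κ → Bool, ∏ j, f (a j) = (∑ z, f z) ^ Fintype.card μ := by
  rw [← Finset.card_univ, ← Finset.prod_const, Finset.prod_univ_sum, Fintype.piFinset_univ]

/-- Independent rows, each of which is zero on the `i`-th column with probability at most
`W 0 + e`, cover all the columns with high probability unless they are all zero. -/
theorem le_prob_cover [Nonempty κ] (W : (κ → Bool) → ℝ) (hW : ∀ z, 0 ≤ W z) (hsum : ∑ z, W z = 1)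
    (e : ℝ) (hcol : ∀ i, ∑ z, (if z i = false then W z else 0) ≤ W (fun _ => false) + e) :
    1 - W (fun _ => false) ^ Fintype.card μ - Fintype.card κ * (Fintype.card μ * e) ≤
      ∑ a : μ → κ → Bool, if ∀ i, ∃ j, a j i = true then ∏ j, W (a j) else 0 := by
  have hz : ∑ a : μ → κ → Bool, (if a = fun _ _ => false then ∏ j, W (a j) else 0)
      = W (fun _ => false) ^ Fintype.card μ := by
    rw [Finset.sum_ite_eq' Finset.univ]
    simp
  have hc : ∀ i, ∑ a : μ → κ → Bool, (if ∀ j, a j i = false then ∏ j, W (a j) else 0)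
      = (∑ z, if z i = false then W z else 0) ^ Fintype.card μ := by
    intro i
    rw [← sum_prod_rows]
    refine Finset.sum_congr rfl fun a _ => ?_
    rw [Finset.prod_ite_zero]
    simp
  have hcs : ∀ i, (∑ z, if z i = false then W z else 0) ^ Fintype.card μ
      - W (fun _ => false) ^ Fintype.card μ ≤ Fintype.card μ * e := by
    intro i
    set c := ∑ z, if z i = false then W z else 0 with hcdef
    have hle : W (fun _ => false) ≤ c := by
      have := Finset.single_le_sum (f := fun z => if z i = false then W z else 0)
        (fun z _ => by split_ifs; exacts [hW z, le_rfl]) (Finset.mem_univ fun _ => false)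
      simpa using this
    have h1 : c ≤ 1 := by
      rw [← hsum]
      refine Finset.sum_le_sum fun z _ => ?_
      split_ifs; exacts [le_rfl, hW z]
    have h2 := add_pow_sub_pow_le (W fun _ => false) (c - W fun _ => false) (hW _)
      (by linarith) (by linarith) (Fintype.card μ)
    rw [add_sub_cancel] at h2
    refine h2.trans (mul_le_mul_of_nonneg_left ?_ (Nat.cast_nonneg _))
    linarith [hcol i]
  -- A table covers every column, or is zero, or is nonzero with some empty column; the last case is
  -- bounded by a sum over columns from which the zero table has been removed.
  have hpt : ∀ a : μ → κ → Bool, ∏ j, W (a j) ≤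
      (if ∀ i, ∃ j, a j i = true then ∏ j, W (a j) else 0) +
      (if a = fun _ _ => false then ∏ j, W (a j) else 0) +
      ∑ i, ((if ∀ j, a j i = false then ∏ j, W (a j) else 0) -
        (if a = fun _ _ => false then ∏ j, W (a j) else 0)) := by
    intro a
    have hp : 0 ≤ ∏ j, W (a j) := Finset.prod_nonneg fun j _ => hW _
    have hnn : ∀ i, 0 ≤ (if ∀ j, a j i = false then ∏ j, W (a j) else 0) -
        (if a = fun _ _ => false then ∏ j, W (a j) else 0) := by
      intro i
      by_cases ha : a = fun _ _ => false
      · subst ha; simp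
      · rw [if_neg ha]
        split_ifs <;> simp [hp]
    have hs := Finset.sum_nonneg fun i (_ : i ∈ (Finset.univ : Finset κ)) => hnn i
    by_cases hcov : ∀ i, ∃ j, a j i = true
    · rw [if_pos hcov]
      have : 0 ≤ (if a = fun _ _ => false then ∏ j, W (a j) else 0) := by
        split_ifs; exacts [hp, le_rfl]
      linarith
    · rw [if_neg hcov]
      by_cases ha : a = fun _ _ => false
      · rw [if_pos ha] at hs ⊢
        linarith
      · rw [if_neg ha] at hs ⊢
        push Not at hcov
        obtain ⟨i, hi⟩ := hcov
        have h1 := Finset.single_le_sum (f := fun i =>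
          (if ∀ j, a j i = false then ∏ j, W (a j) else 0) -
          (if a = fun _ _ => false then ∏ j, W (a j) else 0)) (fun i _ => hnn i) (Finset.mem_univ i)
        simp only [if_neg ha, sub_zero] at h1 ⊢
        rw [if_pos (fun j => by simpa using hi j)] at h1
        linarith
  have htot : ∑ a : μ → κ → Bool, ∏ j, W (a j) = 1 := by
    rw [sum_prod_rows, hsum, one_pow]
  have hfin := Finset.sum_le_sum fun a (_ : a ∈ (Finset.univ : Finset (μ → κ → Bool))) => hpt a
  rw [htot, Finset.sum_add_distrib, Finset.sum_add_distrib, hz, Finset.sum_comm] at hfin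
  have hlast : ∑ i, ∑ a : μ → κ → Bool, ((if ∀ j, a j i = false then ∏ j, W (a j) else 0) -
        (if a = fun _ _ => false then ∏ j, W (a j) else 0))
        ≤ Fintype.card κ * (Fintype.card μ * e) := by
    rw [← nsmul_eq_mul, ← Finset.card_univ (α := κ)]
    refine Finset.sum_le_card_nsmul _ _ _ fun i _ => ?_
    rw [Finset.sum_sub_distrib, hz, hc]
    exact hcs i
  linarith

end Columns

/-! ### From a balanced superposition of constant strings to an exact parity circuit. -/

section Nekomata

variable {κ R : Type} [Fintype κ] [DecidableEq κ] [Fintype R] [DecidableEq R]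

/-- The embedding of the last summand. -/
def restEmb (κ R : Type) : R ↪ κ ⊕ (Unit ⊕ R) :=
  Function.Embedding.inr.trans Function.Embedding.inr

/-- The state `|x⟩|b⟩ ⊗ φ`. -/
noncomputable def loc (x : κ → Bool) (b : Bool) (φ : State R) : State (κ ⊕ (Unit ⊕ R)) := fun z =>
  if (∀ i, z (Sum.inl i) = x i) ∧ z (Sum.inr (Sum.inl ())) = b then φ fun r => z (restEmb κ R r) else 0

theorem loc_basis (x : κ → Bool) (b : Bool) (y : R → Bool) :
    loc x b (basis y) = basis (Sum.elim x (Sum.elim (fun _ => b) y)) := by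
  funext z
  simp only [loc, basis_apply, ← ite_and]
  refine if_congr ?_ rfl rfl
  constructor
  · rintro ⟨⟨h1, h2⟩, h3⟩
    funext q
    rcases q with i | ⟨⟨⟩ | r⟩
    · exact h1 i
    · exact h2
    · exact congrFun h3 r
  · rintro rfl
    exact ⟨⟨fun _ => rfl, rfl⟩, rfl⟩

theorem ImplOn.zero {Q : Type} [Fintype Q] [DecidableEq Q] {S : Set Q} {d : ℕ}
    {T : State Q → State Q} (h : ImplOn S d T) : T 0 = 0 := by
  simpa using h.smul 0 0

theorem liftOp_loc {d : ℕ} {T : State R → State R} (h : ImplOn (Set.univ : Set R) d T)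
    (x : κ → Bool) (b : Bool) (φ : State R) :
    liftOp (restEmb κ R) T (loc x b φ) = loc x b (T φ) := by
  funext z
  simp only [liftOp, loc]
  have h1 : ∀ y i, Function.extend (restEmb κ R) y z (Sum.inl i) = z (Sum.inl i) := fun y i =>
    extend_off _ _ _ (by rintro ⟨r, hr⟩; cases hr)
  have h2 : ∀ y, Function.extend (restEmb κ R) y z (Sum.inr (Sum.inl ()))
      = z (Sum.inr (Sum.inl ())) := fun y =>
    extend_off _ _ _ (by rintro ⟨r, hr⟩; cases hr)
  simp only [h1, h2, extend_comp]
  split_ifs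
  · rfl
  · exact congrFun h.zero _

/-- The phase `∏ (-1) ^ (x i * r (O i))`. -/
noncomputable def cphase (O : κ → R) (x : κ → Bool) (φ : State R) : State R := fun r =>
  (∏ i, if x i = true ∧ r (O i) = true then (-1 : ℂ) else 1) * φ r

theorem cphase_cphase (O : κ → R) (x : κ → Bool) (φ : State R) :
    cphase O x (cphase O x φ) = φ := by
  funext r
  simp only [cphase]
  rw [← mul_assoc, ← Finset.prod_mul_distrib, Finset.prod_eq_one, one_mul]
  intro i _
  split_ifs <;> norm_num

/-- Controlled signs between `x i` and qubit `O i`. The pairs are disjoint because `O` is injective,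
so all of them fit in parallel. -/
theorem ImplOn.cphases (O : κ ↪ R) :
    ∃ D, ImplOn (Set.univ : Set (κ ⊕ (Unit ⊕ R))) 7 D ∧
      ∀ x b φ, D (loc x b φ) = loc x b (cphase O x φ) := by
  refine ⟨_, ImplOn.phaseFlips (fun i : κ => {Sum.inl i, restEmb κ R (O i)}) (fun _ _ => true)
    (fun i => ?_) (fun i j hij => ?_), fun x b φ => ?_⟩
  · rw [Finset.card_pair]
    intro h
    cases h
  · simp only [Finset.disjoint_insert_left, Finset.disjoint_singleton_left, Finset.mem_insert,
      Finset.mem_singleton, not_or, restEmb, Function.Embedding.trans_apply,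
      Function.Embedding.inr_apply]
    refine ⟨⟨fun h => hij (by simpa using h), by simp⟩, by simp, fun h => hij ?_⟩
    simpa using h
  · funext z
    simp only [loc, cphase]
    split_ifs with h
    · congr 1
      refine Finset.prod_congr rfl fun i _ => ?_
      simp [← h.1]
    · rw [mul_zero]

/-- Reads off whether the working register has returned to its initial state. -/
theorem ImplOn.flipRest [Nonempty R] :
    ∃ X, ImplOn (Set.univ : Set (κ ⊕ (Unit ⊕ R))) 3 X ∧
      (∀ x b, X (loc x b (basis fun _ => false)) = loc x (!b) (basis fun _ => false)) ∧
      ∀ x b φ, φ (fun _ => false) = 0 → X (loc x b φ) = loc x b φ := by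
  have h := ImplOn.flip (Q := κ ⊕ (Unit ⊕ R)) (Finset.univ.map (restEmb κ R)) (by simp)
    (fun _ => false) (Sum.inr (Sum.inl ())) (by simp [restEmb])
  refine ⟨_, h.mono (Set.subset_univ _) le_rfl, fun x b => ?_, fun x b φ hφ => ?_⟩
  all_goals
    funext z
    simp only [loc, Finset.mem_map, Finset.mem_univ, true_and, forall_exists_index,
      forall_apply_eq_imp_iff, reduceCtorEq, false_and, decide_false, Bool.xor_false]
    have hr : ∀ r, (Sum.inr (Sum.inl ()) : κ ⊕ (Unit ⊕ R)) = restEmb κ R r ↔ False := by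
      intro r
      simp [restEmb]
    simp only [hr, false_and, decide_false, Bool.xor_false]
    by_cases hz : ∀ r, z (restEmb κ R r) = false
    · have hz' : (fun r => z (restEmb κ R r)) = fun _ => false := funext hz
      simp [basis_apply, *]
    · have hz' : (fun r => z (restEmb κ R r)) ≠ fun _ => false := fun h => hz (congrFun h)
      simp [basis_apply, *]

theorem ImplOn.notOut :
    ∃ X, ImplOn (Set.univ : Set (κ ⊕ (Unit ⊕ R))) 1 X ∧
      ∀ x b φ, X (loc x b φ) = loc x (!b) φ := by
  refine ⟨_, (ImplOn.nots (Q := κ ⊕ (Unit ⊕ R)) {Sum.inr (Sum.inl ())}).mono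
    (Set.subset_univ _) le_rfl, fun x b φ => ?_⟩
  funext z
  simp only [loc, Finset.mem_singleton, reduceCtorEq, if_false, restEmb,
    Function.Embedding.trans_apply, Function.Embedding.inr_apply, Sum.inr.injEq, if_true]
  refine if_congr (and_congr_right fun _ => ?_) rfl rfl
  cases z (Sum.inr (Sum.inl ())) <;> cases b <;> simp

theorem prod_sign (O : κ → R) (x : κ → Bool) (r : R → Bool) (b : Bool) (h : ∀ i, r (O i) = b) :
    (∏ i, if x i = true ∧ r (O i) = true then (-1 : ℂ) else 1) = if b then (-1) ^ ones x else 1 := by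
  cases b
  · simp [h]
  · rw [if_pos rfl, ones, ← Finset.prod_pow_eq_pow_sum]
    refine Finset.prod_congr rfl fun i _ => ?_
    cases hx : x i <;> simp [h]

/-- A state which is supported on `O`-constant strings, with equal probabilities of the two
constants, yields an exact parity circuit. -/
theorem ImplOn.parityOfNekomata [Nonempty κ] {d : ℕ} {B : State R → State R}
    (hB : ImplOn (Set.univ : Set R) d B) (O : κ ↪ R)
    (hsupp : ∀ z, B (basis fun _ => false) z ≠ 0 → ∃ b, ∀ i, z (O i) = b)
    (hbal : ∑ z, (if ∀ i, z (O i) = true then ‖B (basis fun _ => false) z‖ ^ 2 else 0) =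
      ∑ z, (if ∀ i, z (O i) = false then ‖B (basis fun _ => false) z‖ ^ 2 else 0)) :
    ∃ T, ImplOn (Set.univ : Set (κ ⊕ (Unit ⊕ R))) (4 * d + 18) T ∧ ∀ x : κ → Bool,
      T (loc x false (basis fun _ => false)) =
        loc x (decide (ones x % 2 = 1)) (basis fun _ => false) := by
  have : Nonempty R := ⟨O (Classical.arbitrary κ)⟩
  obtain ⟨B', hB', h1, h2⟩ := hB.inv
  obtain ⟨D, hD, hD'⟩ := ImplOn.cphases O
  obtain ⟨X, hX, hX1, hX2⟩ := ImplOn.flipRest (κ := κ) (R := R)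
  obtain ⟨N, hN, hN'⟩ := ImplOn.notOut (κ := κ) (R := R)
  have hBl := (hB.map (restEmb κ R)).mono (Set.subset_univ _) le_rfl
  have hBl' := (hB'.map (restEmb κ R)).mono (Set.subset_univ _) le_rfl
  -- `V = B⁻¹ D B` fixes the initial register state for even weight and maps it to an orthogonal
  -- state for odd weight. After the answer has been recorded, a second `V` restores the register,
  -- as `V` is its own inverse here. The recorded bit says "even", hence the final NOT.
  have hV := (hBl.comp hD).comp hBl'
  refine ⟨_, (((hV.comp hX).comp hV).comp hN).mono le_rfl (by omega), fun x => ?_⟩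
  set β := B (basis fun _ => false) with hβ
  have hVl : ∀ b φ, liftOp (restEmb κ R) B' (D (liftOp (restEmb κ R) B (loc x b φ)))
      = loc x b (B' (cphase O x (B φ))) := by
    intro b φ
    rw [liftOp_loc hB, hD', liftOp_loc hB']
  simp only [hVl]
  have hVV : B' (cphase O x (B (B' (cphase O x (B (basis fun _ => false))))))
      = basis fun _ => false := by
    rw [h2, cphase_cphase, h1]
  rcases Nat.mod_two_eq_zero_or_one (ones x) with hx | hx
  -- Even weight: the sign is `1` on both constant branches, so the phases do nothing.
  · have hfix : B' (cphase O x β) = basis fun _ => false := by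
      have : cphase O x β = β := by
        funext z
        rw [cphase]
        by_cases hz : β z = 0
        · rw [hz, mul_zero]
        · obtain ⟨b, hb⟩ := hsupp z hz
          rw [prod_sign O x z b hb, (Nat.even_iff.2 hx).neg_one_pow]
          simp
      rw [this, hβ, h1]
    rw [← hβ, hfix, hX1, hVl, ← hβ, hfix, hN', hx]
    rfl
  -- Odd weight: the branches acquire opposite signs, and their equal probabilities cancel in the
  -- overlap with the initial state.
  · have hzero : B' (cphase O x β) (fun _ => false) = 0 := by
      rw [← ip_basis (fun _ => false) (B' _), ← hB.ip_eq, h2, ← hβ, ip]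
      have : ∀ z, star (β z) * cphase O x β z =
          (((if ∀ i, z (O i) = false then ‖β z‖ ^ 2 else 0) -
            (if ∀ i, z (O i) = true then ‖β z‖ ^ 2 else 0) : ℝ) : ℂ) := by
        intro z
        by_cases hz : β z = 0
        · simp [hz]
        · obtain ⟨b, hb⟩ := hsupp z hz
          rw [cphase, prod_sign O x z b hb, (Nat.odd_iff.2 hx).neg_one_pow]
          cases b
          · have : ¬ ∀ i, z (O i) = true := fun h => by
              have := h (Classical.arbitrary κ)
              rw [hb] at this
              cases this
            rw [if_pos hb, if_neg this, if_neg Bool.false_ne_true, one_mul, star_mul_self_eq,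
              sub_zero]
          · have : ¬ ∀ i, z (O i) = false := fun h => by
              have := h (Classical.arbitrary κ)
              rw [hb] at this
              cases this
            rw [if_pos hb, if_neg this, if_pos rfl, mul_left_comm, star_mul_self_eq]
            push_cast
            ring
      rw [Finset.sum_congr rfl fun z _ => this z, ← Complex.ofReal_sum, Finset.sum_sub_distrib,
        hbal, sub_self, Complex.ofReal_zero]
    rw [← hβ, hX2 _ _ _ hzero, hVl, hVV, hN', hx]
    rfl

end Nekomata

/-! ### Sums over strings on composite index types, and marginals. -/

section SumLemmas

variable {α β κ : Type} [Fintype α] [DecidableEq α] [Fintype β] [DecidableEq β]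
  [Fintype κ] [DecidableEq κ]

theorem sum_sumArrow (f : (α ⊕ β → Bool) → ℝ) :
    ∑ z, f z = ∑ a : α → Bool, ∑ b : β → Bool, f (Sum.elim a b) := by
  rw [← Fintype.sum_prod_type']
  exact Fintype.sum_equiv (Equiv.sumArrowEquivProdArrow α β Bool) _ _ fun z => by
    congr 1
    exact (Sum.elim_comp_inl_inr z).symm

theorem sum_prodArrow (f : (α × β → Bool) → ℝ) :
    ∑ z, f z = ∑ a : α → β → Bool, f (fun p => a p.1 p.2) :=
  Fintype.sum_equiv (Equiv.curry α β Bool) _ _ fun _ => rfl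

theorem sum_prod_fix (f : κ → Bool → ℝ) (hf : ∀ i, ∑ b, f i b = 1) (i : κ) :
    ∑ z : κ → Bool, (if z i = false then ∏ j, f j (z j) else 0) = f i false := by
  have h : ∀ z : κ → Bool, (if z i = false then ∏ j, f j (z j) else 0)
      = ∏ j, (if j = i ∧ z j = true then 0 else f j (z j)) := by
    intro z
    split_ifs with hz
    · refine Finset.prod_congr rfl fun j _ => ?_
      rw [if_neg]
      rintro ⟨rfl, h⟩
      rw [hz] at h
      cases h
    · refine (Finset.prod_eq_zero (Finset.mem_univ i) ?_).symm
      exact if_pos ⟨rfl, by simpa using hz⟩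
  rw [Finset.sum_congr rfl fun z _ => h z, ← Fintype.piFinset_univ,
    ← Finset.prod_univ_sum (fun _ => Finset.univ) fun j b => if j = i ∧ b = true then 0 else f j b,
    Finset.prod_eq_single i]
  · simp
  · intro j _ hj
    simpa [hj] using hf j
  · simp

theorem norm_vec_sq (θ : ℝ) : ∑ b, ‖vec θ b‖ ^ 2 = 1 := by
  simp only [vec, Fintype.sum_bool, if_true, Bool.false_eq_true, if_false, Complex.norm_real,
    Real.norm_eq_abs, sq_abs, Real.sin_sq_add_cos_sq]

theorem norm_vec_false (θ : ℝ) : ‖vec θ false‖ ^ 2 = Real.cos θ ^ 2 := by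
  simp only [vec, Bool.false_eq_true, if_false, Complex.norm_real, Real.norm_eq_abs, sq_abs]

theorem exists_cos_sq {p : ℝ} (h0 : 0 ≤ p) (h1 : p ≤ 1) : ∃ θ : ℝ, Real.cos θ ^ 2 = p := by
  refine ⟨Real.arccos (Real.sqrt p), ?_⟩
  rw [Real.cos_arccos (by linarith [Real.sqrt_nonneg p]) (Real.sqrt_le_one.2 h1), Real.sq_sqrt h0]

end SumLemmas

/-! ### The row states and the probabilities of the two constant outcomes. -/

section NekomataCircuit

variable {μ κ : Type} [Fintype μ] [DecidableEq μ] [Fintype κ] [DecidableEq κ]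

/-- One row of the nekomata circuit. -/
noncomputable def rowState (κ : Type) [Fintype κ] [DecidableEq κ] (θ : ℝ) : State κ :=
  basis (fun _ => false) + (-(2 * ip (prodQ fun _ : κ => vec θ) (basis fun _ => false))) •
    prodQ fun _ => vec θ

theorem rowState_apply (θ : ℝ) (z : κ → Bool) : rowState κ θ z =
    (if z = fun _ => false then 1 else 0)
      - 2 * (Real.cos θ : ℂ) ^ Fintype.card κ * ∏ i, vec θ (z i) := by
  rw [rowState, basis_false_eq, ip_vec, ← basis_false_eq]
  simp only [Pi.add_apply, Pi.smul_apply, smul_eq_mul, basis_apply, sub_zero, Finset.prod_const,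
    Finset.card_univ, prodQ]
  push_cast
  ring

theorem norm_rowState_zero (θ : ℝ) : ‖rowState κ θ (fun _ => false)‖ ^ 2
    = (1 - 2 * (Real.cos θ ^ 2) ^ Fintype.card κ) ^ 2 := by
  rw [rowState_apply, if_pos rfl, Finset.prod_const, Finset.card_univ,
    show vec θ false = (Real.cos θ : ℂ) from rfl, ← Complex.ofReal_pow, ← Complex.ofReal_one,
    ← Complex.ofReal_ofNat, ← Complex.ofReal_mul, ← Complex.ofReal_mul, ← Complex.ofReal_sub,
    Complex.norm_real, Real.norm_eq_abs, sq_abs]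
  ring

theorem sum_norm_rowState (hκ : 2 ≤ Fintype.card κ) (θ : ℝ) :
    ∑ z, ‖rowState κ θ z‖ ^ 2 = 1 := by
  have h := (ImplOn.reflect_prodQ (Q := κ) (fun _ => θ) hκ).ip_eq (basis fun _ => false)
    (basis fun _ => false)
  rw [ip_basis, basis_apply, if_pos rfl] at h
  change ip (rowState κ θ) (rowState κ θ) = 1 at h
  rw [ip_self] at h
  exact_mod_cast h

/-- Away from the all-zero string a row is `2 cos θ ^ κ` times a product state in which each bit is
zero with probability only `cos² θ`: a row that is not zero is most likely all ones. -/
theorem rowState_column (θ : ℝ) (i : κ) :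
    ∑ z, (if z i = false then ‖rowState κ θ z‖ ^ 2 else 0) ≤
      ‖rowState κ θ (fun _ => false)‖ ^ 2
        + 4 * (Real.cos θ ^ 2) ^ Fintype.card κ * Real.cos θ ^ 2 := by
  have hpt : ∀ z : κ → Bool, (if z i = false then ‖rowState κ θ z‖ ^ 2 else 0) ≤
      (if z = fun _ => false then ‖rowState κ θ z‖ ^ 2 else 0) +
      4 * (Real.cos θ ^ 2) ^ Fintype.card κ *
        (if z i = false then ∏ j, ‖vec θ (z j)‖ ^ 2 else 0) := by
    intro z
    by_cases hz : z = fun _ => false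
    · rw [if_pos hz, if_pos (congrFun hz i), if_pos (congrFun hz i)]
      have : 0 ≤ 4 * (Real.cos θ ^ 2) ^ Fintype.card κ * ∏ j, ‖vec θ (z j)‖ ^ 2 := by positivity
      linarith
    · rw [if_neg hz, zero_add]
      split_ifs
      · rw [rowState_apply, if_neg hz, zero_sub, norm_neg, norm_mul, norm_mul, mul_pow, mul_pow,
          norm_prod, Finset.prod_pow, norm_pow, Complex.norm_real, Real.norm_eq_abs, ← pow_mul,
          mul_comm (Fintype.card κ) 2, pow_mul, sq_abs]
        norm_num
      · simp
  refine (Finset.sum_le_sum fun z _ => hpt z).trans ?_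
  rw [Finset.sum_add_distrib, ← Finset.mul_sum, Finset.sum_ite_eq' Finset.univ,
    if_pos (Finset.mem_univ _), sum_prod_fix (fun _ b => ‖vec θ b‖ ^ 2) (fun _ => norm_vec_sq θ),
    norm_vec_false]

/-- The probability that the measured column indicators are all equal to `b`. -/
noncomputable def colProb (μ κ : Type) [Fintype μ] [DecidableEq μ] [Fintype κ] [DecidableEq κ]
    (θ : ℝ) (b : Bool) : ℝ :=
  ∑ a : μ → κ → Bool, if ∀ i, decide (∀ j, a j i = false) = b then
    ∏ j, ‖rowState κ θ (a j)‖ ^ 2 else 0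

theorem colProb_true (θ : ℝ) [Nonempty κ] : colProb μ κ θ true
    = (1 - 2 * (Real.cos θ ^ 2) ^ Fintype.card κ) ^ (2 * Fintype.card μ) := by
  have h : ∀ a : μ → κ → Bool, (∀ i, decide (∀ j, a j i = false) = true) ↔ a = fun _ _ => false := by
    intro a
    simp only [decide_eq_true_eq]
    exact ⟨fun h => funext fun j => funext fun i => h i j, by rintro rfl; simp⟩
  simp only [colProb, h]
  rw [Finset.sum_ite_eq' Finset.univ, if_pos (Finset.mem_univ _), Finset.prod_const,
    Finset.card_univ, norm_rowState_zero, ← pow_mul]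

theorem le_colProb_false (θ : ℝ) [Nonempty κ] (hκ : 2 ≤ Fintype.card κ) :
    1 - colProb μ κ θ true - Fintype.card κ * (Fintype.card μ *
      (4 * (Real.cos θ ^ 2) ^ Fintype.card κ * Real.cos θ ^ 2)) ≤ colProb μ κ θ false := by
  have h := le_prob_cover (μ := μ) (fun z : κ → Bool => ‖rowState κ θ z‖ ^ 2)
    (fun z => by positivity) (sum_norm_rowState hκ θ) _ (rowState_column θ)
  rw [norm_rowState_zero, ← pow_mul, ← colProb_true] at h
  simpa [colProb] using h

/-- With `h1`, all `M` rows vanish with probability `(1 - 1/(2M)) ^ (2M)`, which lies between `1/4`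
and `1/2`. Mixed outcomes cost at most `κ cos² θ ≤ 1/8` by a union bound over the columns, so the
remaining probability also exceeds `1/8`. -/
theorem one_eighth_le_colProb [Nonempty κ] (hμ : 0 < Fintype.card μ) (hκ : 2 ≤ Fintype.card κ)
    (θ : ℝ) (h1 : (Real.cos θ ^ 2) ^ Fintype.card κ = 1 / (4 * Fintype.card μ))
    (h2 : Real.cos θ ^ 2 ≤ 1 / (8 * Fintype.card κ)) (b : Bool) : 1 / 8 ≤ colProb μ κ θ b := by
  have hμ' : (1 : ℝ) ≤ Fintype.card μ := by exact_mod_cast hμ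
  have hκ' : (0 : ℝ) < Fintype.card κ := by positivity
  set M : ℝ := (Fintype.card μ : ℝ) with hM
  have hx : 1 - 2 * (1 / (4 * M)) = 1 - 1 / (2 * M) := by field_simp; ring
  have ht : colProb μ κ θ true = ((1 - 1 / (2 * M)) ^ Fintype.card μ) ^ 2 := by
    rw [colProb_true, h1, hx, mul_comm 2 (Fintype.card μ), pow_mul]
  have hle : 1 / (2 * M) ≤ 1 / 2 := by
    rw [div_le_div_iff₀ (by positivity) (by norm_num)]
    linarith
  cases b
  · have hup : colProb μ κ θ true ≤ 1 / 2 := by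
      have h3 : 1 - 1 / (2 * M) ≤ Real.exp (-(1 / (2 * M))) := by
        linarith [Real.add_one_le_exp (-(1 / (2 * M)))]
      have h4 : (1 - 1 / (2 * M)) ^ Fintype.card μ ≤ Real.exp (-(1 / 2)) := by
        refine (pow_le_pow_left₀ (by linarith) h3 _).trans (le_of_eq ?_)
        rw [← Real.exp_nat_mul, ← hM]
        congr 1
        field_simp
      have h5 : ((1 - 1 / (2 * M)) ^ Fintype.card μ) ^ 2 ≤ Real.exp (-1) := by
        refine (pow_le_pow_left₀ (pow_nonneg (by linarith) _) h4 _).trans (le_of_eq ?_)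
        rw [← Real.exp_nat_mul]
        norm_num
      rw [ht]
      linarith [Real.exp_neg_one_lt_d9]
    refine le_trans ?_ (le_colProb_false θ hκ)
    rw [h1, ← hM]
    have h6 : (Fintype.card κ : ℝ) * (M * (4 * (1 / (4 * M)) * Real.cos θ ^ 2)) ≤ 1 / 8 := by
      have : (Fintype.card κ : ℝ) * (M * (4 * (1 / (4 * M)) * Real.cos θ ^ 2))
          = Fintype.card κ * Real.cos θ ^ 2 := by field_simp
      rw [this]
      calc (Fintype.card κ : ℝ) * Real.cos θ ^ 2 ≤ Fintype.card κ * (1 / (8 * Fintype.card κ)) :=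
            mul_le_mul_of_nonneg_left h2 hκ'.le
        _ = 1 / 8 := by field_simp
    linarith
  · rw [ht]
    have h3 : 1 / 2 ≤ (1 - 1 / (2 * M)) ^ Fintype.card μ := by
      have := one_add_mul_le_pow (a := -(1 / (2 * M))) (by linarith) (Fintype.card μ)
      rw [← hM, ← sub_eq_add_neg] at this
      have e : M * -(1 / (2 * M)) = -(1 / 2) := by field_simp
      rw [e] at this
      linarith
    nlinarith

end NekomataCircuit

/-! ### Preparing the exactly balanced state. -/

section NekomataCircuit

variable {μ κ : Type} [Fintype μ] [DecidableEq μ] [Fintype κ] [DecidableEq κ]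

/-- The amplitudes of the state consisting of rows, column indicators and two extra qubits. -/
noncomputable def tableState (μ κ : Type) [Fintype μ] [DecidableEq μ] [Fintype κ] [DecidableEq κ]
    (θ : ℝ) (η : Bool → ℝ) : State ((μ × κ) ⊕ (κ ⊕ Bool)) := fun z =>
  if ∀ i, z (Sum.inr (Sum.inl i)) = decide (∀ j, z (Sum.inl (j, i)) = false) then
    (∏ j, rowState κ θ fun i => z (Sum.inl (j, i))) * ∏ b, vec (η b) (z (Sum.inr (Sum.inr b))) else 0

/-- The embedding of the rows. -/
def rowEmb (μ κ : Type) : (Σ _ : μ, κ) ↪ (μ × κ) ⊕ (κ ⊕ Bool) :=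
  (Equiv.sigmaEquivProd μ κ).toEmbedding.trans Function.Embedding.inl

theorem prod_off_rowEmb (f : (μ × κ) ⊕ (κ ⊕ Bool) → ℂ) [DecidablePred (· ∈ Set.range (rowEmb μ κ))] :
    ∏ q with q ∉ Set.range (rowEmb μ κ), f q = ∏ q : κ ⊕ Bool, f (Sum.inr q) := by
  refine (Finset.prod_congr ?_ fun _ _ => rfl).trans
    (Finset.prod_map Finset.univ Function.Embedding.inr f)
  ext q
  rcases q with ⟨j, i⟩ | q
  · simp [rowEmb]
  · simp [rowEmb]

/-- Reflecting `|0…0⟩` in each row produces `rowState`; flips controlled on zeros then write into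
each column indicator whether its column is empty. The two extra qubits are only rotated. -/
theorem ImplOn.tables [Nonempty μ] (hκ : 2 ≤ Fintype.card κ) (θ : ℝ) (η : Bool → ℝ) :
    ∃ A, ImplOn (Set.univ : Set ((μ × κ) ⊕ (κ ⊕ Bool))) 13 A ∧
      A (basis fun _ => false) = tableState μ κ θ η := by
  classical
  obtain ⟨A₁, hA₁, hA₁'⟩ := ImplOn.rots (Q := (μ × κ) ⊕ (κ ⊕ Bool))
    (Sum.elim (fun _ => 0) (Sum.elim (fun _ => 0) η))
  obtain ⟨A₂, hA₂, hA₂'⟩ := ImplOn.sigma (rowEmb μ κ)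
    (fun _ => ImplOn.reflect_prodQ (Q := κ) (fun _ => θ) hκ)
  have hF := ImplOn.flips (Q := (μ × κ) ⊕ (κ ⊕ Bool))
    (fun i : κ => Finset.univ.image fun j : μ => Sum.inl (j, i)) (fun _ _ => false)
    (fun i => Sum.inr (Sum.inl i)) (fun i => by simp) (fun i => by simp) (fun i i' h => by
      rw [Finset.disjoint_left]
      rintro q hq hq'
      simp only [Finset.mem_insert, Finset.mem_image, Finset.mem_univ, true_and] at hq hq'
      rcases hq with rfl | ⟨j, rfl⟩ <;> simp at hq' <;> exact h (by simp [hq']))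
  refine ⟨_, (hA₁.comp hA₂).comp hF, ?_⟩
  have h1 : A₁ (basis fun _ => false) = prodQ fun q : (μ × κ) ⊕ (κ ⊕ Bool) =>
      vec ((Sum.elim (fun _ => 0) (Sum.elim (fun _ => 0) η) : _ → ℝ) q) := by
    rw [basis_false_eq, hA₁' fun _ => 0]
    simp only [add_zero]
  rw [h1, hA₂']
  funext z
  have hrow : ∀ j, (basis (fun _ => false) : State κ) = prodQ fun r => vec ((Sum.elim (fun _ => 0)
      (Sum.elim (fun _ => 0) η) : (μ × κ) ⊕ (κ ⊕ Bool) → ℝ) (rowEmb μ κ ⟨j, r⟩)) := by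
    intro j
    rw [basis_false_eq]
    rfl
  simp only [← hrow]
  rw [prod_off_rowEmb, Fintype.prod_sum_type]
  have hz1 : ∀ p, flipMap (fun i : κ => Finset.univ.image fun j : μ =>
      (Sum.inl (j, i) : (μ × κ) ⊕ (κ ⊕ Bool))) (fun _ _ => false) (fun i => Sum.inr (Sum.inl i)) z
      (Sum.inl p) = z (Sum.inl p) := by
    intro p
    simp [flipMap]
  have hz2 : ∀ b, flipMap (fun i : κ => Finset.univ.image fun j : μ =>
      (Sum.inl (j, i) : (μ × κ) ⊕ (κ ⊕ Bool))) (fun _ _ => false) (fun i => Sum.inr (Sum.inl i)) z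
      (Sum.inr (Sum.inr b)) = z (Sum.inr (Sum.inr b)) := by
    intro p
    simp [flipMap]
  have hz3 : ∀ i, flipMap (fun i : κ => Finset.univ.image fun j : μ =>
      (Sum.inl (j, i) : (μ × κ) ⊕ (κ ⊕ Bool))) (fun _ _ => false) (fun i => Sum.inr (Sum.inl i)) z
      (Sum.inr (Sum.inl i)) = xor (z (Sum.inr (Sum.inl i)))
        (decide (∀ j, z (Sum.inl (j, i)) = false)) := by
    intro i
    simp [flipMap]
  have hrng : ∀ j r, rowEmb μ κ ⟨j, r⟩ = Sum.inl (j, r) := fun _ _ => rfl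
  simp only [hrng, hz1, hz2, hz3, Sum.elim_inr, Sum.elim_inl, vec_zero]
  have hk : ∏ i, ket false (xor (z (Sum.inr (Sum.inl i))) (decide (∀ j, z (Sum.inl (j, i)) = false)))
      = if ∀ i, z (Sum.inr (Sum.inl i)) = decide (∀ j, z (Sum.inl (j, i)) = false) then 1 else 0 := by
    have hx : ∀ a b : Bool, (xor a b = false) = (a = b) := by decide
    simp only [ket, hx]
    rw [Finset.prod_ite_zero]
    simp
  rw [hk, tableState]
  split_ifs
  · rw [one_mul]
    rfl
  · rw [zero_mul, mul_zero]

theorem prob_tableState (θ : ℝ) (η : Bool → ℝ) (b : Bool) :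
    ∑ z, (if (∀ i, z (Sum.inr (Sum.inl i)) = b) ∧ z (Sum.inr (Sum.inr b)) = false then
      ‖tableState μ κ θ η z‖ ^ 2 else 0) = colProb μ κ θ b * Real.cos (η b) ^ 2 := by
  have hu := sum_prod_fix (fun c d => ‖vec (η c) d‖ ^ 2) (fun c => norm_vec_sq (η c)) b
  rw [norm_vec_false] at hu
  rw [sum_sumArrow, sum_prodArrow, colProb, Finset.sum_mul]
  refine Finset.sum_congr rfl fun a _ => ?_
  rw [sum_sumArrow, ← hu, Finset.mul_sum, Finset.sum_comm]
  refine Finset.sum_congr rfl fun u _ => ?_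
  simp only [Sum.elim_inl, Sum.elim_inr, tableState]
  have h1 : ∀ o : κ → Bool, (∀ i, o i = decide (∀ j, a j i = false)) ↔
      o = fun i => decide (∀ j, a j i = false) := fun o => funext_iff.symm
  have h2 : ∀ o : κ → Bool, (if (∀ i, o i = b) ∧ u b = false then
      ‖(if ∀ i, o i = decide (∀ j, a j i = false) then
        (∏ j, rowState κ θ fun i => a j i) * ∏ b, vec (η b) (u b) else 0 : ℂ)‖ ^ 2 else 0) =
      if o = (fun i => decide (∀ j, a j i = false)) then
        (if (∀ i, decide (∀ j, a j i = false) = b) ∧ u b = false then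
          (∏ j, ‖rowState κ θ (a j)‖ ^ 2) * ∏ b, ‖vec (η b) (u b)‖ ^ 2 else 0) else 0 := by
    intro o
    rw [if_congr (h1 o) rfl rfl]
    by_cases ho : o = fun i => decide (∀ j, a j i = false)
    · subst ho
      rw [if_pos rfl, if_pos rfl, norm_mul, mul_pow, norm_prod, norm_prod, Finset.prod_pow,
        Finset.prod_pow]
    · rw [if_neg ho, if_neg ho]
      simp
  refine (Finset.sum_congr rfl fun o _ => h2 o).trans ?_
  rw [Finset.sum_ite_eq' Finset.univ,
    if_pos (Finset.mem_univ _), ← ite_zero_mul_ite_zero]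

/-- An exact two-column balanced superposition of the strings that are constant on the column
indicators. -/
theorem ImplOn.nekomata [Nonempty μ] (hκ : 2 ≤ Fintype.card κ) (θ : ℝ)
    (h1 : (Real.cos θ ^ 2) ^ Fintype.card κ = 1 / (4 * Fintype.card μ))
    (h2 : Real.cos θ ^ 2 ≤ 1 / (8 * Fintype.card κ)) :
    ∃ B, ImplOn (Set.univ : Set ((μ × κ) ⊕ (κ ⊕ Bool))) 60 B ∧
      (∀ z, B (basis fun _ => false) z ≠ 0 → ∃ b, ∀ i, z (Sum.inr (Sum.inl i)) = b) ∧
      ∀ b, ∑ z, (if ∀ i, z (Sum.inr (Sum.inl i)) = b then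
        ‖B (basis fun _ => false) z‖ ^ 2 else 0) = 1 / 2 := by
  have hne : Nonempty κ := Fintype.card_pos_iff.1 (by omega)
  have hp : ∀ b, 1 / 8 ≤ colProb μ κ θ b := one_eighth_le_colProb Fintype.card_pos hκ θ h1 h2
  -- The extra qubit `b` dilutes the outcome "constantly `b`" to probability exactly `1/8`. The two
  -- outcomes become equally likely and have total probability `1/4`, as exact amplification
  -- requires.
  have hη : ∀ b, ∃ η : ℝ, Real.cos η ^ 2 = 1 / (8 * colProb μ κ θ b) := fun b => by
    have := hp b
    refine exists_cos_sq (by positivity) ?_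
    rw [div_le_one (by linarith)]
    linarith
  choose η hη using hη
  obtain ⟨A, hA, hA'⟩ := ImplOn.tables (μ := μ) hκ θ η
  have hpr : ∀ b, ∑ z, (if (∀ i, z (Sum.inr (Sum.inl i)) = b) ∧ z (Sum.inr (Sum.inr b)) = false then
      ‖tableState μ κ θ η z‖ ^ 2 else 0) = 1 / 8 := by
    intro b
    have := hp b
    rw [prob_tableState, hη]
    field_simp
  let Pb : Bool → ((μ × κ) ⊕ (κ ⊕ Bool) → Bool) → Prop := fun b z =>
    (∀ i, z (Sum.inr (Sum.inl i)) = b) ∧ z (Sum.inr (Sum.inr b)) = false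
  have hdec : ∀ b z, Decidable (Pb b z) := fun b z => inferInstanceAs (Decidable (_ ∧ _))
  have hPr : ∀ b, ∑ z, (if Pb b z then ‖tableState μ κ θ η z‖ ^ 2 else 0) = 1 / 8 := fun b => by
    convert hpr b
  have hexcl : ∀ b c z, Pb b z → (∀ i, z (Sum.inr (Sum.inl i)) = c) → c = b := by
    intro b c z h h'
    rw [← h' (Classical.arbitrary κ), h.1]
  have hflip : ∀ b : Bool, ImplOn (Set.univ : Set ((μ × κ) ⊕ (κ ⊕ Bool))) 7
      (fun ψ z => if Pb b z then -ψ z else ψ z) := by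
    intro b
    have h := (ImplOn.phaseFlip (Q := (μ × κ) ⊕ (κ ⊕ Bool))
      (insert (Sum.inr (Sum.inr b)) (Finset.univ.image fun i : κ => Sum.inr (Sum.inl i))) (by
        rw [Finset.card_insert_of_notMem (by simp), Finset.card_image_of_injective _ (by
          intro i j h; simpa using h), Finset.card_univ]
        omega) (Sum.elim (fun _ => b) (Sum.elim (fun _ => b) fun _ => false))).mono
          (Set.subset_univ _) le_rfl
    convert h using 5
    simp [Pb, and_comm]
  -- The two events exclude each other, so flipping both signs in turn flips the sign of their
  -- union.
  have hP := (hflip true).comp (hflip false)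
  have hP' : ImplOn (Set.univ : Set ((μ × κ) ⊕ (κ ⊕ Bool))) (7 + 7)
      (fun ψ z => if Pb true z ∨ Pb false z then -ψ z else ψ z) := by
    convert hP using 3 with ψ z
    by_cases ht : Pb true z
    · have : ¬ Pb false z := fun h => by cases hexcl _ _ z h ht.1
      simp [ht, this]
    · simp [ht]
  obtain ⟨B, hB, hB'⟩ := hA.amplify (by simp; omega) (fun z => Pb true z ∨ Pb false z) hP' (by
    have hsplit : ∀ z, (if Pb true z ∨ Pb false z then ‖A (basis fun _ => false) z‖ ^ 2 else 0) =
        (if Pb true z then ‖tableState μ κ θ η z‖ ^ 2 else 0) +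
        (if Pb false z then ‖tableState μ κ θ η z‖ ^ 2 else 0) := by
      intro z
      rw [hA']
      by_cases ht : Pb true z
      · have : ¬ Pb false z := fun h => by cases hexcl _ _ z h ht.1
        simp [ht, this]
      · simp [ht]
    rw [Finset.sum_congr rfl fun z _ => hsplit z, Finset.sum_add_distrib, hPr true, hPr false]
    norm_num)
  refine ⟨B, hB, fun z hz => ?_, fun b => ?_⟩
  · rw [hB'] at hz
    by_cases h : Pb true z ∨ Pb false z
    · rcases h with h | h
      · exact ⟨_, h.1⟩
      · exact ⟨_, h.1⟩
    · simp [h] at hz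
  · have : ∀ z, (if ∀ i, z (Sum.inr (Sum.inl i)) = b then ‖B (basis fun _ => false) z‖ ^ 2 else 0)
        = 4 * if Pb b z then ‖tableState μ κ θ η z‖ ^ 2 else 0 := by
      intro z
      rw [hB', hA']
      beta_reduce
      by_cases h : Pb b z
      · have h' : Pb true z ∨ Pb false z := by cases b <;> simp [h]
        rw [if_pos h.1, if_pos h, if_pos h', norm_mul, mul_pow]
        norm_num
      · rw [if_neg h, mul_zero]
        split_ifs with h3 h4
        · exfalso
          rcases h4 with h4 | h4 <;>
          · have := hexcl _ _ z h4 h3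
            subst this
            exact h h4
        · simp
        · rfl
    rw [Finset.sum_congr rfl fun z _ => this z, ← Finset.mul_sum, hPr b]
    norm_num

end NekomataCircuit

/-! ### Circuits acting as maps of basis states on subregisters. -/

section BasisMaps

variable {Q : Type} [Fintype Q] [DecidableEq Q]

theorem ImplOn.sigma_basis {J : Type} [Fintype J] [DecidableEq J] {R : J → Type}
    [∀ j, Fintype (R j)] [∀ j, DecidableEq (R j)] (e : (Σ j, R j) ↪ Q)
    {S : ∀ j, Set (R j)} {d : ℕ} {T : ∀ j, State (R j) → State (R j)}
    (h : ∀ j, ImplOn (S j) d (T j)) :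
    ∃ U, ImplOn (Set.univ : Set Q) d U ∧ ∀ b b' : Q → Bool,
      (∀ j, T j (basis fun r => b (e ⟨j, r⟩)) = basis fun r => b' (e ⟨j, r⟩)) →
      (∀ q, q ∉ Set.range e → b' q = b q) → U (basis b) = basis b' := by
  obtain ⟨U, hU, hU'⟩ := ImplOn.sigma_prodQ e h
  exact ⟨U, hU, fun b b' h1 h2 => hU' _ _ h1 fun q hq => by rw [h2 q hq]⟩

theorem ImplOn.map_basis {R : Type} [Fintype R] [DecidableEq R] (e : R ↪ Q)
    {S : Set R} {d : ℕ} {T : State R → State R} (h : ImplOn S d T) :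
    ∃ U, ImplOn (Set.univ : Set Q) d U ∧ ∀ b b' : Q → Bool,
      (T (basis fun r => b (e r)) = basis fun r => b' (e r)) →
      (∀ q, q ∉ Set.range e → b' q = b q) → U (basis b) = basis b' := by
  obtain ⟨U, hU, hU'⟩ := ImplOn.sigma_basis (J := Unit) (R := fun _ => R)
    ((Equiv.uniqueSigma fun _ : Unit => R).toEmbedding.trans e) fun _ => h
  refine ⟨U, hU, fun b b' h1 h2 => hU' b b' (fun _ => h1) fun q hq => h2 q ?_⟩
  rintro ⟨r, rfl⟩
  exact hq ⟨⟨(), r⟩, rfl⟩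

end BasisMaps

/-! ### Exact parity: the gadget, padding, and trees. -/

section Parity

/-- There is a circuit of depth at most `d` with at most `s` ancillas which computes the parity of
bits indexed by `ι`, leaving the other qubits in a basis state. -/
def ParityImpl (ι : Type) [Fintype ι] [DecidableEq ι] (d s : ℕ) : Prop :=
  ∃ (A : Type) (_ : Fintype A) (_ : DecidableEq A) (T : State (ι ⊕ (Unit ⊕ A)) → State (ι ⊕ (Unit ⊕ A))),
    Fintype.card A ≤ s ∧ ImplOn Set.univ d T ∧ ∀ x : ι → Bool, ∃ g,
      T (basis (Sum.elim x (Sum.elim (fun _ => false) fun _ => false))) =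
        basis (Sum.elim x (Sum.elim (fun _ => decide (ones x % 2 = 1)) g))

variable {ι κ : Type} [Fintype ι] [DecidableEq ι] [Fintype κ] [DecidableEq κ]

theorem ParityImpl.gadget (hκ : 2 ≤ Fintype.card κ) :
    ParityImpl κ 258 ((8 * Fintype.card κ) ^ Fintype.card κ * Fintype.card κ
      + (Fintype.card κ + 2)) := by
  set q := Fintype.card κ with hq
  -- With this number of rows, the `q`-th root of `1 / (4 M)` is at most `1 / (8 q)`, so a single
  -- angle satisfies both requirements of the nekomata circuit. The depth is `258 = 4 · 60 + 18`.
  set M := (8 * q) ^ q with hM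
  have hM0 : 0 < M := pow_pos (by omega) _
  have hne : Nonempty κ := Fintype.card_pos_iff.1 (by omega)
  have hneM : Nonempty (Fin M) := ⟨⟨0, hM0⟩⟩
  set ε : ℝ := (1 / (4 * M : ℝ)) ^ ((1 : ℝ) / q) with hε
  have hM1 : (1 : ℝ) ≤ M := by exact_mod_cast hM0
  have hε0 : 0 ≤ ε := by positivity
  have hεq : ε ^ q = 1 / (4 * M) := by
    rw [hε, ← Real.rpow_natCast, ← Real.rpow_mul (by positivity), one_div_mul_cancel, Real.rpow_one]
    have : q ≠ 0 := by omega
    exact_mod_cast this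
  have hεle : ε ≤ 1 / (8 * q) := by
    refine le_of_pow_le_pow_left₀ (n := q) (by omega) (by positivity) ?_
    rw [hεq, div_pow, one_pow, hM]
    push_cast
    refine one_div_le_one_div_of_le (by positivity) ?_
    have : (0 : ℝ) ≤ (8 * q) ^ q := by positivity
    linarith
  have hε1 : ε ≤ 1 := hεle.trans (by
    rw [div_le_one (by positivity)]
    have : (2 : ℝ) ≤ q := by exact_mod_cast hκ
    linarith)
  obtain ⟨θ, hθ⟩ := exists_cos_sq hε0 hε1
  obtain ⟨B, hB, h1, h2⟩ := ImplOn.nekomata (μ := Fin M) hκ θ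
    (by rw [hθ, ← hq, hεq, Fintype.card_fin]) (by rw [hθ]; exact hεle)
  obtain ⟨T, hT, hT'⟩ := hB.parityOfNekomata (κ := κ)
    (Function.Embedding.inl.trans Function.Embedding.inr) h1 ((h2 true).trans (h2 false).symm)
  refine ⟨(Fin M × κ) ⊕ (κ ⊕ Bool), inferInstance, inferInstance, T, ?_, hT, fun x => ?_⟩
  · simp [hq]
  · refine ⟨fun _ => false, ?_⟩
    rw [← loc_basis, ← loc_basis]
    exact hT' x

/-- Missing inputs are fed by ancillas in state `0`, which do not change the parity. With equal
cardinalities this also serves to change the index type. -/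
theorem ParityImpl.of_card_le {d s : ℕ} (h : ParityImpl ι d s)
    (hc : Fintype.card κ ≤ Fintype.card ι) : ParityImpl κ d (s + Fintype.card ι) := by
  obtain ⟨A, _, _, T, hA, hT, hT'⟩ := h
  let ε : ι ≃ κ ⊕ Fin (Fintype.card ι - Fintype.card κ) := Fintype.equivOfCardEq (by simp; omega)
  let E : ι ⊕ (Unit ⊕ A) ↪ κ ⊕ (Unit ⊕ (A ⊕ Fin (Fintype.card ι - Fintype.card κ))) :=
    ⟨Sum.elim (fun i => (ε i).elim Sum.inl fun k => Sum.inr (Sum.inr (Sum.inr k)))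
      (Sum.elim (fun u => Sum.inr (Sum.inl u)) fun a => Sum.inr (Sum.inr (Sum.inl a))), by
      have hel : ∀ i, (∃ k, ε i = Sum.inl k) ∨ ∃ k, ε i = Sum.inr k := fun i => by
        cases ε i <;> simp
      rintro (i | u | a) (i' | u' | a') h
      · rcases hel i with ⟨k, hk⟩ | ⟨k, hk⟩ <;> rcases hel i' with ⟨k', hk'⟩ | ⟨k', hk'⟩ <;>
          simp [hk, hk'] at h <;> exact congrArg _ (ε.injective (by rw [hk, hk', h]))
      · rcases hel i with ⟨k, hk⟩ | ⟨k, hk⟩ <;> simp [hk] at h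
      · rcases hel i with ⟨k, hk⟩ | ⟨k, hk⟩ <;> simp [hk] at h
      · rcases hel i' with ⟨k, hk⟩ | ⟨k, hk⟩ <;> simp [hk] at h
      · rfl
      · simp at h
      · rcases hel i' with ⟨k, hk⟩ | ⟨k, hk⟩ <;> simp [hk] at h
      · simp at h
      · simpa using h⟩
  obtain ⟨U, hU, hU'⟩ := hT.map_basis E
  refine ⟨A ⊕ Fin (Fintype.card ι - Fintype.card κ), inferInstance, inferInstance, U, ?_, hU,
    fun x => ?_⟩
  · simp only [Fintype.card_sum, Fintype.card_fin]
    omega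
  · obtain ⟨g, hg⟩ := hT' fun i => Sum.elim x (fun _ => false) (ε i)
    have hones : ones (fun i => Sum.elim x (fun _ => false) (ε i)) = ones x := by
      rw [ones, ε.sum_comp fun k => (Sum.elim x (fun _ => false) k).toNat, Fintype.sum_sum_type]
      simp [ones]
    rw [hones] at hg
    have hE1 : ∀ (f : Unit ⊕ (A ⊕ Fin (Fintype.card ι - Fintype.card κ)) → Bool) i,
        (∀ k, f (Sum.inr (Sum.inr k)) = false) →
        (Sum.elim x f : _ → Bool) (E (Sum.inl i)) = Sum.elim x (fun _ => false) (ε i) := by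
      intro f i hf
      change (Sum.elim x f : _ → Bool) ((ε i).elim Sum.inl fun k => Sum.inr (Sum.inr (Sum.inr k))) = _
      cases ε i
      · rfl
      · exact hf _
    refine ⟨Sum.elim g fun _ => false, hU' _ _ ?_ ?_⟩
    · refine (congrArg T (congrArg basis ?_)).trans (hg.trans (congrArg basis ?_))
      · funext q
        rcases q with i | u | a
        · exact hE1 _ i fun _ => rfl
        · rfl
        · rfl
      · funext q
        rcases q with i | u | a
        · exact (hE1 _ i fun _ => rfl).symm
        · rfl
        · rfl
    · rintro (k | u | a | k) hq
      · rfl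
      · exact (hq ⟨Sum.inr (Sum.inl u), rfl⟩).elim
      · exact (hq ⟨Sum.inr (Sum.inr a), rfl⟩).elim
      · rfl

theorem ones_prod_mod_two (x : ι × κ → Bool) :
    ones (fun i => decide (ones (fun k => x (i, k)) % 2 = 1)) % 2 = ones x % 2 := by
  have h : ones x = ∑ i, ones fun k => x (i, k) := by
    simp only [ones, Fintype.sum_prod_type]
  rw [h, ones, Finset.sum_nat_mod, Finset.sum_nat_mod (f := fun i => ones fun k => x (i, k))]
  congr 2
  funext i
  rcases Nat.mod_two_eq_zero_or_one (ones fun k => x (i, k)) with h | h <;> simp [h]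

/-- Parity of parities. The first stage's leftover ancillas are in a basis state on each input, so
nothing has to be uncomputed. -/
theorem ParityImpl.prod {d s d' s' : ℕ} (h : ParityImpl ι d s) (h' : ParityImpl κ d' s') :
    ParityImpl (ι × κ) (d' + d) (Fintype.card ι * (1 + s') + s) := by
  obtain ⟨A, _, _, T, hA, hT, hTx⟩ := h
  obtain ⟨A', _, _, T', hA', hT', hTx'⟩ := h'
  let e : (Σ _ : ι, κ ⊕ (Unit ⊕ A')) ↪ (ι × κ) ⊕ (Unit ⊕ ((ι × (Unit ⊕ A')) ⊕ A)) :=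
    ⟨fun p => p.2.elim (fun k => Sum.inl (p.1, k)) fun r => Sum.inr (Sum.inr (Sum.inl (p.1, r))), by
      rintro ⟨i, k | r⟩ ⟨i', k' | r'⟩ h <;> simp at h <;> obtain ⟨rfl, rfl⟩ := h <;> rfl⟩
  let e' : ι ⊕ (Unit ⊕ A) ↪ (ι × κ) ⊕ (Unit ⊕ ((ι × (Unit ⊕ A')) ⊕ A)) :=
    ⟨Sum.elim (fun i => Sum.inr (Sum.inr (Sum.inl (i, Sum.inl ()))))
      (Sum.elim (fun u => Sum.inr (Sum.inl u)) fun a => Sum.inr (Sum.inr (Sum.inr a))), by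
      rintro (i | u | a) (i' | u' | a') h <;> simp at h
      · exact congrArg _ h
      · rfl
      · exact congrArg _ (congrArg _ h)⟩
  obtain ⟨U', hU', hUx'⟩ := ImplOn.sigma_basis e (fun _ => hT')
  obtain ⟨U, hU, hUx⟩ := hT.map_basis e'
  refine ⟨(ι × (Unit ⊕ A')) ⊕ A, inferInstance, inferInstance, _, ?_, hU'.comp hU, fun x => ?_⟩
  · simp only [Fintype.card_sum, Fintype.card_prod, Fintype.card_unit]
    gcongr
  · choose g' hg' using fun i => hTx' fun k => x (i, k)
    obtain ⟨g, hg⟩ := hTx fun i => decide (ones (fun k => x (i, k)) % 2 = 1)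
    rw [ones_prod_mod_two] at hg
    refine ⟨Sum.elim (fun p => Sum.elim
      (fun _ => decide (ones (fun k => x (p.1, k)) % 2 = 1)) (g' p.1) p.2) g, ?_⟩
    rw [hUx' _ (Sum.elim x (Sum.elim (fun _ => false) (Sum.elim (fun p => Sum.elim
      (fun _ => decide (ones (fun k => x (p.1, k)) % 2 = 1)) (g' p.1) p.2) fun _ => false)))]
    · refine hUx _ _ ?_ ?_
      · refine (congrArg T (congrArg basis ?_)).trans (hg.trans (congrArg basis ?_))
        · funext q
          rcases q with i | u | a <;> rfl
        · funext q
          rcases q with i | u | a <;> rfl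
      · rintro (k | u | ⟨i, u | a⟩ | k) hq
        · rfl
        · exact (hq ⟨Sum.inr (Sum.inl u), rfl⟩).elim
        · rfl
        · rfl
        · exact (hq ⟨Sum.inr (Sum.inr k), rfl⟩).elim
    · intro i
      refine (congrArg T' (congrArg basis ?_)).trans ((hg' i).trans (congrArg basis ?_))
      · funext q
        rcases q with i | u | a <;> rfl
      · funext q
        rcases q with i | u | a <;> rfl
    · rintro (⟨i, k⟩ | u | ⟨i, r⟩ | k) hq
      · exact (hq ⟨⟨i, Sum.inl k⟩, rfl⟩).elim
      · rfl
      · exact (hq ⟨⟨i, Sum.inr r⟩, rfl⟩).elim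
      · rfl

/-- A `q`-ary tree of gadgets. The ancilla recurrence multiplies by `q` at each level, plus the cost
of reindexing; the factor `4 q` absorbs both. -/
theorem ParityImpl.tree {q d s : ℕ} (hq : 1 ≤ q) (h : ParityImpl (Fin q) d s) (l : ℕ) :
    ParityImpl (Fin (q ^ (l + 1))) (d * (l + 1)) ((s + q + 1) * (4 * q) ^ (l + 1)) := by
  induction l with
  | zero =>
    obtain ⟨A, _, _, T, hA, hT, hTx⟩ := h.of_card_le (κ := Fin (q ^ (0 + 1))) (by simp)
    refine ⟨A, _, _, T, hA.trans ?_, hT.mono le_rfl (by simp), hTx⟩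
    rw [Fintype.card_fin, zero_add, pow_one]
    have : (s + q + 1) * 1 ≤ (s + q + 1) * (4 * q) := Nat.mul_le_mul_left _ (by omega)
    omega
  | succ l ih =>
    have h1 := (h.prod ih).of_card_le (κ := Fin (q ^ (l + 1 + 1))) (by simp [pow_succ'])
    obtain ⟨A, _, _, T, hA, hT, hTx⟩ := h1
    refine ⟨A, _, _, T, hA.trans ?_, hT.mono le_rfl (le_of_eq (by ring)), hTx⟩
    simp only [Fintype.card_prod, Fintype.card_fin]
    set Y := (4 * q) ^ (l + 1) with hY
    have hY1 : 1 ≤ Y := Nat.one_le_pow _ _ (by omega)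
    have hqY : q ^ (l + 1) ≤ Y := Nat.pow_le_pow_left (by omega) _
    have e : (4 * q) ^ (l + 1 + 1) = 4 * q * Y := by rw [hY]; ring
    rw [e]
    have a1 : q * q ^ (l + 1) ≤ q * Y := Nat.mul_le_mul_left _ hqY
    have a2 : q * 1 ≤ q * Y := Nat.mul_le_mul_left _ hY1
    have a3 : s * 1 ≤ s * (q * Y) := Nat.mul_le_mul_left _ (by nlinarith)
    have a4 : 1 * (q * Y) ≤ (s + q + 1) * (q * Y) := Nat.mul_le_mul_right _ (by omega)
    nlinarith

end Parity

/-! ### Boolean functions computed with basis-state garbage. -/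

section Computes

variable {I O O' : Type} [Fintype I] [DecidableEq I] [Fintype O] [DecidableEq O]
  [Fintype O'] [DecidableEq O']

/-- There is a circuit of depth at most `d` with at most `s` ancillas which computes `f`, leaving
the ancillas in a basis state. -/
def Computes (f : (I → Bool) → O → Bool) (d s : ℕ) : Prop :=
  ∃ (A : Type) (_ : Fintype A) (_ : DecidableEq A) (T : State (I ⊕ (O ⊕ A)) → State (I ⊕ (O ⊕ A))),
    Fintype.card A ≤ s ∧ ImplOn Set.univ d T ∧ ∀ x, ∃ g,
      T (basis (Sum.elim x (Sum.elim (fun _ => false) fun _ => false))) =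
        basis (Sum.elim x (Sum.elim (f x) g))

theorem Computes.union {f : (I → Bool) → O → Bool} {f' : (I → Bool) → O' → Bool} {d s d' s' : ℕ}
    (h : Computes f d s) (h' : Computes f' d' s') :
    Computes (fun x => Sum.elim (f x) (f' x)) (d + d') (s + s') := by
  obtain ⟨A, _, _, T, hA, hT, hTx⟩ := h
  obtain ⟨A', _, _, T', hA', hT', hTx'⟩ := h'
  let e : I ⊕ (O ⊕ A) ↪ I ⊕ ((O ⊕ O') ⊕ (A ⊕ A')) :=
    ⟨Sum.map id (Sum.map Sum.inl Sum.inl), Sum.map_injective.2 ⟨Function.injective_id,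
      Sum.map_injective.2 ⟨Sum.inl_injective, Sum.inl_injective⟩⟩⟩
  let e' : I ⊕ (O' ⊕ A') ↪ I ⊕ ((O ⊕ O') ⊕ (A ⊕ A')) :=
    ⟨Sum.map id (Sum.map Sum.inr Sum.inr), Sum.map_injective.2 ⟨Function.injective_id,
      Sum.map_injective.2 ⟨Sum.inr_injective, Sum.inr_injective⟩⟩⟩
  obtain ⟨U, hU, hUx⟩ := hT.map_basis e
  obtain ⟨U', hU', hUx'⟩ := hT'.map_basis e'
  refine ⟨A ⊕ A', inferInstance, inferInstance, _, ?_, hU.comp hU', fun x => ?_⟩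
  · rw [Fintype.card_sum]
    exact add_le_add hA hA'
  · obtain ⟨g, hg⟩ := hTx x
    obtain ⟨g', hg'⟩ := hTx' x
    refine ⟨Sum.elim g g', ?_⟩
    rw [hUx _ (Sum.elim x (Sum.elim (Sum.elim (f x) fun _ => false) (Sum.elim g fun _ => false)))]
    · refine hUx' _ _ ?_ ?_
      · refine (congrArg T' (congrArg basis ?_)).trans (hg'.trans (congrArg basis ?_)) <;>
        · funext q
          rcases q with i | o | a <;> rfl
      · rintro (i | (o | o) | (a | a)) hq
        · rfl
        · rfl
        · exact (hq ⟨Sum.inr (Sum.inl o), rfl⟩).elim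
        · rfl
        · exact (hq ⟨Sum.inr (Sum.inr a), rfl⟩).elim
    · refine (congrArg T (congrArg basis ?_)).trans (hg.trans (congrArg basis ?_)) <;>
      · funext q
        rcases q with i | o | a <;> rfl
    · rintro (i | (o | o) | (a | a)) hq
      · rfl
      · exact (hq ⟨Sum.inr (Sum.inl o), rfl⟩).elim
      · rfl
      · exact (hq ⟨Sum.inr (Sum.inr a), rfl⟩).elim
      · rfl

/-- The injectivity of `ε` gives each parity its own input bits, so all of them are computed in
parallel. -/
theorem Computes.parities {J : Type} [Fintype J] [DecidableEq J] {R : J → Type}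
    [∀ j, Fintype (R j)] [∀ j, DecidableEq (R j)] (ε : (Σ j, R j) ↪ I) {d s : ℕ}
    (h : ∀ j, ParityImpl (R j) d s) :
    Computes (fun (x : I → Bool) j => decide (ones (fun r => x (ε ⟨j, r⟩)) % 2 = 1)) d
      (Fintype.card J * s) := by
  choose A hF hD T hA hT hTx using h
  let e : (Σ j, R j ⊕ (Unit ⊕ A j)) ↪ I ⊕ (J ⊕ (Σ j, A j)) :=
    ⟨fun p => p.2.elim (fun r => Sum.inl (ε ⟨p.1, r⟩))
      (Sum.elim (fun _ => Sum.inr (Sum.inl p.1)) fun a => Sum.inr (Sum.inr ⟨p.1, a⟩)), by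
      rintro ⟨j, r | u | a⟩ ⟨j', r' | u' | a'⟩ h <;> simp at h
      · obtain ⟨rfl, h⟩ := h
        rw [eq_of_heq h]
      · rw [h]
      · obtain ⟨rfl, h⟩ := h
        rw [eq_of_heq h]⟩
  obtain ⟨U, hU, hUx⟩ := ImplOn.sigma_basis e hT
  refine ⟨Σ j, A j, inferInstance, inferInstance, U, ?_, hU, fun x => ?_⟩
  · rw [Fintype.card_sigma]
    exact Finset.sum_le_card_nsmul _ _ _ fun j _ => hA j
  · choose g hg using fun j => hTx j fun r => x (ε ⟨j, r⟩)
    refine ⟨fun p => g p.1 p.2, hUx _ _ (fun j => ?_) ?_⟩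
    · refine (congrArg (T j) (congrArg basis ?_)).trans ((hg j).trans (congrArg basis ?_)) <;>
      · funext q
        rcases q with i | o | a <;> rfl
    · rintro (i | j | a) hq
      · rfl
      · exact (hq ⟨⟨j, Sum.inr (Sum.inl ())⟩, rfl⟩).elim
      · exact (hq ⟨⟨a.1, Sum.inr (Sum.inr a.2)⟩, rfl⟩).elim

theorem xor_decide {p q : Prop} [Decidable p] [Decidable q] (h : ¬(p ∧ q)) :
    (decide p).xor (decide q) = decide (p ∨ q) := by
  by_cases hp : p <;> by_cases hq : q <;> simp_all

/-- The rows agree exactly when every column is constant. Each column flag is flipped once if the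
column is all ones and once if it is all zeros; these exclude each other, so XOR acts as OR. A last
flip takes the conjunction. Each of the three stages has depth 3. -/
theorem Computes.allEqual (M N : Type) [Fintype M] [DecidableEq M] [Fintype N] [DecidableEq N]
    [Nonempty M] [Nonempty N] :
    Computes (fun (x : M × N → Bool) (_ : Unit) =>
      decide (∀ j, (∀ i, x (i, j) = true) ∨ ∀ i, x (i, j) = false)) 9 (Fintype.card N) := by
  let col : N → Finset ((M × N) ⊕ (Unit ⊕ N)) := fun j => Finset.univ.image fun i => Sum.inl (i, j)
  let tgt : N → (M × N) ⊕ (Unit ⊕ N) := fun j => Sum.inr (Sum.inr j)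
  have hne : ∀ j, (col j).Nonempty := fun j => by simp [col]
  have htc : ∀ j j', tgt j ∉ col j' := fun j j' => by simp [col, tgt]
  have hdis : ∀ j j', j ≠ j' → Disjoint (insert (tgt j) (col j)) (insert (tgt j') (col j')) := by
    intro j j' hj
    rw [Finset.disjoint_left]
    intro q hq hq'
    simp only [col, tgt, Finset.mem_insert, Finset.mem_image, Finset.mem_univ, true_and] at hq hq'
    rcases hq with rfl | ⟨i, rfl⟩ <;> simp at hq' <;> exact hj (by simp [hq'])
  have h1 := fun b : Bool => ImplOn.flips col (fun _ _ => b) tgt hne (fun j => htc j j) hdis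
  have hi1 := fun b : Bool => flipMap_involutive col (fun _ _ => b) tgt htc
  have h2 := ImplOn.flips (Q := (M × N) ⊕ (Unit ⊕ N)) (J := Unit)
    (fun _ => Finset.univ.image fun j => Sum.inr (Sum.inr j)) (fun _ _ => true)
    (fun _ => Sum.inr (Sum.inl ())) (fun _ => by simp) (fun _ => by simp)
    (fun j j' h => (h rfl).elim)
  have hi2 := flipMap_involutive (Q := (M × N) ⊕ (Unit ⊕ N)) (J := Unit)
    (fun _ => Finset.univ.image fun j => Sum.inr (Sum.inr j)) (fun _ _ => true)
    (fun _ => Sum.inr (Sum.inl ())) (fun _ _ => by simp)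
  refine ⟨N, inferInstance, inferInstance, _, le_rfl, ((h1 true).comp (h1 false)).comp h2,
    fun x => ⟨fun j => decide ((∀ i, x (i, j) = true) ∨ ∀ i, x (i, j) = false), ?_⟩⟩
  rw [basis_comp_involutive (hi1 true), basis_comp_involutive (hi1 false),
    basis_comp_involutive hi2]
  congr 1
  have hx : ∀ j, ¬ ((∀ i, x (i, j) = true) ∧ ∀ i, x (i, j) = false) := by
    rintro j ⟨ha, hb⟩
    have := ha (Classical.arbitrary M)
    rw [hb] at this
    cases this
  have hc : ∀ j, (decide (∀ i, x (i, j) = true)).xor (decide (∀ i, x (i, j) = false)) =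
      decide ((∀ i, x (i, j) = true) ∨ ∀ i, x (i, j) = false) := by
    exact fun j => xor_decide (hx j)
  have hcol : flipMap col (fun _ _ => false) tgt (flipMap col (fun _ _ => true) tgt
      (Sum.elim x (Sum.elim (fun _ => false) fun _ => false))) = Sum.elim x (Sum.elim (fun _ => false)
        fun j => decide ((∀ i, x (i, j) = true) ∨ ∀ i, x (i, j) = false)) := by
    funext q
    rcases q with p | u | j
    · simp [flipMap, tgt]
    · simp [flipMap, tgt]
    · refine Eq.trans ?_ (hc j)
      simp [flipMap, tgt, col]
  rw [hcol]
  funext q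
  rcases q with p | u | j
  · simp [flipMap]
  · simp [flipMap]
  · simp [flipMap]

end Computes

/-! ### Circuits with a probabilistic one-bit verdict. -/

section Tests

variable {I O : Type} [Fintype I] [DecidableEq I] [Fintype O] [DecidableEq O]

theorem liftOp_basis {Q R : Type} [Fintype Q] [DecidableEq Q] [Fintype R] [DecidableEq R]
    (e : R ↪ Q) [DecidablePred (· ∈ Set.range e)] {S : Set R} {d : ℕ} {T : State R → State R}
    (h : ImplOn S d T) (b z : Q → Bool) : liftOp e T (basis b) z =
      if ∀ q, q ∉ Set.range e → z q = b q then T (basis fun r => b (e r)) fun r => z (e r) else 0 := by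
  have hb : ∀ y, basis b (Function.extend e y z) =
      if (∀ q, q ∉ Set.range e → z q = b q) then basis (fun r => b (e r)) y else 0 := by
    intro y
    simp only [basis_apply, ← ite_and]
    refine if_congr ⟨fun h => ⟨fun q hq => ?_, ?_⟩, fun h => ?_⟩ rfl rfl
    · rw [← h, extend_off e _ _ hq]
    · funext r
      rw [← h, e.injective.extend_apply]
    · funext q
      by_cases hq : q ∈ Set.range e
      · obtain ⟨r, rfl⟩ := hq
        rw [e.injective.extend_apply, h.2]
      · rw [extend_off e _ _ hq, h.1 q hq]
  simp only [liftOp, hb]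
  split_ifs
  · rfl
  · exact congrFun h.zero _

/-- Expectations of functions of the qubits in the range of `e` after acting on them. -/
theorem sum_liftOp_basis {Q R : Type} [Fintype Q] [DecidableEq Q] [Fintype R] [DecidableEq R]
    (e : R ↪ Q) {S : Set R} {d : ℕ} {T : State R → State R}
    (h : ImplOn S d T) (b : Q → Bool) (f : (R → Bool) → Prop) [DecidablePred f] :
    ∑ z, (if f fun r => z (e r) then ‖liftOp e T (basis b) z‖ ^ 2 else 0) =
      ∑ y, if f y then ‖T (basis fun r => b (e r)) y‖ ^ 2 else 0 := by
  classical
  symm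
  refine Fintype.sum_of_injective (fun y => Function.extend e y b) ?_ _ _ ?_ ?_
  · intro y y' hy
    rw [← extend_comp e b y, ← extend_comp e b y']
    exact congrArg (fun z r => z (e r)) hy
  · intro z hz
    rw [liftOp_basis e h, if_neg (c := ∀ q, q ∉ Set.range e → z q = b q)]
    · simp
    · intro hzb
      refine hz ⟨fun r => z (e r), funext fun q => ?_⟩
      by_cases hq : q ∈ Set.range e
      · obtain ⟨r, rfl⟩ := hq
        exact e.injective.extend_apply _ _ _
      · simp only [extend_off e _ _ hq, hzb q hq]
  · intro y
    rw [liftOp_basis e h, if_pos fun q hq => extend_off e _ _ hq, extend_comp]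

/-- There is a circuit of depth at most `d` with at most `s` ancillas whose output qubit is `1` with
probability `p x` on input `x`. -/
def TestImpl (p : (I → Bool) → ℝ) (d s : ℕ) : Prop :=
  ∃ (A : Type) (_ : Fintype A) (_ : DecidableEq A) (T : State (I ⊕ (A ⊕ Unit)) → State (I ⊕ (A ⊕ Unit))),
    Fintype.card A ≤ s ∧ ImplOn Set.univ d T ∧ ∀ x,
      ∑ z, (if z (Sum.inr (Sum.inr ())) = true then
        ‖T (basis (Sum.elim x fun _ => false)) z‖ ^ 2 else 0) = p x

/-- The first circuit leaves a basis state, so the second starts from a definite input `f x` and the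
garbage cannot affect its output distribution. -/
theorem TestImpl.comp_computes {f : (I → Bool) → O → Bool} {p : (O → Bool) → ℝ} {d s d' s' : ℕ}
    (h' : TestImpl p d' s') (h : Computes f d s) :
    TestImpl (fun x => p (f x)) (d + d') (Fintype.card O + s + s') := by
  obtain ⟨A, _, _, T, hA, hT, hTx⟩ := h
  obtain ⟨A', _, _, T', hA', hT', hTx'⟩ := h'
  let e : I ⊕ (O ⊕ A) ↪ I ⊕ (((O ⊕ A) ⊕ A') ⊕ Unit) :=
    ⟨Sum.map id fun r => Sum.inl (Sum.inl r), Sum.map_injective.2 ⟨Function.injective_id,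
      Sum.inl_injective.comp Sum.inl_injective⟩⟩
  let e' : O ⊕ (A' ⊕ Unit) ↪ I ⊕ (((O ⊕ A) ⊕ A') ⊕ Unit) :=
    ⟨Sum.elim (fun o => Sum.inr (Sum.inl (Sum.inl (Sum.inl o))))
      (Sum.elim (fun a => Sum.inr (Sum.inl (Sum.inr a))) fun u => Sum.inr (Sum.inr u)), by
      rintro (i | u | a) (i' | u' | a') h <;> simp at h
      · rw [h]
      · rw [h]
      · rfl⟩
  obtain ⟨U, hU, hUx⟩ := hT.map_basis e
  have hU' := (hT'.map e').mono (Set.subset_univ _) le_rfl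
  refine ⟨(O ⊕ A) ⊕ A', inferInstance, inferInstance, _, ?_, hU.comp hU', fun x => ?_⟩
  · simp only [Fintype.card_sum]
    omega
  · obtain ⟨g, hg⟩ := hTx x
    rw [hUx _ (Sum.elim x (Sum.elim (Sum.elim (Sum.elim (f x) g) fun _ => false) fun _ => false))]
    · have := sum_liftOp_basis e' hT' (Sum.elim x
        (Sum.elim (Sum.elim (Sum.elim (f x) g) fun _ => false) fun _ => false))
        fun y => y (Sum.inr (Sum.inr ())) = true
      refine this.trans ?_
      have hb : (fun r => (Sum.elim x (Sum.elim (Sum.elim (Sum.elim (f x) g) fun _ => false)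
          fun _ => false) : _ → Bool) (e' r)) = Sum.elim (f x) fun _ => false := by
        funext q
        rcases q with i | o | a <;> rfl
      rw [hb]
      exact hTx' (f x)
    · refine (congrArg T (congrArg basis ?_)).trans (hg.trans (congrArg basis ?_)) <;>
      · funext q
        rcases q with i | o | a <;> rfl
    · rintro (i | ((o | a) | a) | u) hq
      · rfl
      · exact (hq ⟨Sum.inr (Sum.inl o), rfl⟩).elim
      · exact (hq ⟨Sum.inr (Sum.inr a), rfl⟩).elim
      · rfl
      · rfl

theorem initState_eq (a : ℕ) (x : I → Bool) : initState a x = basis (Sum.elim x fun _ => false) := by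
  funext z
  rw [basis_apply, initState, Pi.single_apply]

theorem TestImpl.exists_circuit {p : (I → Bool) → ℝ} {d s : ℕ} (h : TestImpl p d s) :
    ∃ a ≤ s, ∃ C : Circuit (Qubits I a), C.depth ≤ d ∧ ∀ x, outputProb C x true = p x := by
  obtain ⟨A, _, _, T, hA, hT, hTx⟩ := h
  let ε : I ⊕ (A ⊕ Unit) ≃ Qubits I (Fintype.card A) :=
    Equiv.sumCongr (Equiv.refl _) (Equiv.sumCongr (Fintype.equivFin A) (Equiv.refl _))
  obtain ⟨C, hC, -, hC'⟩ := hT.map ε.toEmbedding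
  refine ⟨Fintype.card A, hA, C, hC, fun x => ?_⟩
  rw [outputProb, hC', initState_eq, ← hTx]
  have := sum_liftOp_basis ε.toEmbedding hT (Sum.elim x fun _ => false)
    fun y => y (Sum.inr (Sum.inr ())) = true
  refine this.trans ?_
  have hb : (fun r => (Sum.elim x (fun _ => false) : Qubits I (Fintype.card A) → Bool)
      (ε.toEmbedding r)) = Sum.elim x fun _ => false := by
    funext q
    rcases q with i | o | a <;> rfl
  rw [hb]

theorem outputProb_add {a : ℕ} (C : Circuit (Qubits I a)) (x : I → Bool) :
    outputProb C x true + outputProb C x false = 1 := by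
  have hC : ImplOn Set.univ C.depth C.run := ⟨C, le_rfl, by simp, rfl⟩
  have h := hC.ip_eq (initState a x) (initState a x)
  rw [ip_self, initState_eq, ip_basis, basis_apply, if_pos rfl, ← initState_eq] at h
  rw [outputProb, outputProb, ← Finset.sum_add_distrib]
  have h' : ∑ z, ‖C.run (initState a x) z‖ ^ 2 = 1 := by exact_mod_cast h
  rw [← h']
  refine Finset.sum_congr rfl fun z _ => ?_
  cases z (Sum.inr (Sum.inr ())) <;> simp

/-- Measuring functions of disjoint registers of a product state. -/
theorem sum_norm_sigma {Q J : Type} [Fintype Q] [DecidableEq Q] [Fintype J] [DecidableEq J]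
    {R : J → Type} [∀ j, Fintype (R j)] [∀ j, DecidableEq (R j)] (e : (Σ j, R j) ↪ Q)
    [DecidablePred (· ∈ Set.range e)] (f : ∀ j, (R j → Bool) → ℝ) (g : Q → Bool → ℝ)
    (hg : ∀ q, ∑ b, g q b = 1) :
    ∑ z : Q → Bool, (∏ j, f j fun r => z (e ⟨j, r⟩)) * ∏ q with q ∉ Set.range e, g q (z q) =
      ∏ j, ∑ y, f j y := by
  let ε : (Σ j, R j) ⊕ {q // q ∉ Set.range e} ≃ Q :=
    (Equiv.sumCongr (Equiv.ofInjective e e.injective) (Equiv.refl _)).trans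
      (Equiv.sumCompl fun q => q ∈ Set.range e)
  have hε1 : ∀ p, ε (Sum.inl p) = e p := fun _ => rfl
  have hε2 : ∀ p, ε (Sum.inr p) = p.1 := fun _ => rfl
  have hoff : ∀ z : Q → Bool, ∏ q with q ∉ Set.range e, g q (z q)
      = ∏ q : {q // q ∉ Set.range e}, g q.1 (z q.1) := fun z =>
    Finset.prod_subtype _ (fun q => by simp) _
  simp only [hoff]
  rw [← (ε.arrowCongr (Equiv.refl Bool)).sum_comp, sum_sumArrow]
  simp only [Equiv.arrowCongr_apply, Equiv.coe_refl, Function.comp_apply, id_eq, ← hε1, ← hε2,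
    Equiv.symm_apply_apply, Sum.elim_inl, Sum.elim_inr, ← Finset.mul_sum]
  have h1 : ∑ y : {q // q ∉ Set.range e} → Bool, ∏ q, g (ε (Sum.inr q)) (y q) = 1 := by
    rw [← Fintype.piFinset_univ, ← Finset.prod_univ_sum (fun _ => Finset.univ)
      fun (q : {q // q ∉ Set.range e}) b => g (ε (Sum.inr q)) b]
    exact Finset.prod_eq_one fun q _ => hg _
  rw [← Finset.sum_mul, h1, mul_one, Finset.prod_univ_sum, Fintype.piFinset_univ]
  exact Fintype.sum_equiv (Equiv.piCurry fun _ _ => Bool) _ _ fun _ => rfl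

end Tests

/-! ### Evaluating conditional flips at targets and elsewhere. -/

section FlipMap

variable {Q J : Type} [Fintype Q] [DecidableEq Q] [Fintype J]

theorem flipMap_target (T : J → Finset Q) (b : J → Q → Bool) {t : J → Q} (ht : Function.Injective t)
    (z : Q → Bool) (j : J) :
    flipMap T b t z (t j) = xor (z (t j)) (decide (∀ s ∈ T j, z s = b j s)) := by
  have : (∃ j', t j' = t j ∧ ∀ s ∈ T j', z s = b j' s) ↔ ∀ s ∈ T j, z s = b j s :=
    ⟨fun ⟨j', h, h'⟩ => ht h ▸ h', fun h => ⟨j, rfl, h⟩⟩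
  simp only [flipMap, this]

theorem flipMap_of_ne (T : J → Finset Q) (b : J → Q → Bool) (t : J → Q) (z : Q → Bool) {q : Q}
    (hq : ∀ j, t j ≠ q) : flipMap T b t z q = z q := by
  have : ¬ ∃ j, t j = q ∧ ∀ s ∈ T j, z s = b j s := fun ⟨j, h, _⟩ => hq j h
  simp [flipMap, this]

end FlipMap

/-! ### Testing all candidate weights in parallel on separate copies. -/

section WeightTests

/-- The qubits of the weight tests: the verdict on the equality of the copies and the group parities,
the test registers, their flags, the flags of the candidate weights, and the output. -/
abbrev TestQubits (K L G : Type) : Type :=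
  (Unit ⊕ ((K × L) × G)) ⊕ (((((K × L) × G) × Option G) ⊕ (((K × L) × G) ⊕ K)) ⊕ Unit)

variable {K L G : Type} [Fintype K] [DecidableEq K] [Fintype L] [DecidableEq L]
  [Fintype G] [DecidableEq G]

namespace TestQubits

instance : DecidableEq ((((K × L) × G) × Option G) ⊕ (((K × L) × G) ⊕ K)) := inferInstance

/-- The verdict on the equality of the copies. -/
abbrev eq : TestQubits K L G := Sum.inl (Sum.inl ())
/-- A group parity. -/
abbrev par (p : (K × L) × G) : TestQubits K L G := Sum.inl (Sum.inr p)
/-- A qubit of a test register. -/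
abbrev reg (t : (K × L) × G) (o : Option G) : TestQubits K L G := Sum.inr (Sum.inl (Sum.inl (t, o)))
/-- The flag of a test register. -/
abbrev flag (t : (K × L) × G) : TestQubits K L G := Sum.inr (Sum.inl (Sum.inr (Sum.inl t)))
/-- The flag of a candidate. -/
abbrev cand (k : K) : TestQubits K L G := Sum.inr (Sum.inl (Sum.inr (Sum.inr k)))
/-- The output. -/
abbrev out : TestQubits K L G := Sum.inr (Sum.inr ())

/-- The registers of the weak fan-outs. -/
def fanEmb (K L G : Type) : (Σ _ : (K × L) × G, Option G) ↪ TestQubits K L G :=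
  ⟨fun p => p.2.elim (par p.1) fun κ => reg (p.1.1, κ) (some p.1.2), by
    rintro ⟨⟨j, g⟩, _ | κ⟩ ⟨⟨j', g'⟩, _ | κ'⟩ h <;> simp at h
    · obtain ⟨rfl, rfl⟩ := h
      rfl
    · obtain ⟨⟨rfl, rfl⟩, rfl⟩ := h
      rfl⟩

/-- The test registers. -/
def regEmb (K L G : Type) : (Σ _ : (K × L) × G, Option G) ↪ TestQubits K L G :=
  ⟨fun p => reg p.1 p.2, by
    rintro ⟨t, o⟩ ⟨t', o'⟩ h
    simp at h
    obtain ⟨rfl, rfl⟩ := h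
    rfl⟩

/-- The product state after the weak fan-outs. -/
noncomputable def fanned (τ : ℝ) (x : Unit ⊕ ((K × L) × G) → Bool) : TestQubits K L G → Bool → ℂ :=
  Sum.elim (fun i => ket (x i)) (Sum.elim (Sum.elim (fun p => p.2.elim (ket false) fun g =>
    vec (if x (Sum.inr (p.1.1, g)) then τ else 0)) fun _ => ket false) fun _ => ket false)

/-- The parity of group `g` in row `j` is fanned out to qubit `some g` of every register `(j, κ)`.
Each of these registers thereby holds a weak copy of all the parities of the row, while its qubit
`none` stays `0` as the ancilla of the weight test. -/
theorem exists_fanned [Nonempty G] (τ : ℝ) (hτ : Real.cos τ ^ Fintype.card G = 1 / 2) :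
    ∃ U, ImplOn (Set.univ : Set (TestQubits K L G)) 19 U ∧ ∀ x,
      U (basis (Sum.elim x fun _ => false)) = prodQ (fanned τ x) := by
  obtain ⟨T, hT, hT'⟩ := ImplOn.weakFanout (ν := G) τ hτ
  obtain ⟨U, hU, hU'⟩ := ImplOn.sigma_prodQ (fanEmb K L G) fun _ => hT
  refine ⟨U, hU, fun x => hU' _ _ ?_ ?_⟩
  · rintro ⟨j, g⟩
    refine (congrArg T (congrArg prodQ ?_)).trans ((hT' (x (Sum.inr (j, g)))).trans
      (congrArg prodQ ?_)) <;>
    · funext o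
      cases o <;> rfl
  · rintro ((u | p) | ((⟨t, _ | g⟩ | r) | u)) hq
    · rfl
    · rfl
    · rfl
    · exact (hq ⟨⟨(t.1, g), some t.2⟩, rfl⟩).elim
    · rfl
    · rfl

/-- The event that some candidate weight is never excluded, in terms of the test registers. -/
def Accept (w : TestQubits K L G → Bool) : Prop :=
  ∃ k : K, ∀ (ρ : L) (g : G), ¬ ∀ o, w (reg ((k, ρ), g) o) = false

instance : DecidablePred (Accept : (TestQubits K L G → Bool) → Prop) := fun w =>
  inferInstanceAs (Decidable (∃ k : K, ∀ (ρ : L) (g : G), ¬ ∀ o, w (reg ((k, ρ), g) o) = false))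

/-- A flag records an excluding all-zero outcome, and a candidate is marked when none of its flags
is set. The output is first set to `e`, then flipped back if `e` holds and no candidate is marked.
-/
theorem exists_collect [Nonempty L] [Nonempty G] :
    ∃ U, ImplOn (Set.univ : Set (TestQubits K L G)) 12 U ∧ ∀ (ψ : State (TestQubits K L G)) (e : Bool),
      (∀ w, ψ w ≠ 0 → w eq = e ∧ (∀ t, w (flag t) = false) ∧ (∀ k, w (cand k) = false) ∧
        w out = false) →
      ∑ z, (if z out = true then ‖U ψ z‖ ^ 2 else 0) =
        ∑ w, if e = true ∧ Accept w then ‖ψ w‖ ^ 2 else 0 := by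
  let T₁ : (K × L) × G → Finset (TestQubits K L G) := fun t => Finset.univ.image (reg t)
  let T₂ : K → Finset (TestQubits K L G) := fun k =>
    Finset.univ.image fun p : L × G => flag ((k, p.1), p.2)
  let T₃ : Unit → Finset (TestQubits K L G) := fun _ => {eq}
  let T₄ : Unit → Finset (TestQubits K L G) := fun _ => insert eq (Finset.univ.image cand)
  let b₄ : Unit → TestQubits K L G → Bool := fun _ => Sum.elim (fun _ => true) fun _ => false
  have hd₁ : ∀ j j', j ≠ j' → Disjoint (insert (flag j) (T₁ j)) (insert (flag j') (T₁ j')) := by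
    intro j j' hj
    rw [Finset.disjoint_left]
    intro q hq hq'
    simp only [T₁, Finset.mem_insert, Finset.mem_image, Finset.mem_univ, true_and] at hq hq'
    rcases hq with rfl | ⟨o, rfl⟩ <;> simp at hq' <;> exact hj (by simp [hq'])
  have hd₂ : ∀ j j', j ≠ j' → Disjoint (insert (cand j) (T₂ j)) (insert (cand j') (T₂ j')) := by
    intro j j' hj
    rw [Finset.disjoint_left]
    intro q hq hq'
    simp only [T₂, Finset.mem_insert, Finset.mem_image, Finset.mem_univ, true_and] at hq hq'
    rcases hq with rfl | ⟨o, rfl⟩ <;> simp at hq' <;> exact hj (by simp [hq'])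
  have h₁ := ImplOn.flips T₁ (fun _ _ => false) flag (fun t => by simp [T₁]) (fun t => by simp [T₁])
    hd₁
  have h₂ := ImplOn.flips T₂ (fun _ _ => false) cand (fun t => by simp [T₂]) (fun t => by simp [T₂])
    hd₂
  have h₃ := ImplOn.flips T₃ (fun _ _ => true) (fun _ => out) (fun t => by simp [T₃])
    (fun t => by simp [T₃]) (fun j j' h => (h rfl).elim)
  have h₄ := ImplOn.flips T₄ b₄ (fun _ => out) (fun t => by simp [T₄])
    (fun t => by simp [T₄]) (fun j j' h => (h rfl).elim)
  have i₁ := flipMap_involutive T₁ (fun _ _ => false) flag fun _ _ => by simp [T₁]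
  have i₂ := flipMap_involutive T₂ (fun _ _ => false) cand fun _ _ => by simp [T₂]
  have i₃ := flipMap_involutive T₃ (fun _ _ => true) (fun _ => out) fun _ _ => by simp [T₃]
  have i₄ := flipMap_involutive T₄ b₄ (fun _ => out) fun _ _ => by simp [T₄]
  have f₁ : Function.Injective (flag : _ → TestQubits K L G) := fun _ _ h => by simpa using h
  have f₂ : Function.Injective (cand : _ → TestQubits K L G) := fun _ _ h => by simpa using h
  have f₃ : Function.Injective (fun _ => out : Unit → TestQubits K L G) := fun _ _ _ => rfl
  refine ⟨_, ((h₁.comp h₂).comp h₃).comp h₄, fun ψ e hψ => ?_⟩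
  -- All four stages permute the basis, so the final measurement becomes an event in the state
  -- before them.
  refine Fintype.sum_equiv ((i₄.toPerm _).trans ((i₃.toPerm _).trans ((i₂.toPerm _).trans
    (i₁.toPerm _)))) _ _ fun z => ?_
  suffices H : ∀ w, flipMap T₁ (fun _ _ => false) flag (flipMap T₂ (fun _ _ => false) cand
      (flipMap T₃ (fun _ _ => true) (fun _ => out) (flipMap T₄ b₄ (fun _ => out) z))) = w →
      (if z out = true then ‖ψ w‖ ^ 2 else 0) = if e = true ∧ Accept w then ‖ψ w‖ ^ 2 else 0 from
    H _ rfl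
  intro w hw
  have hz : z = flipMap T₄ b₄ (fun _ => out) (flipMap T₃ (fun _ _ => true) (fun _ => out)
      (flipMap T₂ (fun _ _ => false) cand (flipMap T₁ (fun _ _ => false) flag w))) := by
    rw [← hw, i₁, i₂, i₃, i₄]
  by_cases h0 : ψ w = 0
  · simp [h0]
  obtain ⟨w1, w2, w3, w4⟩ := hψ w h0
  refine if_congr ?_ rfl rfl
  set z₁ := flipMap T₁ (fun _ _ => false) flag w with hz₁
  set z₂ := flipMap T₂ (fun _ _ => false) cand z₁ with hz₂
  set z₃ := flipMap T₃ (fun _ _ => true) (fun _ => out) z₂ with hz₃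
  have e1 : ∀ t, z₁ (flag t) = decide (∀ o, w (reg t o) = false) := fun t => by
    rw [hz₁, flipMap_target _ _ f₁, w2]
    simp [T₁]
  have e2 : ∀ k, z₂ (cand k) = decide (∀ ρ g, ¬ ∀ o, w (reg ((k, ρ), g) o) = false) := fun k => by
    rw [hz₂, flipMap_target _ _ f₂, hz₁, flipMap_of_ne (q := cand k), w3, ← hz₁]
    · simp only [T₂, Finset.forall_mem_image, Finset.mem_univ, forall_true_left, Prod.forall, e1,
        decide_eq_false_iff_not, Bool.false_xor]
    · simp
  have e3 : z₁ eq = e := by rw [hz₁, flipMap_of_ne _ _ _ _ (by simp), w1]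
  have e4 : z₂ eq = e := by rw [hz₂, flipMap_of_ne _ _ _ _ (by simp), e3]
  have e5 : z₃ eq = e := by rw [hz₃, flipMap_of_ne _ _ _ _ (by simp), e4]
  have e6 : z₂ out = false := by
    rw [hz₂, flipMap_of_ne _ _ _ _ (by simp), hz₁, flipMap_of_ne _ _ _ _ (by simp), w4]
  have e7 : z₃ out = e := by
    rw [hz₃, flipMap_target T₃ _ f₃ z₂ (), e6]
    simp [T₃, e4]
  have e8 : ∀ k, z₃ (cand k) = decide (∀ ρ g, ¬ ∀ o, w (reg ((k, ρ), g) o) = false) := fun k => by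
    rw [hz₃, flipMap_of_ne _ _ _ _ (by simp), e2]
  have e9 : (∀ s ∈ T₄ (), z₃ s = b₄ () s) ↔ e = true ∧ ¬ Accept w := by
    simp only [T₄, Finset.forall_mem_insert, Finset.forall_mem_image, Finset.mem_univ,
      forall_true_left, e5, e8, b₄, Sum.elim_inl, Sum.elim_inr, decide_eq_false_iff_not, Accept,
      not_exists]
  rw [hz, flipMap_target T₄ _ f₃ z₃ (), e7]
  simp only [e9]
  rcases Classical.em (Accept w) with ha | ha <;> cases e <;> simp [ha]

/-- The distribution of the test registers. -/
theorem exists_registers [Nonempty G] (k : K → ℕ) (hk : ∀ i, k i ≤ Fintype.card G) :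
    ∃ U, ImplOn (Set.univ : Set (TestQubits K L G)) 29 U ∧ ∀ x : Unit ⊕ ((K × L) × G) → Bool,
      ∃ Φ : (K × L) × G → State (Option G),
        (∀ t, ∑ y, ‖Φ t y‖ ^ 2 = 1) ∧
        (∀ t, ones (fun g => x (Sum.inr (t.1, g))) = k t.1.1 → Φ t (fun _ => false) = 0) ∧
        (∀ t, ones (fun g => x (Sum.inr (t.1, g))) ≠ k t.1.1 →
          1 / (8 * (Fintype.card G : ℝ) ^ 2) ≤ ‖Φ t fun _ => false‖ ^ 2) ∧
        (∀ w, U (basis (Sum.elim x fun _ => false)) w ≠ 0 → (∀ t, (Φ t fun o => w (reg t o)) ≠ 0) ∧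
          w eq = x (Sum.inl ()) ∧ (∀ t, w (flag t) = false) ∧ (∀ k, w (cand k) = false) ∧
          w out = false) ∧
        ∀ f : (K × L) × G → (Option G → Bool) → ℝ,
          ∑ w : TestQubits K L G → Bool, (∏ t, f t fun o => w (reg t o)) *
            ‖U (basis (Sum.elim x fun _ => false)) w‖ ^ 2 = ∏ t, ∑ y, f t y * ‖Φ t y‖ ^ 2 := by
  classical
  obtain ⟨τ, hτ, hτ0⟩ := exists_angle (Fintype.card G) Fintype.card_pos
  obtain ⟨U₁, hU₁, hU₁'⟩ := exists_fanned (K := K) (L := L) (G := G) τ hτ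
  choose T hT hT' using fun t : (K × L) × G =>
    ImplOn.weightTest (ν := G) τ hτ hτ0 (k t.1.1) (hk t.1.1)
  obtain ⟨U₂, hU₂, hU₂'⟩ := ImplOn.sigma (regEmb K L G) hT
  refine ⟨_, hU₁.comp hU₂, fun x => ?_⟩
  have hreg : ∀ t o, regEmb K L G ⟨t, o⟩ = reg t o := fun _ _ => rfl
  refine ⟨fun t => T t (prodQ fun o => fanned τ x (reg t o)), ?_⟩
  have hfan : ∀ t : (K × L) × G, (fun o => fanned τ x (reg t o)) = fun o : Option G =>
      o.elim (ket false) fun i => vec (if x (Sum.inr (t.1, i)) then τ else 0) := fun t => by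
    funext o
    cases o <;> rfl
  have hprop := fun t => hT' t (fun g => x (Sum.inr (t.1, g)))
    (T t (prodQ fun o => fanned τ x (reg t o))) (by rw [hfan])
  refine ⟨fun t => ?_, fun t => (hprop t).2.1, fun t => (hprop t).2.2, fun w hw => ?_, fun f => ?_⟩
  · have := (hprop t).1
    rw [ip_self] at this
    exact_mod_cast this
  · rw [hU₁', hU₂'] at hw
    have h1 := left_ne_zero_of_mul hw
    have h2 := right_ne_zero_of_mul hw
    rw [Finset.prod_ne_zero_iff] at h1 h2
    have h3 : ∀ q : TestQubits K L G, q ∉ Set.range (regEmb K L G) → ∀ b, fanned τ x q = ket b →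
        w q = b := by
      intro q hq b hb
      have h4 := h2 q (by simpa using hq)
      rw [hb, ket] at h4
      by_contra hne
      exact h4 (if_neg hne)
    refine ⟨fun t => h1 t (Finset.mem_univ t), h3 _ ?_ _ rfl, fun t => h3 _ ?_ _ rfl,
      fun t => h3 _ ?_ _ rfl, h3 _ ?_ _ rfl⟩ <;>
    · rintro ⟨⟨t, o⟩, h⟩
      rw [hreg] at h
      simp at h
  · have hnorm : ∀ (q : TestQubits K L G), q ∉ Set.range (regEmb K L G) →
        ∃ b, fanned τ x q = ket b := by
      rintro ((u | p) | ((⟨t, o⟩ | (t | k)) | u)) hq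
      · exact ⟨_, rfl⟩
      · exact ⟨_, rfl⟩
      · exact (hq ⟨⟨t, o⟩, rfl⟩).elim
      · exact ⟨_, rfl⟩
      · exact ⟨_, rfl⟩
      · exact ⟨_, rfl⟩
    have hs := sum_norm_sigma (regEmb K L G)
      (fun t y => f t y * ‖T t (prodQ fun o => fanned τ x (reg t o)) y‖ ^ 2)
      -- Only the weights outside the registers enter the product; on the registers a normalized
      -- dummy is inserted.
      (fun q b => if q ∈ Set.range (regEmb K L G) then ‖ket false b‖ ^ 2 else ‖fanned τ x q b‖ ^ 2)
      (fun q => by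
        split_ifs with hq
        · simp [ket]
        · obtain ⟨b, hb⟩ := hnorm q hq
          rw [hb]
          cases b <;> simp [ket])
    rw [← hs]
    refine Finset.sum_congr rfl fun w _ => ?_
    rw [hU₁', hU₂', norm_mul, mul_pow, norm_prod, norm_prod, ← Finset.prod_pow, ← Finset.prod_pow,
      Finset.prod_mul_distrib, mul_assoc]
    congr 2
    refine Finset.prod_congr rfl fun q hq => ?_
    rw [if_neg (Finset.mem_filter.1 hq).2]

end TestQubits

open TestQubits in
/-- A circuit which, given many copies of the values of a group parity vector, recognizes the
vectors whose weight is among the candidates. -/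
theorem TestImpl.weights [Nonempty L] [Nonempty G] (k : K → ℕ) (hk : ∀ i, k i ≤ Fintype.card G) :
    ∃ p : (Unit ⊕ ((K × L) × G) → Bool) → ℝ,
      TestImpl p 41 (Fintype.card (((((K × L) × G) × Option G) ⊕ (((K × L) × G) ⊕ K)))) ∧
      (∀ x, x (Sum.inl ()) = false → p x = 0) ∧
      (∀ x, x (Sum.inl ()) = true →
        (∃ i, ∀ ρ, ones (fun g => x (Sum.inr ((i, ρ), g))) = k i) → p x = 1) ∧
      ∀ x, (∀ i ρ, ones (fun g => x (Sum.inr ((i, ρ), g))) ≠ k i) →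
        p x ≤ Fintype.card K * (1 - 1 / (8 * (Fintype.card G : ℝ) ^ 2)) ^
          (Fintype.card L * Fintype.card G) := by
  classical
  obtain ⟨U, hU, hUx⟩ := exists_registers (L := L) k hk
  obtain ⟨V, hV, hVx⟩ := exists_collect (K := K) (L := L) (G := G)
  choose Φ hΦ1 hΦ2 hΦ3 hΦ4 hΦ5 using hUx
  have hp : ∀ x, ∑ z, (if z out = true then ‖V (U (basis (Sum.elim x fun _ => false))) z‖ ^ 2 else 0) =
      ∑ w, if x (Sum.inl ()) = true ∧ Accept w then
        ‖U (basis (Sum.elim x fun _ => false)) w‖ ^ 2 else 0 :=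
    fun x => hVx _ _ fun w hw => (hΦ4 x w hw).2
  refine ⟨fun x => ∑ w, if x (Sum.inl ()) = true ∧ Accept w then
    ‖U (basis (Sum.elim x fun _ => false)) w‖ ^ 2 else 0, ⟨_, inferInstance, inferInstance, _, le_rfl,
      hU.comp hV, hp⟩, fun x hx => ?_, fun x hx hi => ?_, fun x hx => ?_⟩
  · simp [hx]
  · obtain ⟨i, hi⟩ := hi
    have h1 := hΦ5 x fun _ _ => 1
    simp only [Finset.prod_const_one, one_mul, hΦ1] at h1
    rw [← h1]
    refine Finset.sum_congr rfl fun w _ => ?_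
    by_cases hw : U (basis (Sum.elim x fun _ => false)) w = 0
    · simp [hw]
    · rw [if_pos]
      refine ⟨hx, i, fun ρ g hz => (hΦ4 x w hw).1 ((i, ρ), g) ?_⟩
      rw [funext hz]
      exact hΦ2 x _ (hi ρ)
  -- The probability that none of the registers of candidate `i` excludes it: the registers are
  -- independent, and each misses with probability at most `1 - 1 / (8 |G| ^ 2)`.
  · have hone : ∀ i, ∑ w : TestQubits K L G → Bool,
        (∏ t : (K × L) × G, if t.1.1 = i ∧ ∀ o, w (reg t o) = false then (0 : ℝ) else 1) *
          ‖U (basis (Sum.elim x fun _ => false)) w‖ ^ 2 ≤ (1 - 1 / (8 * (Fintype.card G : ℝ) ^ 2)) ^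
          (Fintype.card L * Fintype.card G) := by
      intro i
      rw [hΦ5 x fun t y => if t.1.1 = i ∧ ∀ o, y o = false then (0 : ℝ) else 1]
      have hle : ∀ t : (K × L) × G, ∑ y : Option G → Bool,
          (if t.1.1 = i ∧ ∀ o, y o = false then (0 : ℝ) else 1) * ‖Φ x t y‖ ^ 2 ≤
          if t.1.1 = i then 1 - 1 / (8 * (Fintype.card G : ℝ) ^ 2) else 1 := by
        intro t
        split_ifs with ht
        · have : ∀ y : Option G → Bool, (if t.1.1 = i ∧ ∀ o, y o = false then (0 : ℝ) else 1) *
              ‖Φ x t y‖ ^ 2 = ‖Φ x t y‖ ^ 2 - if y = (fun _ => false) then ‖Φ x t y‖ ^ 2 else 0 := by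
            intro y
            have : (t.1.1 = i ∧ ∀ o, y o = false) ↔ y = fun _ => false :=
              ⟨fun h => funext h.2, fun h => ⟨ht, congrFun h⟩⟩
            rw [if_congr this rfl rfl]
            split_ifs <;> ring
          rw [Finset.sum_congr rfl fun y _ => this y, Finset.sum_sub_distrib, hΦ1,
            Finset.sum_ite_eq' Finset.univ, if_pos (Finset.mem_univ _)]
          have h3 := hΦ3 x t (hx t.1.1 t.1.2)
          linarith
        · simp [ht, hΦ1]
      refine (Finset.prod_le_prod (fun t _ => Finset.sum_nonneg fun y _ => ?_)
        fun t _ => hle t).trans (le_of_eq ?_)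
      · split_ifs <;> positivity
      · rw [Fintype.prod_prod_type, Fintype.prod_prod_type, Finset.prod_eq_single i]
        · simp only [if_true, Finset.prod_const, Finset.card_univ, ← pow_mul, mul_comm]
        · intro j _ hj
          simp [hj]
        · simp
    -- Union bound over the surviving candidates.
    have hpt : ∀ w : TestQubits K L G → Bool, (if x (Sum.inl ()) = true ∧ Accept w then
        ‖U (basis (Sum.elim x fun _ => false)) w‖ ^ 2 else 0) ≤ ∑ i,
        (∏ t : (K × L) × G, if t.1.1 = i ∧ ∀ o, w (reg t o) = false then (0 : ℝ) else 1) *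
          ‖U (basis (Sum.elim x fun _ => false)) w‖ ^ 2 := by
      intro w
      have hnn : ∀ i ∈ (Finset.univ : Finset K),
          0 ≤ (∏ t : (K × L) × G, if t.1.1 = i ∧ ∀ o, w (reg t o) = false then (0 : ℝ) else 1) *
            ‖U (basis (Sum.elim x fun _ => false)) w‖ ^ 2 := fun i _ =>
        mul_nonneg (Finset.prod_nonneg fun t _ => by split_ifs <;> norm_num) (by positivity)
      split_ifs with h
      · obtain ⟨-, i, hi⟩ := h
        refine le_trans (le_of_eq ?_) (Finset.single_le_sum hnn (Finset.mem_univ i))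
        rw [Finset.prod_eq_one, one_mul]
        rintro ⟨⟨j, ρ⟩, g⟩ _
        rw [if_neg]
        rintro ⟨rfl, h⟩
        exact hi ρ g h
      · exact Finset.sum_nonneg hnn
    refine (Finset.sum_le_sum fun w _ => hpt w).trans ?_
    rw [Finset.sum_comm]
    refine (Finset.sum_le_card_nsmul _ _ _ fun i _ => hone i).trans (le_of_eq ?_)
    rw [nsmul_eq_mul, Finset.card_univ]

end WeightTests

/-! ### Prepending the layer of NOT gates. -/

section Shifted

variable {m n a : ℕ}

theorem shiftLayer_eq (r : Fin n → Bool) : shiftLayer m a r =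
    (((List.finRange m ×ˢ List.finRange n).filter (fun p : Fin m × Fin n => r p.2)).map
      (Sum.inl : Fin m × Fin n → Qubits (Fin m × Fin n) a)).map fun q => Gate.single q notGate := by
  rw [shiftLayer, List.map_map]
  rfl

theorem nodup_shift (r : Fin n → Bool) :
    (((List.finRange m ×ˢ List.finRange n).filter (fun p : Fin m × Fin n => r p.2)).map
      (Sum.inl : Fin m × Fin n → Qubits (Fin m × Fin n) a)).Nodup :=
  (((List.nodup_finRange m).product (List.nodup_finRange n)).filter _).map Sum.inl_injective

theorem shiftLayer_disjoint (r : Fin n → Bool) :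
    (shiftLayer m a r).Pairwise fun g h => Disjoint g.support h.support := by
  rw [shiftLayer_eq, List.pairwise_map]
  refine (nodup_shift r).imp fun h => ?_
  simpa [Gate.support] using h

theorem runList_not_xor {Q : Type} [Fintype Q] [DecidableEq Q] (l : List Q) (hl : l.Nodup)
    (f : Q → Bool) (hf : ∀ q, f q = true ↔ q ∈ l) (ψ : State Q) (z : Q → Bool) :
    runList (l.map fun q => Gate.single q notGate) ψ z = ψ fun q => xor (z q) (f q) := by
  rw [runList_not l hl]
  congr 1
  funext q
  by_cases hq : q ∈ l
  · rw [if_pos hq, (hf q).2 hq, Bool.xor_true]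
  · rw [if_neg hq, Bool.eq_false_iff.2 fun h => hq ((hf q).1 h), Bool.xor_false]

theorem runList_shiftLayer (r : Fin n → Bool) (x : Fin m × Fin n → Bool) :
    runList (shiftLayer m a r) (initState a x) = initState a fun p => xor (x p) (r p.2) := by
  have hf : ∀ q : Qubits (Fin m × Fin n) a,
      (Sum.elim (fun p => r p.2) fun _ => false : Qubits (Fin m × Fin n) a → Bool) q = true ↔
        q ∈ ((List.finRange m ×ˢ List.finRange n).filter (fun p : Fin m × Fin n => r p.2)).map
          Sum.inl := by
    rintro (⟨i, j⟩ | q)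
    · simp
    · simp
  funext z
  rw [shiftLayer_eq, runList_not_xor _ (nodup_shift r) _ hf, initState_eq, initState_eq, basis_apply,
    basis_apply]
  refine if_congr ⟨fun h => ?_, fun h => ?_⟩ rfl rfl
  · funext q
    have := congrFun h q
    rcases q with p | q
    · simp only [Sum.elim_inl] at this ⊢
      rw [← this, Bool.xor_assoc, Bool.xor_self, Bool.xor_false]
    · simpa using this
  · funext q
    have := congrFun h q
    rcases q with p | q
    · simp only [Sum.elim_inl] at this ⊢
      rw [this, Bool.xor_assoc, Bool.xor_self, Bool.xor_false]
    · simpa using this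

theorem TestImpl.exists_shifted {p : (Fin m × Fin n → Bool) → ℝ} {d s : ℕ} (h : TestImpl p d s) :
    ∃ a ≤ s, ∃ C : EvenString n → Circuit (Qubits (Fin m × Fin n) a),
      (∀ r, (C r).depth ≤ d + 1) ∧
      (∃ C₀ : Circuit (Qubits (Fin m × Fin n) a), ∀ r, (C r).layers = shiftLayer m a r.1 :: C₀.layers) ∧
      ∀ r x, outputProb (C r) x true = p fun q => xor (x q) (r.1 q.2) := by
  obtain ⟨a, ha, C₀, hd, hC₀⟩ := h.exists_circuit
  refine ⟨a, ha, fun r => ⟨shiftLayer m a r.1 :: C₀.layers, ?_⟩, fun r => ?_, ⟨C₀, fun r => rfl⟩,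
    fun r x => ?_⟩
  · intro L hL
    rcases List.mem_cons.1 hL with rfl | hL
    · exact shiftLayer_disjoint r.1
    · exact C₀.disjoint L hL
  · simpa [Circuit.depth] using hd
  · rw [← hC₀, outputProb, outputProb, Circuit.run_eq, Circuit.run_eq, List.flatten_cons,
      runList_append, runList_shiftLayer]

end Shifted

/-! ### Tests on copies of a string: counting odd groups, or exact parity. -/

section Main

/-- The number of groups of odd parity. -/
def oddGroups {N G : Type} [Fintype N] [DecidableEq N] [Fintype G] [DecidableEq G] (grp : N → G)
    (z : N → Bool) : ℕ :=
  ones fun g => decide (ones (fun i : {i // grp i = g} => z i.1) % 2 = 1)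

theorem oddGroups_mod_two {N G : Type} [Fintype N] [DecidableEq N] [Fintype G] [DecidableEq G]
    (grp : N → G) (z : N → Bool) : oddGroups grp z % 2 = ones z % 2 := by
  have h : ones z = ∑ g, ones fun i : {i // grp i = g} => z i.1 := by
    simp only [ones]
    rw [← Fintype.sum_sigma', ← (Equiv.sigmaFiberEquiv grp).sum_comp]
    rfl
  rw [h, oddGroups, ones, Finset.sum_nat_mod,
    Finset.sum_nat_mod (f := fun g => ones fun i : {i // grp i = g} => z i.1)]
  congr 2
  funext g
  rcases Nat.mod_two_eq_zero_or_one (ones fun i : {i // grp i = g} => z i.1) with h | h <;> simp [h]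

variable {M N K L G : Type} [Fintype M] [DecidableEq M] [Nonempty M] [Fintype N] [DecidableEq N]
  [Nonempty N] [Fintype K] [DecidableEq K] [Fintype L] [DecidableEq L] [Nonempty L]
  [Fintype G] [DecidableEq G] [Nonempty G]

/-- The test whether all the rows are equal to a string whose number of odd groups is among the
candidates. -/
theorem TestImpl.copies (grp : N → G) (row : K × L ↪ M) (k : K → ℕ)
    (hk : ∀ i, k i ≤ Fintype.card G) {d s : ℕ} (h : ∀ g, ParityImpl {i // grp i = g} d s) :
    ∃ p : (M × N → Bool) → ℝ,
      TestImpl p (9 + d + 41) (1 + Fintype.card ((K × L) × G) +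
        (Fintype.card N + Fintype.card ((K × L) × G) * s) +
          Fintype.card ((((K × L) × G) × Option G) ⊕ (((K × L) × G) ⊕ K))) ∧
      (∀ x, (¬ ∀ j, (∀ i, x (i, j) = true) ∨ ∀ i, x (i, j) = false) → p x = 0) ∧
      (∀ z : N → Bool, (∃ i, oddGroups grp z = k i) → p (fun q => z q.2) = 1) ∧
      ∀ z : N → Bool, (∀ i, oddGroups grp z ≠ k i) → p (fun q => z q.2) ≤
        Fintype.card K * (1 - 1 / (8 * (Fintype.card G : ℝ) ^ 2)) ^
          (Fintype.card L * Fintype.card G) := by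
  -- Every repetition of every candidate reads its own row, so no input bit is needed twice; this is
  -- where the copies are consumed.
  let ε : (Σ p : (K × L) × G, {i // grp i = p.2}) ↪ M × N :=
    ⟨fun p => (row p.1.1, p.2.1), by
      rintro ⟨⟨j, g⟩, ⟨i, hi⟩⟩ ⟨⟨j', g'⟩, ⟨i', hi'⟩⟩ h
      simp only [Prod.mk.injEq, EmbeddingLike.apply_eq_iff_eq] at h
      obtain ⟨rfl, rfl⟩ := h
      obtain rfl : g = g' := hi.symm.trans hi'
      rfl⟩
  have hpar := Computes.parities ε fun p => h p.2
  obtain ⟨p, hp, hp1, hp2, hp3⟩ := TestImpl.weights (L := L) k hk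
  have hc := hp.comp_computes ((Computes.allEqual M N).union hpar)
  refine ⟨_, by simpa only [Fintype.card_sum, Fintype.card_unit] using hc, fun x hx => hp1 _ ?_,
    fun z hz => hp2 _ ?_ ?_, fun z hz => hp3 _ ?_⟩
  · exact decide_eq_false hx
  · exact decide_eq_true fun j => by cases z j <;> simp
  · obtain ⟨i, hi⟩ := hz
    exact ⟨i, fun ρ => hi⟩
  · exact fun i ρ => hz i

/-- The conjunction of two bits. -/
theorem TestImpl.and :
    TestImpl (fun x : Unit ⊕ Unit → Bool =>
      if x (Sum.inl ()) = true ∧ x (Sum.inr ()) = true then 1 else 0) 3 0 := by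
  obtain ⟨F, hF, hi, ht⟩ : ∃ F, ImplOn (Set.univ : Set ((Unit ⊕ Unit) ⊕ (Empty ⊕ Unit))) 3
      (fun ψ z => ψ (F z)) ∧ Function.Involutive F ∧ ∀ x : Unit ⊕ Unit → Bool,
      F (Sum.elim x fun _ => false) (Sum.inr (Sum.inr ())) =
        decide (x (Sum.inl ()) = true ∧ x (Sum.inr ()) = true) := by
    refine ⟨_, ImplOn.flips (J := Unit) (fun _ => Finset.univ.image Sum.inl) (fun _ _ => true)
      (fun _ => Sum.inr (Sum.inr ())) (fun _ => by simp) (fun _ => by simp)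
      (fun j j' h => (h rfl).elim), flipMap_involutive _ _ _ (fun _ _ => by simp), fun x => ?_⟩
    refine (flipMap_target _ _ (t := fun _ : Unit => Sum.inr (Sum.inr ())) (fun _ _ _ => rfl) _
      ()).trans ?_
    have h1 : (∀ u : Unit, x (Sum.inl u) = true) ↔ x (Sum.inl ()) = true :=
      ⟨fun h => h (), fun h _ => h⟩
    have h2 : (∀ u : Unit, x (Sum.inr u) = true) ↔ x (Sum.inr ()) = true :=
      ⟨fun h => h (), fun h _ => h⟩
    simp [h1, h2]
  refine ⟨Empty, inferInstance, inferInstance, _, le_rfl, hF, fun x => ?_⟩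
  have hz : ∀ z : (Unit ⊕ Unit) ⊕ (Empty ⊕ Unit) → Bool,
      (if z (Sum.inr (Sum.inr ())) = true then
        ‖basis (Sum.elim x fun _ => false) (F z)‖ ^ 2 else 0) =
        if z = F (Sum.elim x fun _ => false) then
          if F (Sum.elim x fun _ => false) (Sum.inr (Sum.inr ())) = true then 1 else 0 else 0 := by
    intro z
    rw [show basis (Sum.elim x fun _ => false) (F z) = _ from
      congrFun (basis_comp_involutive hi (Sum.elim x fun _ => false)) z, basis_apply]
    by_cases h : z = F (Sum.elim x fun _ => false)
    · simp [← h]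
    · simp [h]
  rw [Finset.sum_congr rfl fun z _ => hz z, Finset.sum_ite_eq' Finset.univ,
    if_pos (Finset.mem_univ _), ht]
  simp only [decide_eq_true_eq]

/-- Serves the bounded values of `n`, where one exact gadget on all the bits of a row is affordable.
-/
theorem TestImpl.copiesParity {d s : ℕ} (h : ParityImpl N d s) :
    ∃ p : (M × N → Bool) → ℝ, TestImpl p (9 + d + 3) (2 + (Fintype.card N + s)) ∧
      (∀ x, (¬ ∀ j, (∀ i, x (i, j) = true) ∨ ∀ i, x (i, j) = false) → p x = 0) ∧
      ∀ z : N → Bool, p (fun q => z q.2) = if ones z % 2 = 1 then 1 else 0 := by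
  let ε : (Σ _ : Unit, N) ↪ M × N :=
    ⟨fun p => (Classical.arbitrary M, p.2), by
      rintro ⟨⟨⟩, i⟩ ⟨⟨⟩, i'⟩ h
      simp only [Prod.mk.injEq, true_and] at h
      rw [h]⟩
  have hpar := Computes.parities ε fun _ => h
  have hc := TestImpl.and.comp_computes ((Computes.allEqual M N).union hpar)
  refine ⟨_, by simpa using hc, fun x hx => if_neg ?_, fun z => if_congr ?_ rfl rfl⟩
  · rintro ⟨h1, -⟩
    exact hx h1
  · exact ⟨fun h => h.2, fun h => ⟨fun j => by cases z j <;> simp, h⟩⟩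

end Main

/-! ### From a test to circuits for the lifted parity. -/

section Reduction

theorem TestImpl.nonneg {I : Type} [Fintype I] [DecidableEq I] {p : (I → Bool) → ℝ} {d s : ℕ}
    (h : TestImpl p d s) (x : I → Bool) : 0 ≤ p x := by
  obtain ⟨A, _, _, T, -, -, hT⟩ := h
  rw [← hT]
  exact Finset.sum_nonneg fun z _ => by split_ifs <;> positivity

instance (n : ℕ) : Nonempty (EvenString n) := ⟨⟨fun _ => false, by simp [weight]⟩⟩

/-- The same shift is applied to every row, so unequal rows remain unequal and are rejected with
certainty by `h0`. Only equal rows remain, and there the average over the shifts is what `h1` and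
`h2` control. -/
theorem TestImpl.lift_parity {m n : ℕ} [NeZero m] {p : (Fin m × Fin n → Bool) → ℝ} {d s : ℕ}
    (h : TestImpl p d s) {δ : ℝ} (hδ : 0 ≤ δ)
    (h0 : ∀ x, (¬ ∀ j, (∀ i, x (i, j) = true) ∨ ∀ i, x (i, j) = false) → p x = 0)
    (h1 : ∀ z : Fin n → Bool, parity z = true → 1 - δ ≤
      (∑ r : EvenString n, p fun q => xor (z q.2) (r.1 q.2)) / Fintype.card (EvenString n))
    (h2 : ∀ z : Fin n → Bool, parity z = false →
      (∑ r : EvenString n, p fun q => xor (z q.2) (r.1 q.2)) / Fintype.card (EvenString n) ≤ δ) :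
    ∃ a ≤ s, ∃ C : EvenString n → Circuit (Qubits (Fin m × Fin n) a),
      (∀ r, (C r).depth ≤ d + 1) ∧
      (∃ C₀ : Circuit (Qubits (Fin m × Fin n) a), ∀ r, (C r).layers = shiftLayer m a r.1 :: C₀.layers) ∧
      ∀ y : Fin m → Fin n → Bool, 1 - δ ≤
        (∑ r, outputProb (C r) (fun p => y p.1 p.2) (lift parity y)) /
          Fintype.card (EvenString n) := by
  obtain ⟨a, ha, C, hd, hC₀, hC⟩ := h.exists_shifted
  refine ⟨a, ha, C, hd, hC₀, fun y => ?_⟩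
  have hcard : (0 : ℝ) < Fintype.card (EvenString n) := by exact_mod_cast Fintype.card_pos
  have hfalse : ∀ r x, outputProb (C r) x false = 1 - p fun q => xor (x q) (r.1 q.2) := fun r x => by
    rw [← hC, ← outputProb_add (C r) x]
    ring
  by_cases hy : ∀ i, y i = y 0
  · have hy' : (fun p : Fin m × Fin n => y p.1 p.2) = fun p => y 0 p.2 := by
      funext p
      rw [hy p.1]
    rw [hy', lift, if_pos hy]
    cases hp : parity (y 0)
    · simp only [hfalse, Finset.sum_sub_distrib, sub_div]
      have := h2 _ hp
      simp only [Finset.sum_const, Finset.card_univ, nsmul_eq_mul, mul_one, div_self hcard.ne']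
      linarith
    · simp only [hC]
      exact h1 _ hp
  · have hz : ∀ r : EvenString n, (p fun q => xor (y q.1 q.2) (r.1 q.2)) = 0 := by
      intro r
      refine h0 _ fun hall => hy fun i => funext fun j => ?_
      have hxor : xor (y i j) (r.1 j) = xor (y 0 j) (r.1 j) := by
        rcases hall j with h | h
        · exact (h i).trans (h 0).symm
        · exact (h i).trans (h 0).symm
      simpa using hxor
    rw [lift, if_neg hy]
    simp only [hfalse, hz, sub_zero, Finset.sum_const, Finset.card_univ, nsmul_eq_mul, mul_one,
      div_self hcard.ne']
    linarith

end Reduction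

/-! ### Concentration of the number of odd groups. -/

section Concentration

variable {N G : Type} [Fintype N] [DecidableEq N] [Fintype G] [DecidableEq G]

theorem sum_neg_one_pow_ones [Nonempty N] : ∑ x : N → Bool, (-1 : ℝ) ^ ones x = 0 := by
  have h : ∀ x : N → Bool, (-1 : ℝ) ^ ones x = ∏ i, (-1) ^ (x i).toNat := fun x => by
    rw [ones, Finset.prod_pow_eq_pow_sum]
  rw [Finset.sum_congr rfl fun x _ => h x, ← Fintype.piFinset_univ,
    ← Finset.prod_univ_sum (fun _ => Finset.univ) fun (_ : N) (b : Bool) => (-1 : ℝ) ^ b.toNat]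
  simp

theorem card_evenString (n : ℕ) (hn : 0 < n) : 2 * (Fintype.card (EvenString n) : ℝ) = 2 ^ n := by
  have : Nonempty (Fin n) := ⟨⟨0, hn⟩⟩
  have h : ∀ x : Fin n → Bool, (if Even (weight x) then (2 : ℝ) else 0) = 1 + (-1) ^ ones x := by
    intro x
    change (if Even (ones x) then (2 : ℝ) else 0) = _
    split_ifs with hx
    · rw [hx.neg_one_pow]
      norm_num
    · rw [(Nat.not_even_iff_odd.1 hx).neg_one_pow]
      norm_num
  have h2 := Finset.sum_congr (s₁ := Finset.univ) rfl fun x _ => h x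
  rw [Finset.sum_add_distrib, sum_neg_one_pow_ones, ← Finset.sum_filter, Finset.sum_const,
    nsmul_eq_mul] at h2
  rw [Fintype.card_subtype, mul_comm, h2]
  simp

theorem exp_mul_neg_one_pow (t : ℝ) (k : ℕ) :
    Real.exp (t * (-1) ^ k) = Real.cosh t + Real.sinh t * (-1) ^ k := by
  rcases Nat.even_or_odd k with hk | hk
  · rw [hk.neg_one_pow, mul_one, mul_one, Real.cosh_add_sinh]
  · rw [hk.neg_one_pow, mul_neg_one, mul_neg_one, ← sub_eq_add_neg, Real.cosh_sub_sinh]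

theorem sub_two_mul_oddGroups (grp : N → G) (z : N → Bool) :
    (Fintype.card G : ℝ) - 2 * oddGroups grp z
      = ∑ g, (-1 : ℝ) ^ ones fun i : {i // grp i = g} => z i.1 := by
  have h : ∀ k : ℕ, (-1 : ℝ) ^ k = 1 - 2 * ((decide (k % 2 = 1)).toNat : ℝ) := by
    intro k
    rcases Nat.even_or_odd k with hk | hk
    · rw [hk.neg_one_pow, Nat.even_iff.1 hk]
      simp
    · rw [hk.neg_one_pow, Nat.odd_iff.1 hk]
      norm_num
  simp only [h, Finset.sum_sub_distrib, ← Finset.mul_sum, oddGroups]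
  rw [ones]
  simp

/-- For a uniform string the group signs are independent, and each is unbiased because surjectivity
makes the groups nonempty; the exponential moment factors. -/
theorem sum_exp_oddGroups (grp : N → G) (hgrp : Function.Surjective grp) (t : ℝ) :
    ∑ z : N → Bool, Real.exp (t * (Fintype.card G - 2 * oddGroups grp z)) =
      2 ^ Fintype.card N * Real.cosh t ^ Fintype.card G := by
  classical
  have h1 := sum_norm_sigma (Equiv.sigmaFiberEquiv grp).toEmbedding
    (fun g (y : {i // grp i = g} → Bool) => Real.exp (t * (-1) ^ ones y)) (fun _ _ => 1 / 2)
    (fun _ => by norm_num)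
  have h2 : ∀ z : N → Bool, Real.exp (t * (Fintype.card G - 2 * oddGroups grp z)) =
      (∏ g, Real.exp (t * (-1) ^ ones fun i : {i // grp i = g} =>
        z ((Equiv.sigmaFiberEquiv grp).toEmbedding ⟨g, i⟩))) *
      ∏ q with q ∉ Set.range (Equiv.sigmaFiberEquiv grp).toEmbedding, (1 / 2 : ℝ) := by
    intro z
    rw [sub_two_mul_oddGroups, Finset.mul_sum, Real.exp_sum]
    have : (Finset.univ.filter fun q => q ∉ Set.range (Equiv.sigmaFiberEquiv grp).toEmbedding) = ∅ := by
      ext q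
      simp
    rw [this, Finset.prod_empty, mul_one]
    rfl
  rw [Finset.sum_congr rfl fun z _ => h2 z, h1]
  have h3 : ∀ g, ∑ y : {i // grp i = g} → Bool, Real.exp (t * (-1) ^ ones y) =
      2 ^ Fintype.card {i // grp i = g} * Real.cosh t := by
    intro g
    obtain ⟨i, hi⟩ := hgrp g
    have : Nonempty {i // grp i = g} := ⟨⟨i, hi⟩⟩
    simp only [exp_mul_neg_one_pow, Finset.sum_add_distrib, ← Finset.mul_sum, sum_neg_one_pow_ones]
    simp
  rw [Finset.prod_congr rfl fun g _ => h3 g, Finset.prod_mul_distrib, Finset.prod_pow_eq_pow_sum,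
    ← Fintype.card_sigma, Fintype.card_congr (Equiv.sigmaFiberEquiv grp), Finset.prod_const,
    Finset.card_univ]

/-- Chernoff's bound for both tails, with `cosh t ≤ exp (t² / 2)`. -/
theorem card_deviation_le (grp : N → G) (hgrp : Function.Surjective grp) {t : ℝ} (ht : 0 ≤ t) (S : ℝ) :
    ((Finset.univ.filter fun z : N → Bool => S < |(Fintype.card G : ℝ) - 2 * oddGroups grp z|).card : ℝ)
      ≤ 2 * 2 ^ Fintype.card N * Real.exp (Fintype.card G * (t ^ 2 / 2) - t * S) := by
  have hpt : ∀ z : N → Bool, (if S < |(Fintype.card G : ℝ) - 2 * oddGroups grp z| then (1 : ℝ) else 0) ≤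
      Real.exp (-(t * S)) * (Real.exp (t * (Fintype.card G - 2 * oddGroups grp z)) +
        Real.exp (-t * (Fintype.card G - 2 * oddGroups grp z))) := by
    intro z
    split_ifs with h
    · rw [mul_add, ← Real.exp_add, ← Real.exp_add]
      rcases lt_abs.1 h with h | h
      · have : 1 ≤ Real.exp (-(t * S) + t * (Fintype.card G - 2 * oddGroups grp z)) :=
          Real.one_le_exp (by nlinarith)
        linarith [Real.exp_pos (-(t * S) + -t * (Fintype.card G - 2 * oddGroups grp z))]
      · have : 1 ≤ Real.exp (-(t * S) + -t * (Fintype.card G - 2 * oddGroups grp z)) :=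
          Real.one_le_exp (by nlinarith)
        linarith [Real.exp_pos (-(t * S) + t * (Fintype.card G - 2 * oddGroups grp z))]
    · positivity
  have h := Finset.sum_le_sum fun z (_ : z ∈ Finset.univ) => hpt z
  rw [← Finset.mul_sum, Finset.sum_add_distrib, sum_exp_oddGroups grp hgrp,
    sum_exp_oddGroups grp hgrp, Real.cosh_neg, Finset.sum_boole] at h
  refine h.trans ?_
  have hc : Real.cosh t ^ Fintype.card G ≤ Real.exp (Fintype.card G * (t ^ 2 / 2)) := by
    rw [Real.exp_nat_mul]
    exact pow_le_pow_left₀ (Real.cosh_pos t).le (Real.cosh_le_exp_half_sq t) _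
  rw [sub_eq_add_neg, Real.exp_add]
  have h2 : (0 : ℝ) ≤ 2 ^ Fintype.card N * Real.exp (-(t * S)) := by positivity
  nlinarith [mul_le_mul_of_nonneg_left hc h2]

/-- Most shifts by strings of even weight have about as many odd groups as even ones. -/
theorem card_shift_deviation_le {n : ℕ} (hn : 0 < n) (grp : Fin n → G)
    (hgrp : Function.Surjective grp) {σ P : ℝ} (hσ : 0 < σ) (hG : (Fintype.card G : ℝ) ≤ σ ^ 2)
    (z : Fin n → Bool) :
    ((Finset.univ.filter fun r : EvenString n => 4 * σ * P <
      |(Fintype.card G : ℝ) - 2 * oddGroups grp fun i => xor (z i) (r.1 i)|).card : ℝ) ≤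
      Fintype.card (EvenString n) * (4 * Real.exp (1 / 2 - 4 * P)) := by
  -- With `g ≤ σ²`, the choice `t = 1/σ` makes the exponent at most `1/2 - 4P`.
  have h1 := card_deviation_le grp hgrp (t := 1 / σ) (by positivity) (4 * σ * P)
  -- Shifting is injective, so bad shifts inject into bad strings. Even strings are half of all
  -- strings, which doubles the factor 2 of the two tails to 4.
  have h2 : (Finset.univ.filter fun r : EvenString n => 4 * σ * P <
      |(Fintype.card G : ℝ) - 2 * oddGroups grp fun i => xor (z i) (r.1 i)|).card ≤
      (Finset.univ.filter fun z : Fin n → Bool =>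
        4 * σ * P < |(Fintype.card G : ℝ) - 2 * oddGroups grp z|).card := by
    refine Finset.card_le_card_of_injOn (fun r i => xor (z i) (r.1 i)) (fun r hr => ?_) ?_
    · simpa using hr
    · intro r _ r' _ h
      refine Subtype.ext (funext fun i => ?_)
      simpa using congrFun h i
  have h3 : (Fintype.card G : ℝ) * ((1 / σ) ^ 2 / 2) - 1 / σ * (4 * σ * P) ≤ 1 / 2 - 4 * P := by
    have : (Fintype.card G : ℝ) * ((1 / σ) ^ 2 / 2) ≤ σ ^ 2 * ((1 / σ) ^ 2 / 2) :=
      mul_le_mul_of_nonneg_right hG (by positivity)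
    have e1 : σ ^ 2 * ((1 / σ) ^ 2 / 2) = 1 / 2 := by field_simp
    have e2 : 1 / σ * (4 * σ * P) = 4 * P := by field_simp
    linarith
  have h4 := Real.exp_le_exp.2 h3
  have h5 : (0 : ℝ) ≤ 2 * 2 ^ n := by positivity
  rw [Fintype.card_fin] at h1
  calc _ ≤ _ := Nat.cast_le.2 h2
    _ ≤ 2 * 2 ^ n * Real.exp (1 / 2 - 4 * P) := h1.trans (mul_le_mul_of_nonneg_left h4 h5)
    _ = _ := by rw [← card_evenString n hn]; ring

end Concentration

/-! ### Error bounds, candidate weights, and the test with its error analysis. -/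

theorem ones_xor_mod_two {N : Type} [Fintype N] [DecidableEq N] (x y : N → Bool) :
    (ones fun i => xor (x i) (y i)) % 2 = (ones x + ones y) % 2 := by
  have h : ones x + ones y = (ones fun i => xor (x i) (y i)) + 2 * ∑ i, (x i && y i).toNat := by
    simp only [ones]
    rw [Finset.mul_sum, ← Finset.sum_add_distrib, ← Finset.sum_add_distrib]
    refine Finset.sum_congr rfl fun i _ => ?_
    cases x i <;> cases y i <;> rfl
  omega

theorem exp_neg_le_half_pow (P : ℕ) : Real.exp (-P) ≤ (1 / 2) ^ P := by
  have h : Real.exp (-(P : ℝ)) = Real.exp (-1) ^ P := by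
    rw [← Real.exp_nat_mul]
    congr 1
    ring
  rw [h]
  exact pow_le_pow_left₀ (Real.exp_pos _).le (by linarith [Real.exp_neg_one_lt_d9]) P

theorem four_mul_exp_le {P : ℕ} (hP : 2 ≤ P) : 4 * Real.exp (1 / 2 - 4 * P) ≤ (1 / 2) ^ P := by
  have hP' : (2 : ℝ) ≤ P := by exact_mod_cast hP
  refine le_trans ?_ (exp_neg_le_half_pow P)
  have h1 : (4 : ℝ) ≤ Real.exp (3 * P - 1 / 2) := by
    linarith [Real.add_one_le_exp (3 * (P : ℝ) - 1 / 2)]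
  calc 4 * Real.exp (1 / 2 - 4 * P) ≤ Real.exp (3 * P - 1 / 2) * Real.exp (1 / 2 - 4 * P) :=
        mul_le_mul_of_nonneg_right h1 (Real.exp_pos _).le
    _ = Real.exp (-P) := by rw [← Real.exp_add]; ring_nf

/-- Here `5 n P` bounds the number of candidates and `exp (-(4 P))` the probability that a wrong one
survives. -/
theorem mul_exp_le {n P : ℕ} (hP : 2 ≤ P) (hn : n ≤ 2 ^ P) :
    5 * n * P * Real.exp (-(4 * P)) ≤ (1 / 2) ^ P := by
  have hP' : (2 : ℝ) ≤ P := by exact_mod_cast hP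
  refine le_trans ?_ (exp_neg_le_half_pow P)
  have h1 : (n : ℝ) ≤ Real.exp P := by
    have h2 : (2 : ℝ) ≤ Real.exp 1 := by linarith [Real.add_one_le_exp (1 : ℝ)]
    calc (n : ℝ) ≤ 2 ^ P := by exact_mod_cast hn
      _ ≤ Real.exp 1 ^ P := pow_le_pow_left₀ (by norm_num) h2 P
      _ = Real.exp P := by rw [← Real.exp_nat_mul, mul_one]
  have h3 : 5 * (P : ℝ) ≤ Real.exp (2 * P) := by
    have := Real.quadratic_le_exp_of_nonneg (x := 2 * (P : ℝ)) (by positivity)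
    nlinarith
  have h4 : 5 * (n : ℝ) * P ≤ Real.exp P * Real.exp (2 * P) := by
    have := mul_le_mul h1 h3 (by positivity) (Real.exp_pos _).le
    linarith
  calc 5 * n * P * Real.exp (-(4 * P)) ≤ Real.exp P * Real.exp (2 * P) * Real.exp (-(4 * P)) :=
        mul_le_mul_of_nonneg_right h4 (Real.exp_pos _).le
    _ = Real.exp (-P) := by rw [← Real.exp_add, ← Real.exp_add]; ring_nf

/-- The candidate weights: the odd numbers in a window around the half of `g`. -/
abbrev Candidate (g S : ℕ) : Type :=
  {k : Fin (g + 1) // k.1 % 2 = 1 ∧ g ≤ 2 * k.1 + S ∧ 2 * k.1 ≤ g + S}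

theorem card_candidate_le (g S : ℕ) : Fintype.card (Candidate g S) ≤ S + 1 := by
  have h : Fintype.card (Candidate g S) ≤ (Finset.Icc ((g + 1 - S) / 2) ((g + S) / 2)).card := by
    rw [← Finset.card_univ]
    refine Finset.card_le_card_of_injOn (fun k => k.1.1) (fun k _ => ?_) ?_
    · have := k.2
      simp only [Finset.coe_Icc, Set.mem_Icc]
      omega
    · intro k _ k' _ h
      exact Subtype.ext (Fin.ext h)
  rw [Nat.card_Icc] at h
  omega

/-- The window has at most `4σP + 1` candidates, each tested on `32 g P` rows; `hm` says that these
rows are available. An even shift preserves the parity of the number of odd groups, so odd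
candidates can be right only for odd strings. -/
theorem TestImpl.concentrated {m n : ℕ} [NeZero m] (hn : 0 < n) {G : Type} [Fintype G]
    [DecidableEq G] (grp : Fin n → G) (hgrp : Function.Surjective grp) {d s σ P : ℕ}
    (h : ∀ g, ParityImpl {i // grp i = g} d s) (hσ : 0 < σ) (hσn : σ ≤ n)
    (hG : Fintype.card G ≤ σ ^ 2) (hP : 2 ≤ P) (hnP : n ≤ 2 ^ P)
    (hm : (4 * σ * P + 1) * (32 * Fintype.card G * P) ≤ m) :
    ∃ p : (Fin m × Fin n → Bool) → ℝ, TestImpl p (9 + d + 41) (m * n * (s + n + 6)) ∧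
      (∀ x, (¬ ∀ j, (∀ i, x (i, j) = true) ∨ ∀ i, x (i, j) = false) → p x = 0) ∧
      (∀ z : Fin n → Bool, parity z = true → 1 - (1 / 2 : ℝ) ^ P ≤
        (∑ r : EvenString n, p fun q => xor (z q.2) (r.1 q.2)) / Fintype.card (EvenString n)) ∧
      ∀ z : Fin n → Bool, parity z = false →
        (∑ r : EvenString n, p fun q => xor (z q.2) (r.1 q.2)) / Fintype.card (EvenString n) ≤
          (1 / 2 : ℝ) ^ P := by
  have hne : Nonempty (Fin n) := ⟨⟨0, hn⟩⟩
  have hneG : Nonempty G := ⟨grp ⟨0, hn⟩⟩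
  have hneM : Nonempty (Fin m) := ⟨0⟩
  set g := Fintype.card G with hg
  have hg0 : 0 < g := Fintype.card_pos
  have hgn : g ≤ n := by simpa using Fintype.card_le_of_surjective grp hgrp
  set S := 4 * σ * P with hS
  have hL0 : 0 < 32 * g * P := by positivity
  have hneL : Nonempty (Fin (32 * g * P)) := ⟨⟨0, hL0⟩⟩
  have hcK := card_candidate_le g S
  have hrow : Fintype.card (Candidate g S) * (32 * g * P) ≤ m :=
    (Nat.mul_le_mul_right _ hcK).trans hm
  obtain ⟨row⟩ : Nonempty (Candidate g S × Fin (32 * g * P) ↪ Fin m) :=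
    Function.Embedding.nonempty_of_card_le (by simpa using hrow)
  obtain ⟨p, hp, hp0, hp1, hp2⟩ := TestImpl.copies (M := Fin m) grp row (fun k => k.1.1)
    (fun k => by have := k.1.2; omega) h
  have hcard : (0 : ℝ) < Fintype.card (EvenString n) := by exact_mod_cast Fintype.card_pos
  have hmod : ∀ (z : Fin n → Bool) (r : EvenString n),
      oddGroups grp (fun i => xor (z i) (r.1 i)) % 2 = weight z % 2 := by
    intro z r
    rw [oddGroups_mod_two, ones_xor_mod_two]
    have : ones r.1 % 2 = 0 := Nat.even_iff.1 r.2
    change (ones z + ones r.1) % 2 = ones z % 2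
    omega
  refine ⟨p, ?_, hp0, fun z hz => ?_, fun z hz => ?_⟩
  · obtain ⟨A, _, _, T, hA, hT, hTx⟩ := hp
    refine ⟨A, _, _, T, hA.trans ?_, hT, hTx⟩
    simp only [Fintype.card_sum, Fintype.card_prod, Fintype.card_option, Fintype.card_fin, ← hg]
    have hX : Fintype.card (Candidate g S) * (32 * g * P) * g ≤ m * n := Nat.mul_le_mul hrow hgn
    set X := Fintype.card (Candidate g S) * (32 * g * P) * g with hXdef
    have hm0 : 1 ≤ m := Nat.one_le_iff_ne_zero.2 (NeZero.ne m)
    have hK : Fintype.card (Candidate g S) ≤ m * n := by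
      calc Fintype.card (Candidate g S) ≤ Fintype.card (Candidate g S) * (32 * g * P) :=
            Nat.le_mul_of_pos_right _ hL0
        _ ≤ m := hrow
        _ ≤ m * n := Nat.le_mul_of_pos_right _ hn
    have h1 : n ≤ m * n := Nat.le_mul_of_pos_left _ hm0
    have h2 : X * s ≤ m * n * s := Nat.mul_le_mul_right _ hX
    have h3 : X * (g + 1) ≤ m * n * (n + 1) := Nat.mul_le_mul hX (by omega)
    nlinarith
  -- Odd parity: if the shift keeps the number of odd groups in the window, that number is a
  -- candidate and acceptance is certain. Only the bad shifts contribute to the error.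
  · have hbad := card_shift_deviation_le hn grp hgrp (σ := σ) (P := P) (by exact_mod_cast hσ)
      (by exact_mod_cast hG) z
    have hpt : ∀ r : EvenString n, 1 - (if 4 * (σ : ℝ) * P <
        |(Fintype.card G : ℝ) - 2 * oddGroups grp fun i => xor (z i) (r.1 i)| then (1 : ℝ) else 0) ≤
        p fun q => xor (z q.2) (r.1 q.2) := by
      intro r
      split_ifs with hr
      · rw [sub_self]
        exact hp.nonneg _
      · rw [sub_zero]
        refine (hp1 (fun i => xor (z i) (r.1 i)) ?_).ge
        have hodd := hmod z r
        rw [show weight z % 2 = 1 from of_decide_eq_true hz] at hodd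
        rw [not_lt, abs_le] at hr
        set o := oddGroups grp fun i => xor (z i) (r.1 i) with ho
        have hog : o ≤ g := by
          rw [ho, oddGroups, ones_eq_card, hg]
          exact Finset.card_le_univ _
        have h1 : (g : ℝ) ≤ ((2 * o + S : ℕ) : ℝ) := by
          rw [hS]
          push_cast
          linarith [hr.2]
        have h2 : ((2 * o : ℕ) : ℝ) ≤ ((g + S : ℕ) : ℝ) := by
          rw [hS]
          push_cast
          linarith [hr.1]
        exact ⟨⟨⟨o, by omega⟩, hodd, by exact_mod_cast h1, by exact_mod_cast h2⟩, rfl⟩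
    have hsum := Finset.sum_le_sum fun r (_ : r ∈ Finset.univ) => hpt r
    rw [Finset.sum_sub_distrib, Finset.sum_const, Finset.card_univ, nsmul_eq_mul, mul_one,
      Finset.sum_boole] at hsum
    rw [le_div_iff₀ hcard]
    have := mul_le_mul_of_nonneg_left (four_mul_exp_le hP) hcard.le
    linarith
  -- Even parity: every candidate is wrong, so the bound holds for each shift separately.
  · have hpt : ∀ r : EvenString n, (p fun q => xor (z q.2) (r.1 q.2)) ≤ (1 / 2 : ℝ) ^ P := by
      intro r
      have heven := hmod z r
      rw [show weight z % 2 = 0 by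
        have := of_decide_eq_false hz
        omega] at heven
      refine (hp2 (fun i => xor (z i) (r.1 i)) fun k hk => ?_).trans ?_
      · have := k.2.1
        omega
      have hg1 : (1 : ℝ) ≤ g := by exact_mod_cast hg0
      have h1 : 1 - 1 / (8 * (g : ℝ) ^ 2) ≤ Real.exp (-(1 / (8 * (g : ℝ) ^ 2))) := by
        linarith [Real.add_one_le_exp (-(1 / (8 * (g : ℝ) ^ 2)))]
      have h0 : 0 ≤ 1 - 1 / (8 * (g : ℝ) ^ 2) := by
        rw [sub_nonneg, div_le_one (by positivity)]
        nlinarith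
      -- The constant 32 is chosen here: `32 g P · g` trials with success probability at least `1 /
      -- (8 g²)` give the exponent `4 P`.
      have h2 : (1 - 1 / (8 * (g : ℝ) ^ 2)) ^ (Fintype.card (Fin (32 * g * P)) * g) ≤
          Real.exp (-(4 * P)) := by
        refine (pow_le_pow_left₀ h0 h1 _).trans (le_of_eq ?_)
        rw [← Real.exp_nat_mul, Fintype.card_fin]
        congr 1
        push_cast
        field_simp
        ring
      have h3 : (Fintype.card (Candidate g S) : ℝ) ≤ 5 * n * P := by
        have h4 : Fintype.card (Candidate g S) ≤ 5 * n * P := by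
          refine hcK.trans ?_
          have : σ * P ≤ n * P := Nat.mul_le_mul_right _ hσn
          have : 1 ≤ n * P := Nat.mul_pos hn (by omega)
          rw [hS]
          nlinarith
        exact_mod_cast h4
      exact (mul_le_mul h3 h2 (pow_nonneg h0 _) (by positivity)).trans (mul_exp_le hP hnP)
    rw [div_le_iff₀ hcard]
    refine (Finset.sum_le_card_nsmul _ _ _ fun r _ => hpt r).trans (le_of_eq ?_)
    rw [nsmul_eq_mul, Finset.card_univ, mul_comm]

/-! ### Partition into blocks. -/

section Blocks

/-- The partition of `Fin n` into blocks of length `B`. -/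
def block (n B : ℕ) (i : Fin n) : Fin ((n - 1) / B + 1) :=
  ⟨i / B, Nat.lt_succ_of_le (Nat.div_le_div_right (by omega))⟩

theorem block_surjective {n B : ℕ} (hn : 0 < n) (hB : 0 < B) : Function.Surjective (block n B) := by
  rintro ⟨g, hg⟩
  have h1 : g * B ≤ n - 1 := (Nat.le_div_iff_mul_le hB).1 (Nat.lt_succ_iff.1 hg)
  exact ⟨⟨g * B, by omega⟩, Fin.ext (Nat.mul_div_cancel _ hB)⟩

theorem card_block_le {n B : ℕ} (hB : 0 < B) (g : Fin ((n - 1) / B + 1)) :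
    Fintype.card {i // block n B i = g} ≤ B := by
  have h : Fintype.card {i // block n B i = g} ≤ Fintype.card (Fin B) := by
    refine Fintype.card_le_of_injective (fun i => ⟨i.1 % B, Nat.mod_lt _ hB⟩) ?_
    rintro ⟨i, hi⟩ ⟨j, hj⟩ h
    have h1 : i.1 / B = j.1 / B := congrArg Fin.val (hi.trans hj.symm)
    have h2 : i.1 % B = j.1 % B := congrArg Fin.val h
    refine Subtype.ext (Fin.ext ?_)
    rw [← Nat.div_add_mod i.1 B, ← Nat.div_add_mod j.1 B, h1, h2]
  simpa using h

end Blocks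

/-! ### Choice of block length, and counting rows and ancillas. -/

section Parameters

/-- The rows used by the circuit fit into `n ^ (3 / 2) / (log n) ^ d`. -/
theorem rows_le {n m g B σ Λ c d : ℕ} (hB : 0 < B) (hgB : g * B ≤ 2 * n) (hσ : σ ^ 2 ≤ 4 * g)
    (hσ0 : 0 < σ) (hΛ : Real.logb 2 n ≤ Λ + 1) (hlog : 0 < Real.logb 2 n)
    (hBig : 100 * (Λ + 1) ^ (2 * (c + 1) + d) ≤ B)
    (hm : (n : ℝ) ^ (3 / 2 : ℝ) / Real.logb 2 n ^ d ≤ m) :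
    (4 * σ * (Λ + 1) ^ (c + 1) + 1) * (32 * g * (Λ + 1) ^ (c + 1)) ≤ m := by
  set P := (Λ + 1) ^ (c + 1) with hP
  set w := 2 * (c + 1) + d with hw
  have hP1 : 1 ≤ P := Nat.one_le_pow _ _ (by omega)
  have hσP : 1 ≤ σ * P := Nat.mul_pos hσ0 hP1
  have hfirst : (4 * σ * P + 1) * (32 * g * P) ≤ 160 * (σ * g * P ^ 2) := by
    have : 4 * σ * P + 1 ≤ 5 * (σ * P) := by nlinarith
    calc (4 * σ * P + 1) * (32 * g * P) ≤ 5 * (σ * P) * (32 * g * P) := Nat.mul_le_mul_right _ this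
      _ = 160 * (σ * g * P ^ 2) := by ring
  -- Squaring removes the exponent `3/2`, and multiplying by `B ^ 3` allows `g B ≤ 2 n` to be used.
  -- The logarithms are absorbed by `B ^ 3 ≥ 100 ^ 3 (Λ + 1) ^ (3 w)`, where `100 ^ 3` exceeds the
  -- accumulated constant `819200`.
  have hkey : (160 * (σ * g * P ^ 2) * (Λ + 1) ^ d) ^ 2 ≤ n ^ 3 := by
    refine Nat.le_of_mul_le_mul_right ?_ (pow_pos hB 3)
    have e1 : P ^ 4 * ((Λ + 1) ^ d) ^ 2 = (Λ + 1) ^ (2 * w) := by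
      rw [hP, ← pow_mul, ← pow_mul, ← pow_add, hw]
      congr 1
      ring
    have e2 : (Λ + 1) ^ (2 * w) ≤ (Λ + 1) ^ (3 * w) := Nat.pow_le_pow_right (by omega) (by omega)
    have e3 : (100 * (Λ + 1) ^ w) ^ 3 ≤ B ^ 3 := Nat.pow_le_pow_left hBig 3
    have e4 : (g * B) ^ 3 ≤ (2 * n) ^ 3 := Nat.pow_le_pow_left hgB 3
    calc (160 * (σ * g * P ^ 2) * (Λ + 1) ^ d) ^ 2 * B ^ 3
        = 25600 * (σ ^ 2 * (g ^ 2 * (P ^ 4 * ((Λ + 1) ^ d) ^ 2) * B ^ 3)) := by ring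
      _ ≤ 25600 * (4 * g * (g ^ 2 * (P ^ 4 * ((Λ + 1) ^ d) ^ 2) * B ^ 3)) :=
          Nat.mul_le_mul_left _ (Nat.mul_le_mul_right _ hσ)
      _ = 102400 * ((g * B) ^ 3 * (P ^ 4 * ((Λ + 1) ^ d) ^ 2)) := by ring
      _ ≤ 102400 * ((2 * n) ^ 3 * (Λ + 1) ^ (3 * w)) := by
          rw [e1]
          exact Nat.mul_le_mul_left _ (Nat.mul_le_mul e4 e2)
      _ = n ^ 3 * (819200 * (Λ + 1) ^ (3 * w)) := by ring
      _ ≤ n ^ 3 * (100 * (Λ + 1) ^ w) ^ 3 := by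
          refine Nat.mul_le_mul_left _ ?_
          rw [mul_pow, ← pow_mul, mul_comm w 3]
          exact Nat.mul_le_mul_right _ (by norm_num)
      _ ≤ n ^ 3 * B ^ 3 := Nat.mul_le_mul_left _ e3
  have hreal : ((160 * (σ * g * P ^ 2) : ℕ) : ℝ) ≤ m := by
    refine le_trans ?_ hm
    rw [le_div_iff₀ (pow_pos hlog d)]
    have h1 : Real.logb 2 n ^ d ≤ ((Λ + 1 : ℕ) : ℝ) ^ d := by
      push_cast
      exact pow_le_pow_left₀ hlog.le hΛ d
    refine (mul_le_mul_of_nonneg_left h1 (Nat.cast_nonneg _)).trans ?_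
    have h2 : (n : ℝ) ^ (3 / 2 : ℝ) = Real.sqrt ((n : ℝ) ^ 3) := by
      rw [Real.sqrt_eq_rpow, ← Real.rpow_natCast, ← Real.rpow_mul (Nat.cast_nonneg _)]
      norm_num
    rw [h2]
    refine Real.le_sqrt_of_sq_le ?_
    exact_mod_cast hkey
  exact hfirst.trans (by exact_mod_cast hreal)

/-- The first condition makes blocks of length `√Λ ^ (2 w + 1)` long enough to save the required
logarithms; the second keeps them no longer than `n`. -/
theorem exists_threshold (w : ℕ) : ∃ Λ₀ : ℕ, ∀ Λ, Λ₀ ≤ Λ →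
    100 * 4 ^ w ≤ Nat.sqrt Λ ∧ Λ ^ (2 * w + 1) ≤ 2 ^ Λ := by
  have h := (isLittleO_pow_const_const_pow_of_one_lt (R := ℝ) (2 * w + 1) (r := 2)
    (by norm_num)).bound one_pos
  obtain ⟨N, hN⟩ := Filter.eventually_atTop.1 h
  refine ⟨max N ((100 * 4 ^ w) ^ 2), fun Λ hΛ => ⟨?_, ?_⟩⟩
  · rw [Nat.le_sqrt']
    exact (le_max_right _ _).trans hΛ
  · have := hN Λ ((le_max_left _ _).trans hΛ)
    simp only [norm_pow, Real.norm_natCast, one_mul, Real.norm_ofNat] at this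
    exact_mod_cast this

/-- Since `Λ + 1 ≤ 4 q ^ 2`, the power `q ^ (2 w)` accounts for the logarithms, and the one extra
factor `q` for the constant. -/
theorem mul_pow_le_sqrt_pow {Λ w : ℕ} (h : 100 * 4 ^ w ≤ Nat.sqrt Λ) :
    100 * (Λ + 1) ^ w ≤ Nat.sqrt Λ ^ (2 * w + 1) := by
  set q := Nat.sqrt Λ with hq
  have hq1 : 1 ≤ q := le_trans (by have := Nat.one_le_pow w 4 (by norm_num); omega) h
  have h1 : Λ + 1 ≤ 4 * q ^ 2 := by
    have := Nat.lt_succ_sqrt Λ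
    rw [← hq] at this
    have h2 : (q + 1) * (q + 1) ≤ 4 * q ^ 2 := by nlinarith
    exact this.trans_le h2
  calc 100 * (Λ + 1) ^ w ≤ 100 * (4 * q ^ 2) ^ w :=
        Nat.mul_le_mul_left _ (Nat.pow_le_pow_left h1 w)
    _ = 100 * 4 ^ w * q ^ (2 * w) := by rw [mul_pow, ← pow_mul]; ring
    _ ≤ q * q ^ (2 * w) := Nat.mul_le_mul_right _ h
    _ = q ^ (2 * w + 1) := by ring

/-- The gadget has size exponential in `q log q`; the choice `q ^ 2 ≤ log n` makes this polynomial
in `n`. -/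
theorem gadget_size_le {q Λ n : ℕ} (hq : q = Nat.sqrt Λ) (hq3 : 4 ≤ q) (hn : 2 ^ Λ ≤ n) :
    (8 * q) ^ q * q + (q + 2) + q + 1 ≤ n ^ 6 := by
  have hqn : q ≤ n := by
    have h1 : q ≤ Λ := hq ▸ Nat.sqrt_le_self Λ
    exact h1.trans (Nat.lt_two_pow_self.le.trans hn)
  have h1 : (8 * q) ^ q ≤ n ^ 4 := by
    have h2 : 8 * q ≤ 2 ^ (4 * q) := by
      calc 8 * q ≤ 2 ^ 3 * 2 ^ q := Nat.mul_le_mul (by norm_num) Nat.lt_two_pow_self.le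
        _ = 2 ^ (3 + q) := (pow_add _ _ _).symm
        _ ≤ 2 ^ (4 * q) := Nat.pow_le_pow_right (by norm_num) (by omega)
    have h3 : q * q ≤ Λ := hq ▸ Nat.sqrt_le Λ
    calc (8 * q) ^ q ≤ (2 ^ (4 * q)) ^ q := Nat.pow_le_pow_left h2 q
      _ = (2 ^ (q * q)) ^ 4 := by rw [← pow_mul, ← pow_mul]; ring_nf
      _ ≤ (2 ^ Λ) ^ 4 := Nat.pow_le_pow_left (Nat.pow_le_pow_right (by norm_num) h3) 4
      _ ≤ n ^ 4 := Nat.pow_le_pow_left hn 4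
  have h4 : (8 * q) ^ q * q ≤ n ^ 4 * n := Nat.mul_le_mul h1 hqn
  have hn4 : 4 ≤ n := hq3.trans hqn
  have h5 : n ^ 5 * 4 ≤ n ^ 6 := by
    rw [pow_succ n 5]
    exact Nat.mul_le_mul_left _ hn4
  have h6 : n ≤ n ^ 5 := Nat.le_self_pow (by norm_num) n
  have h7 : n ^ 4 * n = n ^ 5 := by ring
  omega

end Parameters

/-! ### Large and small `n`, and the conclusion. -/

theorem logb_le_log_add_one {n : ℕ} (hn : 0 < n) : Real.logb 2 n ≤ (Nat.log 2 n : ℝ) + 1 := by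
  rw [Real.logb_le_iff_le_rpow (by norm_num) (by exact_mod_cast hn)]
  have h : n ≤ 2 ^ (Nat.log 2 n + 1) := (Nat.lt_pow_succ_log_self (by norm_num) n).le
  have h2 : ((2 : ℝ) ^ ((Nat.log 2 n : ℝ) + 1)) = ((2 ^ (Nat.log 2 n + 1) : ℕ) : ℝ) := by
    push_cast
    rw [← Real.rpow_natCast]
    push_cast
    rfl
  rw [h2]
  exact_mod_cast h

theorem half_pow_le_rpow {n c : ℕ} (hn : 2 ≤ n) :
    (1 / 2 : ℝ) ^ ((Nat.log 2 n + 1) ^ (c + 1)) ≤ 2 ^ (-(Real.logb 2 n) ^ c) := by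
  have hlog : 0 ≤ Real.logb 2 n := Real.logb_nonneg (by norm_num) (by exact_mod_cast by omega)
  have h1 : Real.logb 2 n ^ c ≤ ((Nat.log 2 n + 1) ^ (c + 1) : ℕ) := by
    push_cast
    refine (pow_le_pow_left₀ hlog (logb_le_log_add_one (by omega)) c).trans ?_
    refine pow_le_pow_right₀ ?_ (Nat.le_succ c)
    have : (0 : ℝ) ≤ Nat.log 2 n := Nat.cast_nonneg _
    linarith
  rw [one_div, inv_pow, ← Real.rpow_natCast, ← Real.rpow_neg (by norm_num)]
  exact Real.rpow_le_rpow_of_exponent_le (by norm_num) (neg_le_neg h1)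

/-- Blocks of length `q ^ (2 w + 1)` with `q = √Λ` are polylogarithmic in `n`, yet a tree of
constant height `2 w + 1` with gadgets of fan-in `q` computes their parities. -/
theorem TestImpl.large {m n c d Λ : ℕ} [NeZero m] (hn : 2 ≤ n) (hΛn : Λ = Nat.log 2 n)
    (hq : 100 * 4 ^ (2 * (c + 1) + d) ≤ Nat.sqrt Λ)
    (hΛ : Λ ^ (2 * (2 * (c + 1) + d) + 1) ≤ 2 ^ Λ)
    (hm : (n : ℝ) ^ (3 / 2 : ℝ) / Real.logb 2 n ^ d ≤ m) :
    ∃ p : (Fin m × Fin n → Bool) → ℝ,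
      TestImpl p (9 + 258 * (2 * (2 * (c + 1) + d) + 1) + 41) (m * n * (n ^ 9 + n + 6)) ∧
      (∀ x, (¬ ∀ j, (∀ i, x (i, j) = true) ∨ ∀ i, x (i, j) = false) → p x = 0) ∧
      (∀ z : Fin n → Bool, parity z = true → 1 - (1 / 2 : ℝ) ^ ((Λ + 1) ^ (c + 1)) ≤
        (∑ r : EvenString n, p fun q => xor (z q.2) (r.1 q.2)) / Fintype.card (EvenString n)) ∧
      ∀ z : Fin n → Bool, parity z = false →
        (∑ r : EvenString n, p fun q => xor (z q.2) (r.1 q.2)) / Fintype.card (EvenString n) ≤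
          (1 / 2 : ℝ) ^ ((Λ + 1) ^ (c + 1)) := by
  set w := 2 * (c + 1) + d with hw
  set q := Nat.sqrt Λ with hqdef
  set B := q ^ (2 * w + 1) with hB
  have h4w : 1 ≤ 4 ^ w := Nat.one_le_pow w 4 (by norm_num)
  have hq4 : 100 ≤ q := by omega
  have hn2 : 2 ^ Λ ≤ n := hΛn ▸ Nat.pow_log_le_self 2 (by omega)
  have hΛ1 : 1 ≤ Λ := by
    have : q ≤ Λ := Nat.sqrt_le_self Λ
    omega
  have hBn : B ≤ n := ((Nat.pow_le_pow_left (Nat.sqrt_le_self Λ) _).trans hΛ).trans hn2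
  have hBig : 100 * (Λ + 1) ^ w ≤ B := mul_pow_le_sqrt_pow hq
  have hB8 : 8 ≤ B := by
    have : 1 ≤ (Λ + 1) ^ w := Nat.one_le_pow _ _ (by omega)
    omega
  set g := (n - 1) / B + 1 with hg
  have hgB : g * B ≤ 2 * n := by
    have := Nat.div_mul_le_self (n - 1) B
    rw [hg, add_mul, one_mul]
    omega
  -- An integer substitute for `√g`, rounded up so that `g ≤ σ²` while still `σ² ≤ 4 g`.
  set σ := Nat.sqrt g + 1 with hσ
  have hg0 : 0 < g := Nat.succ_pos _
  have hs1 : 1 ≤ Nat.sqrt g := Nat.sqrt_pos.2 hg0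
  have hσ4 : σ ^ 2 ≤ 4 * g := by
    have := Nat.sqrt_le g
    rw [hσ]
    nlinarith
  have hgσ : g ≤ σ ^ 2 := by
    have := Nat.lt_succ_sqrt g
    rw [hσ, sq]
    exact this.le
  have hgn : 4 * g ≤ n := by
    have : g * 8 ≤ g * B := Nat.mul_le_mul_left _ hB8
    omega
  have hσn : σ ≤ n := by
    have : σ ≤ σ ^ 2 := Nat.le_self_pow (by norm_num) σ
    omega
  -- The exponent `c + 1` instead of `c` keeps `P ≥ Λ + 1` even for `c = 0`.
  have hnP : n ≤ 2 ^ ((Λ + 1) ^ (c + 1)) := by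
    have h1 : n ≤ 2 ^ (Λ + 1) := hΛn ▸ (Nat.lt_pow_succ_log_self (by norm_num) n).le
    exact h1.trans (Nat.pow_le_pow_right (by norm_num) (Nat.le_self_pow (by omega) _))
  have hP : 2 ≤ (Λ + 1) ^ (c + 1) :=
    le_trans (by omega : 2 ≤ Λ + 1) (Nat.le_self_pow (by omega) _)
  have hlogle : Real.logb 2 n ≤ (Λ : ℝ) + 1 := hΛn ▸ logb_le_log_add_one (by omega)
  have hrows := rows_le (c := c) (by omega) hgB hσ4 (by omega) hlogle
    (Real.logb_pos (by norm_num) (by exact_mod_cast by omega)) hBig hm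
  have hgad : ParityImpl (Fin q) 258 ((8 * q) ^ q * q + (q + 2)) := by
    simpa using ParityImpl.gadget (κ := Fin q) (by simp; omega)
  have htree := hgad.tree (by omega) (2 * w)
  have hfib : ∀ b, ParityImpl {i // block n B i = b} (258 * (2 * w + 1)) (n ^ 9) := by
    intro b
    obtain ⟨A, _, _, T, hA, hT, hTx⟩ := htree.of_card_le (κ := {i // block n B i = b})
      (by simpa using card_block_le (by omega) b)
    refine ⟨A, _, _, T, hA.trans ?_, hT, hTx⟩
    rw [Fintype.card_fin]
    have h1 := gadget_size_le (n := n) hqdef (by omega) hn2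
    have h2 : (4 * q) ^ (2 * w + 1) ≤ n ^ 2 := by
      calc (4 * q) ^ (2 * w + 1) ≤ (q ^ 2) ^ (2 * w + 1) :=
            Nat.pow_le_pow_left (by nlinarith) _
        _ = B ^ 2 := by rw [hB, ← pow_mul, ← pow_mul, mul_comm]
        _ ≤ n ^ 2 := Nat.pow_le_pow_left hBn 2
    have h3 := Nat.mul_le_mul h1 h2
    have h4 : n ^ 6 * n ^ 2 = n ^ 8 := by ring
    have h5 : n ^ 8 * 2 ≤ n ^ 9 := by
      rw [pow_succ n 8]
      exact Nat.mul_le_mul_left _ hn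
    have h6 : n ≤ n ^ 8 := Nat.le_self_pow (by norm_num) n
    have h7 : q ^ (2 * w + 1) ≤ n := hBn
    omega
  exact TestImpl.concentrated (by omega) (block n B) (block_surjective (by omega) (by omega)) hfib
    (by omega) hσn (by rwa [Fintype.card_fin]) hP hnP (by rwa [Fintype.card_fin])

/-- The verdict is exact and the same for all even shifts. The size is exponential in `n`, which is
harmless because it is applied only below a fixed threshold. -/
theorem TestImpl.small {m n : ℕ} [NeZero m] (hn : 2 ≤ n) {δ : ℝ} (hδ : 0 ≤ δ) :
    ∃ p : (Fin m × Fin n → Bool) → ℝ,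
      TestImpl p 270 (2 + (n + ((8 * n) ^ n * n + (n + 2)))) ∧
      (∀ x, (¬ ∀ j, (∀ i, x (i, j) = true) ∨ ∀ i, x (i, j) = false) → p x = 0) ∧
      (∀ z : Fin n → Bool, parity z = true → 1 - δ ≤
        (∑ r : EvenString n, p fun q => xor (z q.2) (r.1 q.2)) / Fintype.card (EvenString n)) ∧
      ∀ z : Fin n → Bool, parity z = false →
        (∑ r : EvenString n, p fun q => xor (z q.2) (r.1 q.2)) / Fintype.card (EvenString n) ≤ δ := by
  have hneM : Nonempty (Fin m) := ⟨0⟩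
  have hne : Nonempty (Fin n) := ⟨⟨0, by omega⟩⟩
  have hcard : (0 : ℝ) < Fintype.card (EvenString n) := by exact_mod_cast Fintype.card_pos
  have hgad : ParityImpl (Fin n) 258 ((8 * n) ^ n * n + (n + 2)) := by
    simpa using ParityImpl.gadget (κ := Fin n) (by simpa using hn)
  obtain ⟨p, hp, hp0, hp1⟩ := TestImpl.copiesParity (M := Fin m) hgad
  have hval : ∀ (z : Fin n → Bool) (r : EvenString n), (p fun q => xor (z q.2) (r.1 q.2)) =
      if parity z = true then 1 else 0 := by
    intro z r
    rw [hp1 fun i => xor (z i) (r.1 i), ones_xor_mod_two]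
    have h1 : ones r.1 % 2 = 0 := Nat.even_iff.1 r.2
    have h2 : (ones z + ones r.1) % 2 = weight z % 2 := by
      change _ = ones z % 2
      omega
    rw [h2, parity]
    simp
  refine ⟨p, by simpa using hp, hp0, fun z hz => ?_, fun z hz => ?_⟩
  · simp only [hval, hz, if_true, Finset.sum_const, Finset.card_univ, nsmul_eq_mul, mul_one,
      div_self hcard.ne']
    linarith
  · simp only [hval, hz, Bool.false_eq_true, if_false, Finset.sum_const_zero, zero_div]
    exact hδ

/-- As `n m ≥ 2`, the constant factor `2 (D + 1)` can be traded for the power `(n m) ^ (2 (D + 1))`.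
-/
theorem size_le_of_qubits {m n a D k E : ℕ} (C : Circuit (Qubits (Fin m × Fin n) a))
    (hmn : 2 ≤ n * m) (hd : C.depth ≤ D) (ha : a ≤ (n * m) ^ k + E) :
    C.size ≤ (n * m) ^ (k + 1 + 2 * (D + 1)) + (D + 1) * (E + 1) := by
  have h1 := C.size_le
  have hcard : Fintype.card (Qubits (Fin m × Fin n) a) = m * n + (a + 1) := by simp
  rw [hcard] at h1
  have h2 : C.size ≤ (D + 1) * (m * n + (a + 1)) := h1.trans (Nat.mul_le_mul_right _ (by omega))
  have h3 : n * m ≤ (n * m) ^ (k + 1) := Nat.le_self_pow (by omega) _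
  have h4 : (n * m) ^ k ≤ (n * m) ^ (k + 1) := Nat.pow_le_pow_right (by omega) (by omega)
  have h5 : 2 * (D + 1) ≤ (n * m) ^ (2 * (D + 1)) :=
    Nat.lt_two_pow_self.le.trans (Nat.pow_le_pow_left hmn _)
  have h6 : m * n + (a + 1) ≤ 2 * (n * m) ^ (k + 1) + (E + 1) := by
    rw [mul_comm m n]
    omega
  calc C.size ≤ (D + 1) * (2 * (n * m) ^ (k + 1) + (E + 1)) := h2.trans (Nat.mul_le_mul_left _ h6)
    _ = (n * m) ^ (k + 1) * (2 * (D + 1)) + (D + 1) * (E + 1) := by ring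
    _ ≤ (n * m) ^ (k + 1) * (n * m) ^ (2 * (D + 1)) + (D + 1) * (E + 1) :=
        Nat.add_le_add_right (Nat.mul_le_mul_left _ h5) _
    _ = (n * m) ^ (k + 1 + 2 * (D + 1)) + (D + 1) * (E + 1) := by rw [← pow_add]

end QAC

theorem theoremC4 (c d : ℕ) :
    ∃ D K : ℕ, ∀ n : ℕ, 2 ≤ n → ∀ (m : ℕ) [NeZero m],
      (n : ℝ) ^ (3 / 2 : ℝ) / (Real.logb 2 (n : ℝ)) ^ d ≤ (m : ℝ) →
      ∃ (a : ℕ) (C : QAC.EvenString n → QAC.Circuit (QAC.Qubits (Fin m × Fin n) a)),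
        (∀ r, (C r).depth ≤ D ∧ (C r).size ≤ (n * m) ^ K + K) ∧
        (∃ C₀ : QAC.Circuit (QAC.Qubits (Fin m × Fin n) a),
          ∀ r, (C r).layers = QAC.shiftLayer m a r.1 :: C₀.layers) ∧
        ∀ y : Fin m → Fin n → Bool,
          1 - (2 : ℝ) ^ (-(Real.logb 2 (n : ℝ)) ^ c) ≤
            (∑ r, QAC.outputProb (C r) (fun p => y p.1 p.2) (QAC.lift QAC.parity y)) /
              (Fintype.card (QAC.EvenString n) : ℝ) := by
  obtain ⟨Λ₀, hΛ₀⟩ := QAC.exists_threshold (2 * (c + 1) + d)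
  -- The summand 271 is the depth 270 of the circuit for small `n` plus the layer of NOT gates, so
  -- `D` bounds the depth in both cases.
  set D := 9 + 258 * (2 * (2 * (c + 1) + d) + 1) + 41 + 271 with hD
  set N := 2 ^ Λ₀ with hN
  -- The number of ancillas used by the small case at `n = N`; it is monotone in `n`, so it bounds
  -- all smaller cases.
  set E := 2 + (N + ((8 * N) ^ N * N + (N + 2))) with hE
  -- One `K` must serve both as exponent and as additive constant, so it is the sum of the two. The
  -- 11 is the degree of the ancilla bound for large `n`.
  refine ⟨D, (11 + 1 + 2 * (D + 1)) + (D + 1) * (E + 1), fun n hn m _ hm => ?_⟩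
  have hm0 : 0 < m := Nat.pos_of_ne_zero (NeZero.ne m)
  have hnm : n ≤ n * m := Nat.le_mul_of_pos_right n hm0
  have hsize : ∀ {a : ℕ} (C : QAC.Circuit (QAC.Qubits (Fin m × Fin n) a)), C.depth ≤ D →
      a ≤ (n * m) ^ 11 + E → C.size ≤ (n * m) ^ ((11 + 1 + 2 * (D + 1)) + (D + 1) * (E + 1)) +
        ((11 + 1 + 2 * (D + 1)) + (D + 1) * (E + 1)) := fun C hC ha =>
    (QAC.size_le_of_qubits C (by omega) hC ha).trans (Nat.add_le_add
      (Nat.pow_le_pow_right (by omega) (Nat.le_add_right _ _)) (Nat.le_add_left _ _))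
  rcases le_or_gt Λ₀ (Nat.log 2 n) with h | h
  · obtain ⟨hq, hΛ⟩ := hΛ₀ _ h
    obtain ⟨p, hp, h0, h1, h2⟩ := QAC.TestImpl.large hn rfl hq hΛ hm
    obtain ⟨a, ha, C, hd, hC₀, hC⟩ := hp.lift_parity (by positivity) h0 h1 h2
    have ha' : a ≤ (n * m) ^ 11 := by
      have h9 : 2 ^ 9 ≤ n ^ 9 := Nat.pow_le_pow_left hn 9
      have hn9 : n ≤ n ^ 9 := Nat.le_self_pow (by norm_num) n
      have h10 : n ^ 9 * 2 ≤ n ^ 10 := Nat.mul_le_mul_left (n ^ 9) hn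
      have hn1 : n + 6 ≤ n ^ 9 := by
        have h8 : n * 2 ^ 8 ≤ n ^ 9 := by
          rw [pow_succ' n 8]
          exact Nat.mul_le_mul_left n (Nat.pow_le_pow_left hn 8)
        omega
      calc a ≤ m * n * (n ^ 9 + n + 6) := ha
        _ ≤ n * m * (n * m) ^ 10 := by
          rw [mul_comm m n]
          exact Nat.mul_le_mul_left _
            ((by omega : n ^ 9 + n + 6 ≤ n ^ 10).trans (Nat.pow_le_pow_left hnm 10))
        _ = (n * m) ^ 11 := (pow_succ' _ _).symm
    have hdD : ∀ r, (C r).depth ≤ D := fun r => (hd r).trans (by omega)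
    exact ⟨a, C, fun r => ⟨hdD r, hsize _ (hdD r) (ha'.trans (Nat.le_add_right _ _))⟩, hC₀,
      fun y => (sub_le_sub_left (QAC.half_pow_le_rpow hn) 1).trans (hC y)⟩
  · have hnN : n ≤ N := (Nat.lt_pow_of_log_lt (by norm_num) h).le
    obtain ⟨p, hp, h0, h1, h2⟩ := QAC.TestImpl.small (m := m) hn
      (δ := (2 : ℝ) ^ (-(Real.logb 2 (n : ℝ)) ^ c)) (by positivity)
    obtain ⟨a, ha, C, hd, hC₀, hC⟩ := hp.lift_parity (by positivity) h0 h1 h2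
    have hpow : (8 * n) ^ n ≤ (8 * N) ^ N :=
      (Nat.pow_le_pow_left (Nat.mul_le_mul_left 8 hnN) n).trans
        (Nat.pow_le_pow_right (by omega) hnN)
    have hmul := Nat.mul_le_mul hpow hnN
    have ha' : a ≤ E := by omega
    have hdD : ∀ r, (C r).depth ≤ D := fun r => (hd r).trans (by omega)
    exact ⟨a, C, fun r => ⟨hdD r, hsize _ (hdD r) (ha'.trans (Nat.le_add_left _ _))⟩, hC₀, hC⟩
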